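/- Let $\mathbb{H}^2$ be the upper half-plane with metric $(dx^2+dy^2)/y^2$, let $\mathbb{H}^2\times\mathbb{R}$ carry the product metric, with vertical coordinate $t$, and let $\mathrm{Nil}_3=\mathbb{R}^3$ carry the metric $dx_1^2+dx_2^2+\bigl(dx_3+\tfrac12(x_2dx_1-x_1dx_2)\bigr)^2$. For $\alpha>0$ there is a function $\varphi=\varphi_\alpha:\mathbb{R}\to\mathbb{R}$ with $\varphi(0)=0$, $\varphi'=-\sqrt{\alpha^2+\cos^2\varphi}$. Put $\alpha_*=\sqrt{\alpha^2+1}$, $G(u)=-\int_0^u\frac{ds}{\alpha-\varphi'(s)}$, $f=\frac{\varphi'}{\alpha\alpha_*(\alpha-\varphi')}$, $z=u+iv\in\mathbb{C}$. Define the helicoidal surface $\mathcal{H}_\alpha:\mathbb{C}\to\mathrm{Nil}_3$ by $$x_1=\tfrac{G'}{\alpha}\cos\varphi\,\sinh(\alpha v),\qquad x_2=-G,\qquad x_3+\tfrac{x_1x_2}{2}=-\tfrac{G'}{\alpha}\sin\varphi\,\sinh(\alpha v),$$ and $X_\alpha=(x,y,t):\mathbb{C}\to\mathbb{H}^2\times\mathbb{R}$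 by $$y=\frac{e^{\alpha_*v}}{(f+\frac{\alpha_*}{\alpha})\cosh(\alpha v)+\sinh(\alpha v)},\qquad x=-\frac{\sin\varphi\,\cosh(\alpha v)}{\alpha_*(\alpha-\varphi')}\,y,\qquad t=\frac{\cos\varphi\,\cosh(\alpha v)}{\alpha(\varphi'-\alpha)},$$ and let $\mathcal{C}_\alpha=X_\alpha(\mathbb{C})$. Then for every $\alpha>0$: 1. $\mathcal{H}_\alpha$ is a conformal minimal immersion, $X_\alpha$ is a conformal immersion of constant mean curvature $\frac12$, and the two are sister immersions: they induce the same metric and have the same angle function, and, with $J$ the rotation by $\pi/2$ on the surface, the tangential parts $T,T'$ of the vertical unit Killing fields and the shape operators $S,S'$ of $\mathcal{H}_\alpha$, $X_\alpha$ satisfy $T'=JT$ and $S'=JS+\frac12\mathrm{Id}$. 2. $\mathcal{C}_\alpha$ is a properly embedded annulus of constant mean curvature $\frac12$, conformally equivalent to $\mathbb{C}\setminus\{0\}$. 3. $\mathcal{C}_\alpha$ is invariant under the reflection in the horizontal plane $\{t=0\}$ and under the reflections in the two orthogonal vertical planes over the geodesics $\{x=0\}$ and $\{x^2+y^2=1\}$.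 4. $\mathcal{C}_\alpha$ is a bigraph over some domain $\Omega\subset\mathbb{H}^2$: there is a smooth $w:\Omega\to(0,\infty)$ such that $\mathcal{C}_\alpha$ is the union of the graphs of $w$ and $-w$ and of $\partial\Omega\times\{0\}$. 5. $\mathcal{C}_\alpha$ is not invariant under any nontrivial one-parameter group of isometries of $\mathbb{H}^2\times\mathbb{R}$. Moreover, as $\alpha\to\infty$, the surfaces $\mathcal{C}_\alpha$ converge to the two horocylinders over the mutually tangent horocycles $\{y=1\}$ and $\{x^2+(y-\frac12)^2=\frac14\}$, both punctured at the point $(i,0)$. The convergence is smooth and with multiplicity one on each of them, on compact subsets of $(\mathbb{H}^2\times\mathbb{R})\setminus\{(i,0)\}$. -/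

import Mathlib

open scoped Matrix ContDiff

noncomputable section

/-! ## Surfaces in a coordinate domain of `ℝ³` with a Riemannian metric

A metric is given by its Gram matrix in the coordinate frame; a surface is parametrised by an open
subset of `ℂ`, with `u + i v` as real coordinates. -/

/-- The metric `g` at the point `p`, evaluated on the coordinate vectors `a` and `b`. -/
def metricInner (g : (Fin 3 → ℝ) → Matrix (Fin 3) (Fin 3) ℝ) (p a b : Fin 3 → ℝ) : ℝ :=
  a ⬝ᵥ (g p *ᵥ b)

/-- The partial derivative `∂ᵢ f` at `p`. -/
def partialDeriv (i : Fin 3) (f : (Fin 3 → ℝ) → ℝ) (p : Fin 3 → ℝ) : ℝ :=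
  fderiv ℝ f p (Pi.single i 1)

/-- The Christoffel symbol `Γᵏᵢⱼ` of the Levi-Civita connection of `g`. -/
def christoffel (g : (Fin 3 → ℝ) → Matrix (Fin 3) (Fin 3) ℝ) (k i j : Fin 3) (p : Fin 3 → ℝ) : ℝ :=
  (1 / 2) * ∑ l : Fin 3, (g p)⁻¹ k l *
    (partialDeriv i (fun q => g q j l) p + partialDeriv j (fun q => g q i l) p
      - partialDeriv l (fun q => g q i j) p)

/-- First fundamental form of `X` at `z`, on the tangent vectors `a b : ℂ` of the parameter
domain. -/
def firstForm (g : (Fin 3 → ℝ) → Matrix (Fin 3) (Fin 3) ℝ) (X : ℂ → Fin 3 → ℝ) (z a b : ℂ) : ℝ :=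
  metricInner g (X z) (fderiv ℝ X z a) (fderiv ℝ X z b)

/-- The ambient covariant derivative `∇_{dX(a)} dX(b)` along `X`, for constant `a b : ℂ`. -/
def covDeriv (g : (Fin 3 → ℝ) → Matrix (Fin 3) (Fin 3) ℝ) (X : ℂ → Fin 3 → ℝ) (z a b : ℂ) :
    Fin 3 → ℝ :=
  fun k => fderiv ℝ (fun w => fderiv ℝ X w b) z a k
    + ∑ i : Fin 3, ∑ j : Fin 3,
        christoffel g k i j (X z) * fderiv ℝ X z a i * fderiv ℝ X z b j

/-- Second fundamental form of `X` with respect to the normal vector `n` at `z`. -/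
def secondForm (g : (Fin 3 → ℝ) → Matrix (Fin 3) (Fin 3) ℝ) (X : ℂ → Fin 3 → ℝ) (n : Fin 3 → ℝ)
    (z a b : ℂ) : ℝ :=
  metricInner g (X z) (covDeriv g X z a b) n

/-- `n` is a unit normal vector of `X` at `z`. -/
def IsUnitNormalAt (g : (Fin 3 → ℝ) → Matrix (Fin 3) (Fin 3) ℝ) (X : ℂ → Fin 3 → ℝ)
    (n : Fin 3 → ℝ) (z : ℂ) : Prop :=
  metricInner g (X z) n n = 1 ∧ ∀ a : ℂ, metricInner g (X z) (fderiv ℝ X z a) n = 0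

/-- Mean curvature: half the trace of the second fundamental form with respect to the first. -/
def meanCurvature (g : (Fin 3 → ℝ) → Matrix (Fin 3) (Fin 3) ℝ) (X : ℂ → Fin 3 → ℝ)
    (n : Fin 3 → ℝ) (z : ℂ) : ℝ :=
  (secondForm g X n z 1 1 * firstForm g X z Complex.I Complex.I
      - 2 * secondForm g X n z 1 Complex.I * firstForm g X z 1 Complex.I
      + secondForm g X n z Complex.I Complex.I * firstForm g X z 1 1)
    / (2 * (firstForm g X z 1 1 * firstForm g X z Complex.I Complex.I
      - firstForm g X z 1 Complex.I ^ 2))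

/-- `X` is a smooth conformal immersion of the open set `D`. -/
def IsConformalImmersionOn (g : (Fin 3 → ℝ) → Matrix (Fin 3) (Fin 3) ℝ) (X : ℂ → Fin 3 → ℝ)
    (D : Set ℂ) : Prop :=
  ContDiffOn ℝ ∞ X D ∧ ∀ z ∈ D, 0 < firstForm g X z 1 1 ∧
    firstForm g X z 1 1 = firstForm g X z Complex.I Complex.I ∧ firstForm g X z 1 Complex.I = 0

/-- `X` has constant mean curvature `H` on `D`, for some continuous choice of unit normal. -/
def HasConstantMeanCurvatureOn (g : (Fin 3 → ℝ) → Matrix (Fin 3) (Fin 3) ℝ) (H : ℝ)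
    (X : ℂ → Fin 3 → ℝ) (D : Set ℂ) : Prop :=
  ∃ N : ℂ → Fin 3 → ℝ, ContinuousOn N D ∧
    ∀ z ∈ D, IsUnitNormalAt g X (N z) z ∧ meanCurvature g X (N z) z = H

/-! ## The two ambient spaces

In both of them the vertical unit Killing field is the third coordinate field. -/

/-- The metric `dx₁² + dx₂² + (dx₃ + (x₂ dx₁ - x₁ dx₂) / 2)²` of the Heisenberg group. -/
def nilMetric (p : Fin 3 → ℝ) : Matrix (Fin 3) (Fin 3) ℝ :=
  !![1, 0, 0; 0, 1, 0; 0, 0, 0] + Matrix.vecMulVec ![p 1 / 2, -p 0 / 2, 1] ![p 1 / 2, -p 0 / 2, 1]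

/-- The metric `(dx² + dy²) / y² + dt²` of `ℍ² × ℝ`, in half-plane coordinates `(x, y, t)`. -/
def hypProdMetric (p : Fin 3 → ℝ) : Matrix (Fin 3) (Fin 3) ℝ :=
  Matrix.diagonal ![1 / p 1 ^ 2, 1 / p 1 ^ 2, 1]

/-- `ℍ² × ℝ` as a metric space: the product distance
`dist (p, q)² = dist (p₁, q₁)² + dist (p₂, q₂)²`. -/
abbrev HypProd : Type := WithLp 2 (UpperHalfPlane × ℝ)

/-- The half-plane coordinates `(x, y, t)` of a point of `ℍ² × ℝ`. -/
def coords (p : HypProd) : Fin 3 → ℝ := ![p.fst.re, p.fst.im, p.snd]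

/-- The vertical unit Killing field (in both ambient spaces). -/
def vertical : Fin 3 → ℝ := ![0, 0, 1]

/-! ## Sister immersions -/

/-- `X : ℂ → Nil₃` and `Y : ℂ → ℍ² × ℝ` are sister immersions: `X` is minimal, `Y` has constant mean
curvature `1/2`, both are conformal, they induce the same metric, and, for the unit normals that
make `(∂ᵤ, ∂ᵥ, normal)` positively oriented, the angle functions agree, the tangential parts of the
vertical field satisfy `T' = J T`, and the shape operators satisfy `S' = J S + 1/2`, where `J` is
the rotation by `π/2` on the surface (multiplication by `i` in the conformal parameter). The last
two equations are written through `⟨J a, b⟩ = -⟨a, J b⟩`. -/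
def AreSisterImmersions (X Y : ℂ → Fin 3 → ℝ) : Prop :=
  (∀ z, 0 < Y z 1) ∧
  IsConformalImmersionOn nilMetric X Set.univ ∧
  IsConformalImmersionOn hypProdMetric Y Set.univ ∧
  HasConstantMeanCurvatureOn nilMetric 0 X Set.univ ∧
  HasConstantMeanCurvatureOn hypProdMetric (1 / 2) Y Set.univ ∧
  (∀ z a b, firstForm nilMetric X z a b = firstForm hypProdMetric Y z a b) ∧
  ∃ N N' : ℂ → Fin 3 → ℝ, ∀ z,
    IsUnitNormalAt nilMetric X (N z) z ∧
    IsUnitNormalAt hypProdMetric Y (N' z) z ∧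
    0 < (Matrix.of ![fderiv ℝ X z 1, fderiv ℝ X z Complex.I, N z]).det ∧
    0 < (Matrix.of ![fderiv ℝ Y z 1, fderiv ℝ Y z Complex.I, N' z]).det ∧
    metricInner nilMetric (X z) (N z) vertical = metricInner hypProdMetric (Y z) (N' z) vertical ∧
    (∀ a, metricInner hypProdMetric (Y z) (fderiv ℝ Y z a) vertical
      = -metricInner nilMetric (X z) (fderiv ℝ X z (Complex.I * a)) vertical) ∧
    (∀ a b, secondForm hypProdMetric Y (N' z) z a b
      = -secondForm nilMetric X (N z) z a (Complex.I * b)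
        + (1 / 2) * firstForm hypProdMetric Y z a b)

/-! ## The explicit surfaces -/

/-- `φ` is the (unique) solution of `φ'² = α² + cos² φ`, `φ(0) = 0`, `φ' < 0`. -/
def IsProfile (α : ℝ) (φ : ℝ → ℝ) : Prop :=
  φ 0 = 0 ∧ ∀ u, HasDerivAt φ (-√(α ^ 2 + Real.cos (φ u) ^ 2)) u

/-- The function `α - φ' = α + √(α² + cos² φ)`. -/
def profileDenom (α : ℝ) (φ : ℝ → ℝ) (u : ℝ) : ℝ := α + √(α ^ 2 + Real.cos (φ u) ^ 2)

/-- The function `G` with `G' = -1 / (α - φ')` and `G(0) = 0`. -/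
def profileG (α : ℝ) (φ : ℝ → ℝ) (u : ℝ) : ℝ := ∫ s in (0 : ℝ)..u, -(1 / profileDenom α φ s)

/-- The helicoidal minimal surface of `Nil₃`:
`x₁ = (G'/α) cos φ sinh (α v)`, `x₂ = -G`, `x₃ + x₁ x₂ / 2 = -(G'/α) sin φ sinh (α v)`. -/
def helicoidParam (α : ℝ) (φ : ℝ → ℝ) (z : ℂ) : Fin 3 → ℝ :=
  let G' := -(1 / profileDenom α φ z.re)
  let x₁ := G' / α * Real.cos (φ z.re) * Real.sinh (α * z.im)
  let x₂ := -profileG α φ z.re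
  let y₃ := -(G' / α) * Real.sin (φ z.re) * Real.sinh (α * z.im)
  ![x₁, x₂, y₃ - x₁ * x₂ / 2]

/-- The horizontal catenoid of `ℍ² × ℝ` in half-plane coordinates. With `α⋆ = √(α² + 1)` and
`f = φ' / (α α⋆ (α - φ'))`, and `X₁ = -sin φ cosh (α v) / (α⋆ (α - φ'))`,
`1 / (X₃ - X₂) = e^{α⋆ v} / ((f + α⋆/α) cosh (α v) + sinh (α v))` in the hyperboloid model,
the horizontal part is `(X₁, 1) / (X₃ - X₂)`; the height is `cos φ cosh (α v) / (α (φ' - α))`. -/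
def catenoidParam (α : ℝ) (φ : ℝ → ℝ) (z : ℂ) : Fin 3 → ℝ :=
  let u := z.re
  let v := z.im
  let α' := √(α ^ 2 + 1)
  let d := profileDenom α φ u
  let f := -√(α ^ 2 + Real.cos (φ u) ^ 2) / (α * α' * d)
  let X₁ := -(Real.sin (φ u) * Real.cosh (α * v)) / (α' * d)
  let y := Real.exp (α' * v) / ((f + α' / α) * Real.cosh (α * v) + Real.sinh (α * v))
  ![X₁ * y, y, -(Real.cos (φ u) * Real.cosh (α * v)) / (α * d)]

/-- The horizontal catenoid as a subset of `ℍ² × ℝ`. -/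
def horizontalCatenoid (α : ℝ) (φ : ℝ → ℝ) : Set HypProd :=
  {p | ∃ z : ℂ, coords p = catenoidParam α φ z}

/-! ## Geometric properties of subsets of `ℍ² × ℝ` -/

/-- `C` is a properly embedded annulus of constant mean curvature `H`, conformally equivalent to
`ℂ ∖ {0}`: it is the image of a proper injective smooth conformal immersion of `ℂ ∖ {0}`. -/
def IsProperlyEmbeddedCMCPuncturedPlane (H : ℝ) (C : Set HypProd) : Prop :=
  ∃ Y : ℂ → HypProd,
    IsConformalImmersionOn hypProdMetric (fun z => coords (Y z)) {0}ᶜ ∧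
    Set.InjOn Y {0}ᶜ ∧
    IsProperMap (fun z : ({0}ᶜ : Set ℂ) => Y z) ∧
    Y '' {0}ᶜ = C ∧
    HasConstantMeanCurvatureOn hypProdMetric H (fun z => coords (Y z)) {0}ᶜ

/-- Reflection in the horizontal plane `ℍ² × {0}`. -/
def reflectHorizontal (p : HypProd) : HypProd := WithLp.toLp 2 (p.fst, -p.snd)

/-- Reflection in the vertical plane over the geodesic `{Re z = 0}`: `(z, t) ↦ (-z̄, t)`. -/
def reflectImAxis (p : HypProd) : HypProd :=
  WithLp.toLp 2 (⟨-(starRingEnd ℂ) (p.fst : ℂ), by simpa using p.fst.im_pos⟩, p.snd)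

/-- Reflection in the vertical plane over the geodesic `{|z| = 1}`: `(z, t) ↦ (1 / z̄, t)`. -/
def reflectUnitCircle (p : HypProd) : HypProd :=
  WithLp.toLp 2 (⟨((starRingEnd ℂ) (p.fst : ℂ))⁻¹, by
    have h : 0 < Complex.normSq (p.fst : ℂ) := Complex.normSq_pos.2 p.fst.ne_zero
    simpa [Complex.inv_im] using div_pos p.fst.im_pos h⟩, p.snd)

/-- `C` is a bigraph over `Ω ⊆ ℍ²`, symmetric in the plane `ℍ² × {0}`: the union of the graphs of
`w` and `-w` for a smooth positive function `w` on `Ω`, glued along `∂Ω` at height `0`. -/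
def IsBigraphOver (Ω : Set UpperHalfPlane) (C : Set HypProd) : Prop :=
  ∃ w : ℂ → ℝ, ContDiffOn ℝ ∞ w (UpperHalfPlane.coe '' Ω) ∧ (∀ z ∈ Ω, 0 < w (z : ℂ)) ∧
    C = {p | (p.fst ∈ Ω ∧ (p.snd = w (p.fst : ℂ) ∨ p.snd = -w (p.fst : ℂ))) ∨
      (p.fst ∈ frontier Ω ∧ p.snd = 0)}

/-- `C` is invariant under some nontrivial (continuous) one-parameter group of isometries. -/
def IsInvariantUnderOneParameterGroup (C : Set HypProd) : Prop :=
  ∃ Φ : Multiplicative ℝ →* (HypProd ≃ᵢ HypProd),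
    (∀ p, Continuous fun s : ℝ => Φ (Multiplicative.ofAdd s) p) ∧
    (∃ s, Φ s ≠ 1) ∧ ∀ s, (Φ s : HypProd → HypProd) '' C = C

/-! ## Convergence -/

/-- The two horocylinders over the horocycles `{Im z = 1}` and `{|z - i/2| = 1/2}`, which are
tangent to each other at `i`. -/
def horocylinder : Fin 2 → Set HypProd :=
  ![{p | p.fst.im = 1}, {p | ‖(p.fst : ℂ) - Complex.I / 2‖ = 1 / 2}]

/-- The point `(i, 0)`, which lies on both horocylinders. -/
def contactPoint : HypProd := WithLp.toLp 2 (UpperHalfPlane.I, 0)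

/-- As `α → ∞` the surfaces `C α` converge smoothly on compact subsets of `M ∖ {o}`,
`M = ℍ² × ℝ`, to the punctured surfaces `S i ∖ {o}`, `i = 0, 1`, each with multiplicity one. Here
`Z i` parametrises `S i ∖ {o}` by `ℂ ∖ {0}`, and the `Y i α` parametrise pieces of `C α`. -/
def ConvergesToPunctured (C : ℝ → Set HypProd) (S : Fin 2 → Set HypProd) (o : HypProd) : Prop :=
  ∃ (Z : Fin 2 → ℂ → HypProd) (Y : Fin 2 → ℝ → ℂ → HypProd),
    -- the limit parametrisations are embeddings onto the punctured surfaces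
    (∀ i, IsConformalImmersionOn hypProdMetric (fun z => coords (Z i z)) {0}ᶜ ∧
      Topology.IsEmbedding (fun z : ({0}ᶜ : Set ℂ) => Z i z) ∧ Z i '' {0}ᶜ = S i \ {o}) ∧
    -- locally uniform convergence of all derivatives
    (∀ i, ∀ᶠ α in Filter.atTop, ContDiffOn ℝ ∞ (fun z => coords (Y i α z)) {0}ᶜ) ∧
    (∀ i, ∀ k : ℕ, TendstoLocallyUniformlyOn
      (fun α => iteratedFDeriv ℝ k (fun z => coords (Y i α z)))
      (iteratedFDeriv ℝ k (fun z => coords (Z i z))) Filter.atTop {0}ᶜ) ∧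
    -- the pieces lie in the surfaces, are embedded and disjoint
    (∀ L : Set ℂ, IsCompact L → L ⊆ {0}ᶜ → ∀ᶠ α in Filter.atTop,
      (∀ i, Y i α '' L ⊆ C α) ∧
      ∀ i j, ∀ z ∈ L, ∀ w ∈ L, Y i α z = Y j α w → i = j ∧ z = w) ∧
    -- nothing else of the surfaces remains in a compact set that avoids `o`
    (∀ K : Set HypProd, IsCompact K → o ∉ K → ∃ L : Set ℂ, IsCompact L ∧ L ⊆ {0}ᶜ ∧
      ∀ᶠ α in Filter.atTop, C α ∩ K ⊆ ⋃ i, Y i α '' L)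

end

/-!
The proof is explicit. Write `a = √(α² + 1)`, `d = α - φ'`, `C = cosh (α v)`, `S = sinh (α v)`,
and use on `ℍ²` the global coordinates `X = x / y` (the slope) and `log |z|`.

*The catenoid as a level set.* Along the catenoid `(a X, α t) = -(C / d) (sin φ, cos φ)`, while
`log |z| = a v - arsinh (S / √(1 + X²))` (`catenoidPoint`, `coords_catenoidPoint`). For fixed `X`
the latter is a strictly increasing bijection of `ℝ` (`logRadius_strictMono`,
`logRadius_surjective`), so `v` is a smooth function on `ℍ²`. As `d² = 2 α d + cos² φ`, also
`C / d` is a function of `X` and `v`, and since `φ` is onto `ℝ` the catenoid is the set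
`α² t² = sqHeight α X v` (`mem_horizontalCatenoid_iff`). The reflections change the signs of `t`,
`X` and `v`, so the symmetries can be read off, and the catenoid is a bigraph over the domain
`2 a α |X| < C` (`isBigraphOver_bigraphDomain`).

*The sister relation.* The Christoffel symbols are eliminated by Koszul's formula
(`secondForm_eq`). For the helicoidal surface one works with the contact form, for the catenoid
with the orthonormal frame `y ∂ₓ, y ∂_y, ∂ₜ`; in both cases the metric is `(C / d)² |dz|²` and the
second fundamental form is explicit (`secondForm_helicoidParam`, `secondForm_catenoidParam`), and
the relations between the two surfaces are identities in `cos φ`, `sin φ`, `C`, `S` and `d`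
(`areSisterImmersions`).

*The annulus.* Since `φ (u + P) = φ u - 2 π` for some `P > 0` (`exists_isProfile`), the catenoid
is parametrised by `ℂ ∖ {0}` through `u + i v = (P / 2 π i) log w`. The function `v` on `ℍ²` makes
this parametrisation proper and `(X, t, v)` make it injective. It is locally a holomorphic
reparametrisation, under which conformality and mean curvature persist
(`isProperlyEmbeddedCMCPuncturedPlane`).

*No one-parameter symmetry.* The fibres of `ℍ² × ℝ → ℍ²` are metric invariants: `p` and `q` lie in
the same fibre exactly when they satisfy the parallelogram law with every third point
(`isParallelogramPair_iff`), which is seen through Busemann functions. Hence an isometry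
preserving the catenoid preserves its section at height `0`; a one-parameter group fixes the two
nearest points of the two components of this section, and then everything
(`not_isInvariantUnderOneParameterGroup`).

*The limit.* In the parameter `ζ = tanh (α v) (X + i t)` the half `v > 0` of the catenoid is
parametrised by `ℂ ∖ {0}`, by a map that depends smoothly on `ζ`, on `1 / α` and on one further
quantity that tends to `0` (`sheetPoint`, `contDiffOn_sheet`). All derivatives therefore converge
locally uniformly to those of the horocylinder `{y = 1}`; the half `v < 0` is the mirror image. A
point of the catenoid for which `ζ` is small is close to `(i, 0)`, because then `log |z|` is at
most of the order of `1 / α` plus the square of the slope (`exists_compact_sheet`).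
-/

noncomputable section

/-! ### The profile function -/

lemma profile_radicand_pos {α : ℝ} (hα : 0 < α) (θ : ℝ) : 0 < α ^ 2 + Real.cos θ ^ 2 := by
  positivity

lemma contDiff_profile_speed {α : ℝ} (hα : 0 < α) :
    ContDiff ℝ ∞ fun θ : ℝ => √(α ^ 2 + Real.cos θ ^ 2) := by
  refine ContDiff.sqrt (by fun_prop) fun θ => (profile_radicand_pos hα θ).ne'

lemma IsProfile.contDiff {α : ℝ} (hα : 0 < α) {φ : ℝ → ℝ} (h : IsProfile α φ) :
    ContDiff ℝ ∞ φ := by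
  rw [contDiff_infty]
  have hd : deriv φ = fun u => -√(α ^ 2 + Real.cos (φ u) ^ 2) := by
    ext u; exact (h.2 u).deriv
  intro n
  induction n with
  | zero =>
    exact contDiff_zero.2 (continuous_iff_continuousAt.2 fun u => (h.2 u).continuousAt)
  | succ n ih =>
    push_cast
    rw [contDiff_succ_iff_deriv]
    refine ⟨fun u => (h.2 u).differentiableAt, by simp, ?_⟩
    rw [hd]
    exact ((((contDiff_profile_speed hα).of_le (by exact_mod_cast le_top)).comp ih).neg)

lemma IsProfile.strictAnti {α : ℝ} (hα : 0 < α) {φ : ℝ → ℝ} (h : IsProfile α φ) :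
    StrictAnti φ := by
  refine strictAnti_of_deriv_neg fun u => ?_
  rw [(h.2 u).deriv]
  exact neg_neg_of_pos (Real.sqrt_pos.2 (profile_radicand_pos hα _))

/-- The profile is the inverse of the strictly monotone function
`θ ↦ -∫₀^θ ds / √(α² + cos² s)`; it is onto, and shifts by `-2π` over a period. -/
theorem exists_isProfile {α : ℝ} (hα : 0 < α) :
    ∃ φ : ℝ → ℝ, IsProfile α φ ∧ Function.Surjective φ ∧
      ∃ P : ℝ, 0 < P ∧ ∀ u, φ (u + P) = φ u - 2 * Real.pi := by
  set k : ℝ → ℝ := fun θ => 1 / √(α ^ 2 + Real.cos θ ^ 2) with hk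
  have kpos : ∀ θ, 0 < k θ := fun θ => by
    have := Real.sqrt_pos.2 (profile_radicand_pos hα θ); positivity
  have kcont : Continuous k := by
    refine continuous_const.div (contDiff_profile_speed hα).continuous fun θ => ?_
    exact (Real.sqrt_pos.2 (profile_radicand_pos hα θ)).ne'
  set g : ℝ → ℝ := fun θ => ∫ s in (0 : ℝ)..θ, k s with hg
  have gder : ∀ θ, HasDerivAt g (k θ) θ := fun θ =>
    intervalIntegral.integral_hasDerivAt_right (kcont.intervalIntegrable _ _)
      (kcont.stronglyMeasurableAtFilter _ _) kcont.continuousAt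
  have g0 : g 0 = 0 := by simp [hg]
  have gcont : Continuous g := continuous_iff_continuousAt.2 fun θ => (gder θ).continuousAt
  have gmono : StrictMono g := strictMono_of_deriv_pos fun θ => by rw [(gder θ).deriv]; exact kpos θ
  set P := g (2 * Real.pi) with hP
  have Ppos : 0 < P := by rw [← g0, hP]; exact gmono (by positivity)
  have gper : ∀ θ, g (θ + 2 * Real.pi) = g θ + P := by
    have hder : ∀ θ, HasDerivAt (fun θ => g (θ + 2 * Real.pi) - g θ) 0 θ := fun θ => by
      have h1 := (gder (θ + 2 * Real.pi)).comp_add_const θ (2 * Real.pi)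
      have h2 := h1.sub (gder θ)
      have : k (θ + 2 * Real.pi) - k θ = 0 := by simp [hk]
      rwa [this] at h2
    intro θ
    have := is_const_of_deriv_eq_zero (fun θ => (hder θ).differentiableAt)
      (fun θ => (hder θ).deriv) θ 0
    simp only [zero_add, g0, sub_zero] at this
    linarith
  -- the integrand is at least `1 / √(α² + 1)`, so `g` is onto
  set m := 1 / √(α ^ 2 + 1) with hm
  have mpos : 0 < m := by positivity
  have hlin : ∀ θ, HasDerivAt (fun θ => g θ - m * θ) (k θ - m) θ := fun θ => by
    have h := (gder θ).fun_sub ((hasDerivAt_id' θ).const_mul m)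
    rwa [mul_one] at h
  have hmono : Monotone fun θ => g θ - m * θ := by
    refine monotone_of_deriv_nonneg ?_ fun θ => ?_
    · exact fun θ => (hlin θ).differentiableAt
    · rw [(hlin θ).deriv, sub_nonneg]
      have := Real.sqrt_pos.2 (profile_radicand_pos hα θ)
      exact one_div_le_one_div_of_le this
        (Real.sqrt_le_sqrt (by nlinarith [Real.cos_sq_le_one θ]))
  have gsurj : Function.Surjective g := by
    refine gcont.surjective ?_ ?_
    · refine Filter.tendsto_atTop_mono' _ ?_ (Filter.tendsto_id.const_mul_atTop mpos)
      filter_upwards [Filter.eventually_ge_atTop 0] with θ hθ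
      have := hmono hθ
      simp only [g0, mul_zero, sub_zero] at this
      simpa using this
    · refine Filter.tendsto_atBot_mono' _ ?_ (Filter.tendsto_id.const_mul_atBot mpos)
      filter_upwards [Filter.eventually_le_atBot 0] with θ hθ
      have := hmono hθ
      simp only [g0, mul_zero, sub_zero] at this
      simpa using this
  let e : ℝ ≃o ℝ := gmono.orderIsoOfSurjective g gsurj
  have he : ∀ θ, e θ = g θ := fun θ => rfl
  have hge : ∀ u, g (e.symm u) = u := fun u => e.apply_symm_apply u
  refine ⟨fun u => e.symm (-u), ⟨?_, fun u => ?_⟩, ?_, P, Ppos, fun u => ?_⟩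
  · apply gmono.injective; rw [hge, g0, neg_zero]
  · have h1 : HasDerivAt e.symm (k (e.symm (-u)))⁻¹ (-u) :=
      HasDerivAt.of_local_left_inverse e.symm.continuous.continuousAt (gder _) (kpos _).ne'
        (Filter.Eventually.of_forall hge)
    have h2 := h1.scomp u (hasDerivAt_neg u)
    simp only [hk, smul_eq_mul, one_div, inv_inv, neg_one_mul] at h2
    exact h2
  · intro θ
    exact ⟨-g θ, by simp only [neg_neg]; exact e.symm_apply_apply θ⟩
  · apply gmono.injective
    have := gper (e.symm (-(u + P)))
    rw [hge] at this
    have h3 := gper (e.symm (-u) - 2 * Real.pi)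
    rw [sub_add_cancel, hge] at h3
    rw [hge]; linarith

/-! ### Global coordinates on the half-plane and an implicit equation of the catenoid -/

/-- The quotient `x / y`: the hyperbolic sine of the signed distance to the geodesic `{x = 0}`. -/
def axialSlope (z : ℂ) : ℝ := z.re / z.im

/-- On a curve of constant slope `X`, the value of `log |z|` that corresponds to the conformal
parameter `v` of the catenoid. -/
def logRadius (α X v : ℝ) : ℝ :=
  √(α ^ 2 + 1) * v - Real.arsinh (Real.sinh (α * v) / √(1 + X ^ 2))

/-- The value of `α² t²` on the catenoid, as a function of the slope `X` and of the conformal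
parameter `v`; where it is negative the catenoid has no point. -/
def sqHeight (α X v : ℝ) : ℝ :=
  Real.cosh (α * v) * ((2 * α ^ 2 + 1) * Real.cosh (α * v)
    - 2 * √(α ^ 2 + 1) * α * √(Real.cosh (α * v) ^ 2 + X ^ 2))

/-- The point of the half-plane with slope `X` and `log |z| = l`. -/
def polarPoint (X l : ℝ) : UpperHalfPlane :=
  ⟨⟨X * (Real.exp l / √(1 + X ^ 2)), Real.exp l / √(1 + X ^ 2)⟩, by
    change 0 < Real.exp l / √(1 + X ^ 2); positivity⟩

lemma polarPoint_re (X l : ℝ) : (polarPoint X l).re = X * (Real.exp l / √(1 + X ^ 2)) := rfl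

lemma polarPoint_im (X l : ℝ) : (polarPoint X l).im = Real.exp l / √(1 + X ^ 2) := rfl

lemma polarPoint_coe_re (X l : ℝ) :
    (polarPoint X l : ℂ).re = X * (Real.exp l / √(1 + X ^ 2)) := rfl

lemma polarPoint_coe_im (X l : ℝ) : (polarPoint X l : ℂ).im = Real.exp l / √(1 + X ^ 2) := rfl

@[simp] lemma slope_polarPoint (X l : ℝ) : axialSlope (polarPoint X l) = X := by
  rw [axialSlope, polarPoint_coe_re, polarPoint_coe_im, mul_div_assoc, div_self, mul_one]
  positivity

lemma norm_eq_im_mul (z : UpperHalfPlane) : ‖(z : ℂ)‖ = z.im * √(1 + axialSlope z ^ 2) := by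
  have h := z.im_pos
  rw [Complex.norm_eq_sqrt_sq_add_sq, ← Real.sqrt_sq h.le, ← Real.sqrt_mul (sq_nonneg _)]
  congr 1
  simp only [axialSlope, UpperHalfPlane.coe_re, UpperHalfPlane.coe_im]
  field_simp
  ring

@[simp] lemma log_norm_polarPoint (X l : ℝ) : Real.log ‖(polarPoint X l : ℂ)‖ = l := by
  rw [norm_eq_im_mul, slope_polarPoint, polarPoint_im, div_mul_cancel₀ _ (by positivity),
    Real.log_exp]

lemma polarPoint_slope_log_norm (z : UpperHalfPlane) :
    polarPoint (axialSlope z) (Real.log ‖(z : ℂ)‖) = z := by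
  have h := z.im_pos
  have hn : 0 < ‖(z : ℂ)‖ := norm_pos_iff.2 z.ne_zero
  have him : Real.exp (Real.log ‖(z : ℂ)‖) / √(1 + axialSlope z ^ 2) = z.im := by
    rw [Real.exp_log hn, norm_eq_im_mul, mul_div_assoc, div_self (by positivity), mul_one]
  apply UpperHalfPlane.ext
  apply Complex.ext
  · rw [polarPoint_coe_re, him, axialSlope, UpperHalfPlane.coe_im, div_mul_cancel₀ _ h.ne']
  · rw [polarPoint_coe_im, him]; rfl

lemma continuous_slope : Continuous fun z : UpperHalfPlane => axialSlope z := by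
  unfold axialSlope
  exact UpperHalfPlane.continuous_re.div UpperHalfPlane.continuous_im fun z => z.im_pos.ne'

lemma continuous_log_norm : Continuous fun z : UpperHalfPlane => Real.log ‖(z : ℂ)‖ :=
  (UpperHalfPlane.continuous_coe.norm).log fun z => (norm_pos_iff.2 z.ne_zero).ne'

lemma continuous_polarPoint : Continuous fun p : ℝ × ℝ => polarPoint p.1 p.2 := by
  have h : ∀ p : ℝ × ℝ, √(1 + p.1 ^ 2) ≠ 0 := fun p => by positivity
  refine UpperHalfPlane.isEmbedding_coe.continuous_iff.2 ?_
  have : (UpperHalfPlane.coe ∘ fun p : ℝ × ℝ => polarPoint p.1 p.2) = fun p : ℝ × ℝ =>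
      ((p.1 * (Real.exp p.2 / √(1 + p.1 ^ 2)) : ℝ) : ℂ)
        + ((Real.exp p.2 / √(1 + p.1 ^ 2) : ℝ) : ℂ) * Complex.I := by
    ext p
    exact Complex.mk_eq_add_mul_I _ _
  rw [this]
  have h1 : Continuous fun p : ℝ × ℝ => Real.exp p.2 / √(1 + p.1 ^ 2) :=
    Continuous.div (by fun_prop) (by fun_prop) h
  fun_prop

/-! ### The function `logRadius` -/

lemma lt_sqrt_sq_add_one (α : ℝ) : α < √(α ^ 2 + 1) :=
  Real.lt_sqrt_of_sq_lt (by linarith)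

lemma sq_sqrt_sq_add_one (α : ℝ) : √(α ^ 2 + 1) ^ 2 = α ^ 2 + 1 := Real.sq_sqrt (by positivity)

lemma logRadius_neg (α X v : ℝ) : logRadius α X (-v) = -logRadius α X v := by
  simp only [logRadius, mul_neg, Real.sinh_neg, neg_div, Real.arsinh_neg]; ring

lemma logRadius_neg_slope (α X v : ℝ) : logRadius α (-X) v = logRadius α X v := by
  simp [logRadius]

@[simp] lemma logRadius_zero (α X : ℝ) : logRadius α X 0 = 0 := by simp [logRadius]

/-- The derivative of `logRadius` in `v`; it is at least `√(α² + 1) - α > 0`. -/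
def logRadiusDeriv (α X v : ℝ) : ℝ :=
  √(α ^ 2 + 1) - α * (Real.cosh (α * v) / √(Real.cosh (α * v) ^ 2 + X ^ 2))

lemma hasDerivAt_logRadius (α X v : ℝ) :
    HasDerivAt (logRadius α X) (logRadiusDeriv α X v) v := by
  have h1 : HasDerivAt (fun v => Real.sinh (α * v) / √(1 + X ^ 2))
      (Real.cosh (α * v) * α / √(1 + X ^ 2)) v := by
    have := ((hasDerivAt_id' v).const_mul α).sinh.div_const (√(1 + X ^ 2))
    rwa [mul_one] at this
  have h2 := ((hasDerivAt_id' v).const_mul √(α ^ 2 + 1)).fun_sub h1.arsinh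
  have hB : (0 : ℝ) < 1 + X ^ 2 := by positivity
  have hC : (0 : ℝ) < Real.cosh (α * v) ^ 2 + X ^ 2 := by positivity
  have h3 : √(1 + (Real.sinh (α * v) / √(1 + X ^ 2)) ^ 2)
      = √(Real.cosh (α * v) ^ 2 + X ^ 2) / √(1 + X ^ 2) := by
    rw [← Real.sqrt_div hC.le]
    congr 1
    rw [div_pow, Real.sq_sqrt hB.le, Real.cosh_sq]
    field_simp
    ring
  refine h2.congr_deriv ?_
  rw [h3, logRadiusDeriv, smul_eq_mul]
  have h4 := Real.sqrt_pos.2 hB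
  have h5 := Real.sqrt_pos.2 hC
  field_simp

lemma logRadiusDeriv_ge {α : ℝ} (hα : 0 < α) (X v : ℝ) :
    √(α ^ 2 + 1) - α ≤ logRadiusDeriv α X v := by
  have hc := Real.cosh_pos (α * v)
  have : Real.cosh (α * v) / √(Real.cosh (α * v) ^ 2 + X ^ 2) ≤ 1 := by
    rw [div_le_one (by positivity)]
    exact Real.le_sqrt_of_sq_le (by nlinarith [sq_nonneg X])
  unfold logRadiusDeriv
  nlinarith

lemma logRadiusDeriv_pos {α : ℝ} (hα : 0 < α) (X v : ℝ) : 0 < logRadiusDeriv α X v :=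
  lt_of_lt_of_le (sub_pos.2 (lt_sqrt_sq_add_one α)) (logRadiusDeriv_ge hα X v)

lemma logRadius_strictMono {α : ℝ} (hα : 0 < α) (X : ℝ) : StrictMono (logRadius α X) :=
  strictMono_of_deriv_pos fun v => by
    rw [(hasDerivAt_logRadius α X v).deriv]; exact logRadiusDeriv_pos hα X v

lemma logRadius_surjective {α : ℝ} (hα : 0 < α) (X : ℝ) : Function.Surjective (logRadius α X) := by
  set m := √(α ^ 2 + 1) - α with hm
  have mpos : 0 < m := sub_pos.2 (lt_sqrt_sq_add_one α)
  have hlin : ∀ v, HasDerivAt (fun v => logRadius α X v - m * v) (logRadiusDeriv α X v - m) v :=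
    fun v => by
      have h := (hasDerivAt_logRadius α X v).fun_sub ((hasDerivAt_id' v).const_mul m)
      rwa [mul_one] at h
  have hmono : Monotone fun v => logRadius α X v - m * v := by
    refine monotone_of_deriv_nonneg (fun v => (hlin v).differentiableAt) fun v => ?_
    rw [(hlin v).deriv, sub_nonneg]
    exact logRadiusDeriv_ge hα X v
  have hcont : Continuous (logRadius α X) :=
    continuous_iff_continuousAt.2 fun v => (hasDerivAt_logRadius α X v).continuousAt
  refine hcont.surjective ?_ ?_
  · refine Filter.tendsto_atTop_mono' _ ?_ (Filter.tendsto_id.const_mul_atTop mpos)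
    filter_upwards [Filter.eventually_ge_atTop 0] with v hv
    have := hmono hv
    simpa using this
  · refine Filter.tendsto_atBot_mono' _ ?_ (Filter.tendsto_id.const_mul_atBot mpos)
    filter_upwards [Filter.eventually_le_atBot 0] with v hv
    have := hmono hv
    simpa using this

lemma contDiff_logRadius (α : ℝ) : ContDiff ℝ ∞ fun p : ℝ × ℝ => logRadius α p.1 p.2 := by
  unfold logRadius
  have h : ∀ p : ℝ × ℝ, (1 + p.1 ^ 2) ≠ 0 := fun p => by positivity
  have h1 : ContDiff ℝ ∞ fun p : ℝ × ℝ => √(1 + p.1 ^ 2) := ContDiff.sqrt (by fun_prop) h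
  have h2 : ContDiff ℝ ∞ fun p : ℝ × ℝ => Real.sinh (α * p.2) / √(1 + p.1 ^ 2) :=
    ContDiff.div (by fun_prop) h1 fun p => by positivity
  exact ContDiff.sub (by fun_prop) (Real.contDiff_arsinh.comp h2)

/-- The ordinate of a point in terms of its slope and of `v`; on the catenoid this is the formula
that defines `y`. -/
lemma exp_logRadius (α X v : ℝ) :
    Real.exp (logRadius α X v) / √(1 + X ^ 2) = Real.exp (√(α ^ 2 + 1) * v)
      / (Real.sinh (α * v) + √(Real.cosh (α * v) ^ 2 + X ^ 2)) := by
  have hB : (0 : ℝ) < 1 + X ^ 2 := by positivity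
  have hC : (0 : ℝ) < Real.cosh (α * v) ^ 2 + X ^ 2 := by positivity
  have h3 : √(1 + (Real.sinh (α * v) / √(1 + X ^ 2)) ^ 2)
      = √(Real.cosh (α * v) ^ 2 + X ^ 2) / √(1 + X ^ 2) := by
    rw [← Real.sqrt_div hC.le]
    congr 1
    rw [div_pow, Real.sq_sqrt hB.le, Real.cosh_sq]
    field_simp
    ring
  have h4 := Real.sqrt_pos.2 hB
  rw [logRadius, Real.exp_sub, Real.exp_arsinh, h3, ← add_div, div_div, div_mul_cancel₀ _ h4.ne']

/-- The conformal parameter `v`, as a function of the slope and of `log |z|`. -/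
def conformalParam {α : ℝ} (hα : 0 < α) (X l : ℝ) : ℝ :=
  (logRadius_surjective hα X l).choose

@[simp] lemma logRadius_conformalParam {α : ℝ} (hα : 0 < α) (X l : ℝ) :
    logRadius α X (conformalParam hα X l) = l := (logRadius_surjective hα X l).choose_spec

@[simp] lemma conformalParam_logRadius {α : ℝ} (hα : 0 < α) (X v : ℝ) :
    conformalParam hα X (logRadius α X v) = v :=
  (logRadius_strictMono hα X).injective (logRadius_conformalParam hα X _)

/-- A left inverse of an injective immersion between spaces of equal finite dimension is smooth. -/
lemma contDiffAt_leftInverse {E : Type*} [NormedAddCommGroup E] [NormedSpace ℝ E]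
    [FiniteDimensional ℝ E] {f g : E → E} (hf : ContDiff ℝ ∞ f) (hg : Function.LeftInverse g f)
    {x : E} (hx : Function.Injective (fderiv ℝ f x)) : ContDiffAt ℝ ∞ g (f x) := by
  have : CompleteSpace E := FiniteDimensional.complete ℝ E
  let e : E ≃L[ℝ] E := (LinearEquiv.ofInjectiveEndo
    (fderiv ℝ f x : E →ₗ[ℝ] E) hx).toContinuousLinearEquiv
  have he : HasFDerivAt f (e : E →L[ℝ] E) x :=
    (hf.differentiable (by simp)).differentiableAt.hasFDerivAt
  have hn : (∞ : WithTop ℕ∞) ≠ 0 := by simp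
  have hloc := hf.contDiffAt.to_localInverse he hn
  refine hloc.congr_of_eventuallyEq ?_
  have hs := hf.contDiffAt.hasStrictFDerivAt' he hn
  filter_upwards [hs.eventually_right_inverse] with y hy
  conv_lhs => rw [← hy]
  exact hg _

lemma contDiff_conformalParam {α : ℝ} (hα : 0 < α) :
    ContDiff ℝ ∞ fun p : ℝ × ℝ => conformalParam hα p.1 p.2 := by
  set f : ℝ × ℝ → ℝ × ℝ := fun p => (p.1, logRadius α p.1 p.2) with hf
  set g : ℝ × ℝ → ℝ × ℝ := fun p => (p.1, conformalParam hα p.1 p.2) with hg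
  have hfs : ContDiff ℝ ∞ f := contDiff_fst.prodMk (contDiff_logRadius α)
  have hgf : Function.LeftInverse g f := fun p => by simp [hf, hg]
  have hfg : ∀ p, f (g p) = p := fun p => by simp [hf, hg]
  suffices h : ContDiff ℝ ∞ g from contDiff_snd.comp h
  rw [contDiff_iff_contDiffAt]
  intro p
  rw [← hfg p]
  refine contDiffAt_leftInverse hfs hgf ?_
  set x := g p
  rw [injective_iff_map_eq_zero]
  intro h hh
  have hL := ((contDiff_logRadius α).differentiable (by simp)).differentiableAt (x := x)
  have hd : HasFDerivAt f ((ContinuousLinearMap.fst ℝ ℝ ℝ).prod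
      (fderiv ℝ (fun p : ℝ × ℝ => logRadius α p.1 p.2) x)) x :=
    hasFDerivAt_fst.prodMk hL.hasFDerivAt
  rw [hd.fderiv] at hh
  have h1 : h.1 = 0 := congrArg Prod.fst hh
  have h2 : fderiv ℝ (fun p : ℝ × ℝ => logRadius α p.1 p.2) x h = 0 := congrArg Prod.snd hh
  have h3 : HasDerivAt (fun v => logRadius α x.1 v)
      (fderiv ℝ (fun p : ℝ × ℝ => logRadius α p.1 p.2) x (0, 1)) x.2 := by
    have hline : HasDerivAt (fun v : ℝ => (x.1, v)) ((0 : ℝ), (1 : ℝ)) x.2 :=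
      (hasDerivAt_const _ _).prodMk (hasDerivAt_id _)
    exact HasFDerivAt.comp_hasDerivAt x.2 (f := fun v : ℝ => (x.1, v)) hL.hasFDerivAt hline
  have h4 := h3.unique (hasDerivAt_logRadius α x.1 x.2)
  have h5 : h = h.2 • ((0 : ℝ), (1 : ℝ)) := by ext <;> simp [h1]
  rw [h5, map_smul, h4, smul_eq_mul] at h2
  have := (mul_eq_zero.1 h2).resolve_right (logRadiusDeriv_pos hα _ _).ne'
  ext <;> simp [h1, this]

/-! ### The catenoid in the global coordinates -/

lemma profileDenom_pos {α : ℝ} (hα : 0 < α) (φ : ℝ → ℝ) (u : ℝ) : 0 < profileDenom α φ u := by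
  unfold profileDenom; positivity

lemma profileDenom_sq {α : ℝ} (φ : ℝ → ℝ) (u : ℝ) :
    profileDenom α φ u ^ 2 = 2 * α * profileDenom α φ u + Real.cos (φ u) ^ 2 := by
  have h := Real.sq_sqrt (show 0 ≤ α ^ 2 + Real.cos (φ u) ^ 2 by positivity)
  unfold profileDenom
  linear_combination h

/-- The slope `x / y` along the catenoid. -/
def catenoidSlope (α : ℝ) (φ : ℝ → ℝ) (z : ℂ) : ℝ :=
  -(Real.sin (φ z.re) * Real.cosh (α * z.im)) / (√(α ^ 2 + 1) * profileDenom α φ z.re)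

/-- The height along the catenoid. -/
def catenoidHeight (α : ℝ) (φ : ℝ → ℝ) (z : ℂ) : ℝ :=
  -(Real.cos (φ z.re) * Real.cosh (α * z.im)) / (α * profileDenom α φ z.re)

/-- The catenoid, as a map into `ℍ² × ℝ`. -/
def catenoidPoint (α : ℝ) (φ : ℝ → ℝ) (z : ℂ) : HypProd :=
  WithLp.toLp 2 (polarPoint (catenoidSlope α φ z) (logRadius α (catenoidSlope α φ z) z.im),
    catenoidHeight α φ z)

lemma catenoidPoint_fst (α : ℝ) (φ : ℝ → ℝ) (z : ℂ) : (catenoidPoint α φ z).fst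
    = polarPoint (catenoidSlope α φ z) (logRadius α (catenoidSlope α φ z) z.im) := rfl

lemma catenoidPoint_snd (α : ℝ) (φ : ℝ → ℝ) (z : ℂ) :
    (catenoidPoint α φ z).snd = catenoidHeight α φ z := rfl

lemma sqrt_cosh_sq_add_catenoidSlope_sq {α : ℝ} (hα : 0 < α) (φ : ℝ → ℝ) (z : ℂ) :
    √(Real.cosh (α * z.im) ^ 2 + catenoidSlope α φ z ^ 2)
      = (1 + α * profileDenom α φ z.re) / (√(α ^ 2 + 1) * profileDenom α φ z.re)
        * Real.cosh (α * z.im) := by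
  have hd := profileDenom_pos hα φ z.re
  have ha := sq_sqrt_sq_add_one α
  have hap : 0 < √(α ^ 2 + 1) := by positivity
  rw [Real.sqrt_eq_iff_mul_self_eq (by positivity) (by positivity), catenoidSlope]
  have h1 := profileDenom_sq (α := α) φ z.re
  have h2 := Real.sin_sq_add_cos_sq (φ z.re)
  field_simp
  linear_combination profileDenom α φ z.re ^ 2 * ha + h1 + h2

lemma catenoidParam_one {α : ℝ} (hα : 0 < α) (φ : ℝ → ℝ) (z : ℂ) :
    catenoidParam α φ z 1 = Real.exp (logRadius α (catenoidSlope α φ z) z.im)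
      / √(1 + catenoidSlope α φ z ^ 2) := by
  rw [exp_logRadius, sqrt_cosh_sq_add_catenoidSlope_sq hα]
  have hd := profileDenom_pos hα φ z.re
  have ha := sq_sqrt_sq_add_one α
  have hap : 0 < √(α ^ 2 + 1) := by positivity
  simp only [catenoidParam, Matrix.cons_val_one, Matrix.cons_val_zero]
  rw [add_comm (Real.sinh (α * z.im))]
  congr 3
  have hq : √(α ^ 2 + Real.cos (φ z.re) ^ 2) = profileDenom α φ z.re - α := by
    rw [profileDenom]; ring
  rw [hq]
  field_simp
  linear_combination (profileDenom α φ z.re) * ha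

lemma catenoidParam_zero (α : ℝ) (φ : ℝ → ℝ) (z : ℂ) :
    catenoidParam α φ z 0 = catenoidSlope α φ z * catenoidParam α φ z 1 := by
  simp [catenoidParam, catenoidSlope]

lemma catenoidParam_two (α : ℝ) (φ : ℝ → ℝ) (z : ℂ) :
    catenoidParam α φ z 2 = catenoidHeight α φ z := by
  simp [catenoidParam, catenoidHeight]

lemma coords_catenoidPoint {α : ℝ} (hα : 0 < α) (φ : ℝ → ℝ) (z : ℂ) :
    coords (catenoidPoint α φ z) = catenoidParam α φ z := by
  ext i
  fin_cases i
  · change (polarPoint _ _).re = catenoidParam α φ z 0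
    rw [catenoidParam_zero, catenoidParam_one hα, polarPoint_re]
  · change (polarPoint _ _).im = catenoidParam α φ z 1
    rw [catenoidParam_one hα, polarPoint_im]
  · exact (catenoidParam_two α φ z).symm

lemma coords_injective : Function.Injective coords := by
  intro p q h
  have h0 : p.fst.re = q.fst.re := congrFun h 0
  have h1 : p.fst.im = q.fst.im := congrFun h 1
  have h2 : p.snd = q.snd := congrFun h 2
  refine WithLp.ofLp_injective 2 (Prod.ext ?_ h2)
  exact UpperHalfPlane.ext (Complex.ext h0 h1)

lemma horizontalCatenoid_eq_range {α : ℝ} (hα : 0 < α) (φ : ℝ → ℝ) :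
    horizontalCatenoid α φ = Set.range (catenoidPoint α φ) := by
  ext p
  simp only [horizontalCatenoid, Set.mem_ofPred_eq, Set.mem_range]
  refine exists_congr fun z => ?_
  rw [← coords_catenoidPoint hα, coords_injective.eq_iff, eq_comm]

/-- The identity `1 / d = √(α² + 1) √(C² + X²) / C - α` that expresses the profile through the
slope. -/
lemma cosh_div_profileDenom {α : ℝ} (hα : 0 < α) (φ : ℝ → ℝ) (z : ℂ) :
    Real.cosh (α * z.im) / profileDenom α φ z.re
      = √(α ^ 2 + 1) * √(Real.cosh (α * z.im) ^ 2 + catenoidSlope α φ z ^ 2)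
        - α * Real.cosh (α * z.im) := by
  have hd := profileDenom_pos hα φ z.re
  have hap : 0 < √(α ^ 2 + 1) := by positivity
  rw [sqrt_cosh_sq_add_catenoidSlope_sq hα]
  field_simp
  ring

/-- With `r = C / d` the slope and the height of the catenoid are `-r sin φ / √(α² + 1)` and
`-r cos φ / α`, and `r` depends on the slope and `v` only; so `α² t² = r² - (α² + 1) X²`. -/
lemma sqHeight_eq (α X v : ℝ) : sqHeight α X v
    = (√(α ^ 2 + 1) * √(Real.cosh (α * v) ^ 2 + X ^ 2) - α * Real.cosh (α * v)) ^ 2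
      - (√(α ^ 2 + 1) * X) ^ 2 := by
  have h := Real.sq_sqrt (show 0 ≤ Real.cosh (α * v) ^ 2 + X ^ 2 by positivity)
  have ha := sq_sqrt_sq_add_one α
  rw [sqHeight]
  linear_combination (-√(α ^ 2 + 1) ^ 2) * h + (-Real.cosh (α * v) ^ 2) * ha

lemma sqrt_mul_catenoidSlope {α : ℝ} (φ : ℝ → ℝ) (z : ℂ) :
    √(α ^ 2 + 1) * catenoidSlope α φ z
      = -Real.sin (φ z.re) * (Real.cosh (α * z.im) / profileDenom α φ z.re) := by
  have hap : √(α ^ 2 + 1) ≠ 0 := by positivity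
  rw [catenoidSlope, ← mul_div_assoc, mul_div_mul_left _ _ hap]
  ring

lemma mul_catenoidHeight {α : ℝ} (hα : 0 < α) (φ : ℝ → ℝ) (z : ℂ) :
    α * catenoidHeight α φ z
      = -Real.cos (φ z.re) * (Real.cosh (α * z.im) / profileDenom α φ z.re) := by
  rw [catenoidHeight, ← mul_div_assoc, mul_div_mul_left _ _ hα.ne']
  ring

lemma sq_mul_catenoidHeight {α : ℝ} (hα : 0 < α) (φ : ℝ → ℝ) (z : ℂ) :
    (α * catenoidHeight α φ z) ^ 2 = sqHeight α (catenoidSlope α φ z) z.im := by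
  rw [sqHeight_eq, ← cosh_div_profileDenom hα, sqrt_mul_catenoidSlope, mul_catenoidHeight hα]
  have h2 := Real.sin_sq_add_cos_sq (φ z.re)
  linear_combination (Real.cosh (α * z.im) / profileDenom α φ z.re) ^ 2 * h2

lemma exists_cos_eq_and_sin_eq {x y : ℝ} (h : x ^ 2 + y ^ 2 = 1) :
    ∃ θ, Real.cos θ = x ∧ Real.sin θ = y := by
  have hn : ‖(⟨x, y⟩ : ℂ)‖ = 1 := by
    rw [Complex.norm_eq_sqrt_sq_add_sq, h, Real.sqrt_one]
  have hz : (⟨x, y⟩ : ℂ) ≠ 0 := by rw [← norm_ne_zero_iff, hn]; norm_num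
  exact ⟨Complex.arg ⟨x, y⟩, by rw [Complex.cos_arg hz, hn, div_one],
    by rw [Complex.sin_arg, hn, div_one]⟩

/-- Every solution of the implicit equation lies on the catenoid: `1 / d` is recovered from the
slope, and then the slope and the height give the sine and the cosine of the profile. -/
lemma exists_catenoidSlope_eq {α : ℝ} (hα : 0 < α) {φ : ℝ → ℝ} (hφ : Function.Surjective φ)
    {X v t : ℝ} (h : (α * t) ^ 2 = sqHeight α X v) :
    ∃ u : ℝ, catenoidSlope α φ ⟨u, v⟩ = X ∧ catenoidHeight α φ ⟨u, v⟩ = t := by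
  have hap : 0 < √(α ^ 2 + 1) := by positivity
  have ha2 := sq_sqrt_sq_add_one α
  set a := √(α ^ 2 + 1) with ha
  set C := Real.cosh (α * v) with hC
  have hCpos : 0 < C := Real.cosh_pos _
  have hWpos : 0 < √(C ^ 2 + X ^ 2) := by positivity
  have hW2 := Real.sq_sqrt (show 0 ≤ C ^ 2 + X ^ 2 by positivity)
  have hCW : C ≤ √(C ^ 2 + X ^ 2) := Real.le_sqrt_of_sq_le (by nlinarith [sq_nonneg X])
  have hlt : α < a := lt_sqrt_sq_add_one α
  have hsq := h
  rw [sqHeight_eq, ← ha, ← hC] at hsq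
  have hnn : 0 ≤ C * ((2 * α ^ 2 + 1) * C - 2 * a * α * √(C ^ 2 + X ^ 2)) := by
    have : 0 ≤ (α * t) ^ 2 := sq_nonneg _
    rw [h, sqHeight] at this; exact this
  have hnn' : 2 * a * α * √(C ^ 2 + X ^ 2) ≤ (2 * α ^ 2 + 1) * C := by
    have := (mul_nonneg_iff_of_pos_left hCpos).1 hnn; linarith
  set W := √(C ^ 2 + X ^ 2) with hW
  set R := a * W - α * C with hR
  have hRpos : 0 < R := by nlinarith
  have hge : α * W ≤ a * C := by
    have : 2 * a * (α * W) ≤ 2 * a * (a * C) := by nlinarith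
    exact le_of_mul_le_mul_left this (by positivity)
  obtain ⟨θ, hcos, hsin⟩ : ∃ θ, Real.cos θ = -(α * t) / R ∧ Real.sin θ = -(a * X) / R := by
    apply exists_cos_eq_and_sin_eq
    field_simp
    linear_combination hsq
  obtain ⟨u, hu⟩ := hφ θ
  have hd : profileDenom α φ u = C / R := by
    have hsqrt : √(α ^ 2 + Real.cos θ ^ 2) = C / R - α := by
      have h1 : C / R - α = a * (a * C - α * W) / R := by
        field_simp
        rw [hR]
        linear_combination (-C) * ha2
      rw [h1, Real.sqrt_eq_iff_mul_self_eq (by positivity)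
        (div_nonneg (mul_nonneg hap.le (sub_nonneg.2 hge)) hRpos.le), hcos]
      field_simp
      rw [hR] at hsq ⊢
      linear_combination hsq + a ^ 2 * hW2 - (a ^ 2 * (C ^ 2 - W ^ 2) + (a * W - α * C) ^ 2) * ha2
    rw [profileDenom, hu, hsqrt]; ring
  refine ⟨u, ?_, ?_⟩
  · change -(Real.sin (φ u) * C) / (a * profileDenom α φ u) = X
    rw [hd, hu, hsin]; field_simp
  · change -(Real.cos (φ u) * C) / (α * profileDenom α φ u) = t
    rw [hd, hu, hcos]; field_simp

/-- The implicit equation of the catenoid. -/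
theorem mem_horizontalCatenoid_iff {α : ℝ} (hα : 0 < α) {φ : ℝ → ℝ}
    (hφ : Function.Surjective φ) (p : HypProd) :
    p ∈ horizontalCatenoid α φ ↔ (α * p.snd) ^ 2 = sqHeight α (axialSlope p.fst)
      (conformalParam hα (axialSlope p.fst) (Real.log ‖(p.fst : ℂ)‖)) := by
  rw [horizontalCatenoid_eq_range hα]
  constructor
  · rintro ⟨z, rfl⟩
    simp only [catenoidPoint_fst, catenoidPoint_snd, slope_polarPoint, log_norm_polarPoint,
      conformalParam_logRadius]
    exact sq_mul_catenoidHeight hα φ z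
  · intro h
    obtain ⟨u, h1, h2⟩ := exists_catenoidSlope_eq hα hφ h
    refine ⟨⟨u, conformalParam hα (axialSlope p.fst) (Real.log ‖(p.fst : ℂ)‖)⟩, ?_⟩
    rw [catenoidPoint, h1, h2, logRadius_conformalParam, polarPoint_slope_log_norm]
    rfl

/-! ### Symmetries -/

lemma conformalParam_neg_slope {α : ℝ} (hα : 0 < α) (X l : ℝ) :
    conformalParam hα (-X) l = conformalParam hα X l := by
  apply (logRadius_strictMono hα X).injective
  rw [logRadius_conformalParam, ← logRadius_neg_slope, logRadius_conformalParam]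

lemma conformalParam_neg {α : ℝ} (hα : 0 < α) (X l : ℝ) :
    conformalParam hα X (-l) = -conformalParam hα X l := by
  apply (logRadius_strictMono hα X).injective
  rw [logRadius_conformalParam, logRadius_neg, logRadius_conformalParam]

lemma sqHeight_neg_slope (α X v : ℝ) : sqHeight α (-X) v = sqHeight α X v := by simp [sqHeight]

lemma sqHeight_neg (α X v : ℝ) : sqHeight α X (-v) = sqHeight α X v := by simp [sqHeight]

lemma reflectHorizontal_reflectHorizontal (p : HypProd) :
    reflectHorizontal (reflectHorizontal p) = p := by
  refine WithLp.ofLp_injective 2 (Prod.ext rfl ?_)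
  exact neg_neg p.snd

lemma reflectImAxis_reflectImAxis (p : HypProd) : reflectImAxis (reflectImAxis p) = p := by
  refine WithLp.ofLp_injective 2 (Prod.ext (UpperHalfPlane.ext ?_) rfl)
  change -(starRingEnd ℂ) (-(starRingEnd ℂ) (p.fst : ℂ)) = p.fst
  simp

lemma reflectUnitCircle_reflectUnitCircle (p : HypProd) :
    reflectUnitCircle (reflectUnitCircle p) = p := by
  refine WithLp.ofLp_injective 2 (Prod.ext (UpperHalfPlane.ext ?_) rfl)
  change ((starRingEnd ℂ) (((starRingEnd ℂ) (p.fst : ℂ))⁻¹))⁻¹ = p.fst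
  simp

lemma slope_reflectUnitCircle (p : HypProd) :
    axialSlope (reflectUnitCircle p).fst = axialSlope p.fst := by
  change axialSlope (((starRingEnd ℂ) (p.fst : ℂ))⁻¹) = _
  have hn : Complex.normSq (p.fst : ℂ) ≠ 0 := (Complex.normSq_pos.2 p.fst.ne_zero).ne'
  simp only [axialSlope, Complex.inv_re, Complex.inv_im, Complex.normSq_conj, Complex.conj_re,
    Complex.conj_im, neg_neg]
  exact div_div_div_cancel_right₀ hn _ _

lemma log_norm_reflectUnitCircle (p : HypProd) :
    Real.log ‖((reflectUnitCircle p).fst : ℂ)‖ = -Real.log ‖(p.fst : ℂ)‖ := by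
  change Real.log ‖((starRingEnd ℂ) (p.fst : ℂ))⁻¹‖ = _
  rw [norm_inv, RCLike.norm_conj, Real.log_inv]

lemma slope_reflectImAxis (p : HypProd) :
    axialSlope (reflectImAxis p).fst = -axialSlope p.fst := by
  change axialSlope (-(starRingEnd ℂ) (p.fst : ℂ)) = _
  simp [axialSlope, neg_div]

lemma log_norm_reflectImAxis (p : HypProd) :
    Real.log ‖((reflectImAxis p).fst : ℂ)‖ = Real.log ‖(p.fst : ℂ)‖ := by
  change Real.log ‖-(starRingEnd ℂ) (p.fst : ℂ)‖ = _
  rw [norm_neg, RCLike.norm_conj]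

lemma reflectHorizontal_image {α : ℝ} (hα : 0 < α) {φ : ℝ → ℝ} (hφ : Function.Surjective φ) :
    reflectHorizontal '' horizontalCatenoid α φ = horizontalCatenoid α φ := by
  rw [Set.image_eq_preimage_of_inverse reflectHorizontal_reflectHorizontal
    reflectHorizontal_reflectHorizontal]
  ext p
  rw [Set.mem_preimage, mem_horizontalCatenoid_iff hα hφ, mem_horizontalCatenoid_iff hα hφ]
  change (α * -p.snd) ^ 2 = sqHeight α (axialSlope p.fst) _ ↔ _
  rw [mul_neg, neg_sq]
  rfl

lemma reflectImAxis_image {α : ℝ} (hα : 0 < α) {φ : ℝ → ℝ} (hφ : Function.Surjective φ) :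
    reflectImAxis '' horizontalCatenoid α φ = horizontalCatenoid α φ := by
  rw [Set.image_eq_preimage_of_inverse reflectImAxis_reflectImAxis reflectImAxis_reflectImAxis]
  ext p
  rw [Set.mem_preimage, mem_horizontalCatenoid_iff hα hφ, mem_horizontalCatenoid_iff hα hφ,
    slope_reflectImAxis, log_norm_reflectImAxis, conformalParam_neg_slope, sqHeight_neg_slope]
  rfl

lemma reflectUnitCircle_image {α : ℝ} (hα : 0 < α) {φ : ℝ → ℝ} (hφ : Function.Surjective φ) :
    reflectUnitCircle '' horizontalCatenoid α φ = horizontalCatenoid α φ := by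
  rw [Set.image_eq_preimage_of_inverse reflectUnitCircle_reflectUnitCircle
    reflectUnitCircle_reflectUnitCircle]
  ext p
  rw [Set.mem_preimage, mem_horizontalCatenoid_iff hα hφ, mem_horizontalCatenoid_iff hα hφ,
    slope_reflectUnitCircle, log_norm_reflectUnitCircle, conformalParam_neg, sqHeight_neg]
  rfl

/-! ### The bigraph -/

/-- The parameter `v` at a point of the half-plane. -/
def pointParam {α : ℝ} (hα : 0 < α) (z : UpperHalfPlane) : ℝ :=
  conformalParam hα (axialSlope z) (Real.log ‖(z : ℂ)‖)

lemma continuous_pointParam {α : ℝ} (hα : 0 < α) : Continuous (pointParam hα) := by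
  have h := (contDiff_conformalParam hα).continuous
  have h2 : Continuous fun z : UpperHalfPlane => (axialSlope z, Real.log ‖(z : ℂ)‖) :=
    continuous_slope.prodMk continuous_log_norm
  have h3 := Continuous.comp (g := fun p : ℝ × ℝ => conformalParam hα p.1 p.2) h h2
  unfold pointParam
  simpa only [Function.comp_def] using h3

/-- The domain over which the catenoid is a bigraph: the set where `sqHeight` is positive. -/
def bigraphDomain {α : ℝ} (hα : 0 < α) : Set UpperHalfPlane :=
  {z | 2 * √(α ^ 2 + 1) * α * |axialSlope z| < Real.cosh (α * pointParam hα z)}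

/-- The point of the half-plane with slope `X` and conformal parameter `v`. -/
def paramPoint (α X v : ℝ) : UpperHalfPlane := polarPoint X (logRadius α X v)

@[simp] lemma slope_paramPoint (α X v : ℝ) : axialSlope (paramPoint α X v) = X :=
  slope_polarPoint _ _

@[simp] lemma pointParam_paramPoint {α : ℝ} (hα : 0 < α) (X v : ℝ) :
    pointParam hα (paramPoint α X v) = v := by
  rw [pointParam, slope_paramPoint, paramPoint, log_norm_polarPoint, conformalParam_logRadius]

lemma paramPoint_pointParam {α : ℝ} (hα : 0 < α) (z : UpperHalfPlane) :
    paramPoint α (axialSlope z) (pointParam hα z) = z := by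
  rw [pointParam, paramPoint, logRadius_conformalParam, polarPoint_slope_log_norm]

lemma continuous_paramPoint (α : ℝ) : Continuous fun p : ℝ × ℝ => paramPoint α p.1 p.2 :=
  continuous_polarPoint.comp (continuous_fst.prodMk (contDiff_logRadius α).continuous)

lemma isOpen_bigraphDomain {α : ℝ} (hα : 0 < α) : IsOpen (bigraphDomain hα) := by
  refine isOpen_lt (continuous_const.mul continuous_slope.abs) ?_
  exact Real.continuous_cosh.comp (continuous_const.mul (continuous_pointParam hα))

/-- The domain is the image of the strip `(-1, 1) × ℝ` under `(s, v) ↦` the point with parameter `v`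
and slope `s cosh (α v)`, up to a constant factor. -/
lemma isConnected_bigraphDomain {α : ℝ} (hα : 0 < α) : IsConnected (bigraphDomain hα) := by
  set k := 2 * √(α ^ 2 + 1) * α with hk
  have kpos : 0 < k := by positivity
  have hX : Continuous fun p : ℝ × ℝ => p.1 * Real.cosh (α * p.2) / k := by
    refine Continuous.div_const ?_ k
    exact continuous_fst.mul (Real.continuous_cosh.comp (by fun_prop))
  have hc := (continuous_paramPoint α).comp (hX.prodMk continuous_snd)
  have hs : IsConnected (Set.Ioo (-1 : ℝ) 1 ×ˢ (Set.univ : Set ℝ)) :=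
    (isConnected_Ioo (by norm_num)).prod isConnected_univ
  convert hs.image _ hc.continuousOn using 1
  ext z
  simp only [bigraphDomain, ← hk, Set.mem_ofPred_eq, Set.mem_image, Set.mem_prod, Set.mem_Ioo,
    Set.mem_univ, and_true, Function.comp_apply, Prod.exists]
  have hcosh := Real.cosh_pos (α * pointParam hα z)
  constructor
  · intro h
    refine ⟨k * axialSlope z / Real.cosh (α * pointParam hα z), pointParam hα z, ?_, ?_⟩
    · rw [← abs_lt, abs_div, abs_mul, abs_of_pos kpos, abs_of_pos hcosh, div_lt_one hcosh]
      exact h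
    · rw [div_mul_cancel₀ _ hcosh.ne', mul_div_cancel_left₀ _ kpos.ne', paramPoint_pointParam]
  · rintro ⟨s, v, hs, rfl⟩
    have hcv := Real.cosh_pos (α * v)
    rw [slope_paramPoint, pointParam_paramPoint, abs_div, abs_mul, abs_of_pos kpos,
      abs_of_pos hcv, mul_div_cancel₀ _ kpos.ne']
    exact mul_lt_of_lt_one_left hcv (abs_lt.2 hs)

lemma sqHeight_pos_iff {α : ℝ} (hα : 0 < α) (X v : ℝ) :
    0 < sqHeight α X v ↔ 2 * √(α ^ 2 + 1) * α * |X| < Real.cosh (α * v) := by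
  have ha2 := sq_sqrt_sq_add_one α
  have hap : 0 < √(α ^ 2 + 1) := by positivity
  have hC := Real.cosh_pos (α * v)
  have hX := sq_abs X
  have hW := Real.sq_sqrt (show 0 ≤ Real.cosh (α * v) ^ 2 + X ^ 2 by positivity)
  rw [sqHeight, mul_pos_iff_of_pos_left hC, sub_pos, ← sq_lt_sq₀ (by positivity) (by positivity),
    ← sq_lt_sq₀ (a := 2 * √(α ^ 2 + 1) * α * |X|) (by positivity) hC.le, ← sub_pos,
    ← sub_pos (b := _ ^ 2)]
  rw [mul_pow, mul_pow, mul_pow, hW, mul_pow, mul_pow _ |X|, mul_pow _ α, mul_pow, ha2, hX]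
  ring_nf

lemma sqHeight_nonneg_iff {α : ℝ} (hα : 0 < α) (X v : ℝ) :
    0 ≤ sqHeight α X v ↔ 2 * √(α ^ 2 + 1) * α * |X| ≤ Real.cosh (α * v) := by
  have ha2 := sq_sqrt_sq_add_one α
  have hap : 0 < √(α ^ 2 + 1) := by positivity
  have hC := Real.cosh_pos (α * v)
  have hX := sq_abs X
  have hW := Real.sq_sqrt (show 0 ≤ Real.cosh (α * v) ^ 2 + X ^ 2 by positivity)
  rw [sqHeight, mul_nonneg_iff_of_pos_left hC, sub_nonneg,
    ← sq_le_sq₀ (by positivity) (by positivity),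
    ← sq_le_sq₀ (a := 2 * √(α ^ 2 + 1) * α * |X|) (by positivity) hC.le, ← sub_nonneg,
    ← sub_nonneg (b := _ ^ 2)]
  rw [mul_pow, mul_pow, mul_pow, hW, mul_pow, mul_pow _ |X|, mul_pow _ α, mul_pow, ha2, hX]
  ring_nf

lemma sqHeight_eq_zero_iff {α : ℝ} (hα : 0 < α) (X v : ℝ) :
    sqHeight α X v = 0 ↔ 2 * √(α ^ 2 + 1) * α * |X| = Real.cosh (α * v) := by
  have h1 := sqHeight_pos_iff hα X v
  have h2 := sqHeight_nonneg_iff hα X v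
  constructor
  · intro h
    exact le_antisymm (h2.1 h.ge) (not_lt.1 fun h3 => (h1.2 h3).ne' h)
  · intro h
    exact le_antisymm (not_lt.1 fun h3 => (h1.1 h3).ne h) (h2.2 h.le)

lemma frontier_bigraphDomain {α : ℝ} (hα : 0 < α) : frontier (bigraphDomain hα)
    = {z : UpperHalfPlane |
        2 * √(α ^ 2 + 1) * α * |axialSlope z| = Real.cosh (α * pointParam hα z)} := by
  apply Set.Subset.antisymm
  · refine frontier_lt_subset_eq (continuous_const.mul continuous_slope.abs) ?_
    exact Real.continuous_cosh.comp (continuous_const.mul (continuous_pointParam hα))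
  · intro z hz
    have hz' : 2 * √(α ^ 2 + 1) * α * |axialSlope z| = Real.cosh (α * pointParam hα z) := hz
    rw [(isOpen_bigraphDomain hα).frontier_eq]
    refine ⟨?_, fun h => (ne_of_lt h) hz⟩
    -- shrinking the slope at constant `v` moves a boundary point into the domain
    set c : ℝ → UpperHalfPlane := fun r => paramPoint α (r * axialSlope z) (pointParam hα z) with hc
    have hcc : Continuous c :=
      (continuous_paramPoint α).comp (by fun_prop : Continuous fun r : ℝ =>
        (r * axialSlope z, pointParam hα z))
    have h1 : c 1 = z := by rw [hc]; simp only [one_mul]; exact paramPoint_pointParam hα z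
    have hcl : (1 : ℝ) ∈ closure (Set.Ioo (0 : ℝ) 1) := by
      rw [closure_Ioo (by norm_num)]; exact ⟨by norm_num, le_refl _⟩
    rw [← h1]
    refine map_mem_closure hcc hcl fun r hr => ?_
    change 2 * √(α ^ 2 + 1) * α * |axialSlope (c r)| < Real.cosh (α * pointParam hα (c r))
    rw [hc]
    simp only [slope_paramPoint, pointParam_paramPoint]
    rw [abs_mul, abs_of_pos hr.1]
    have := Real.cosh_pos (α * pointParam hα z)
    nlinarith [hr.2]

lemma mem_horizontalCatenoid_iff' {α : ℝ} (hα : 0 < α) {φ : ℝ → ℝ}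
    (hφ : Function.Surjective φ) (p : HypProd) : p ∈ horizontalCatenoid α φ ↔
      (α * p.snd) ^ 2 = sqHeight α (axialSlope p.fst) (pointParam hα p.fst) :=
  mem_horizontalCatenoid_iff hα hφ p

lemma isBigraphOver_bigraphDomain {α : ℝ} (hα : 0 < α) {φ : ℝ → ℝ}
    (hφ : Function.Surjective φ) :
    IsBigraphOver (bigraphDomain hα) (horizontalCatenoid α φ) := by
  set V : ℂ → ℝ := fun z => conformalParam hα (axialSlope z) (Real.log ‖z‖) with hV
  have hVz : ∀ z : UpperHalfPlane, V z = pointParam hα z := fun z => rfl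
  refine ⟨fun z => √(sqHeight α (axialSlope z) (V z)) / α, ?_, ?_, ?_⟩
  · rintro _ ⟨z, hz, rfl⟩
    apply ContDiffAt.contDiffWithinAt
    have him : (z : ℂ).im ≠ 0 := z.im_pos.ne'
    have hn : ‖(z : ℂ)‖ ≠ 0 := (norm_pos_iff.2 z.ne_zero).ne'
    have h1 : ContDiffAt ℝ ∞ axialSlope (z : ℂ) := by
      unfold axialSlope
      exact ContDiffAt.div Complex.reCLM.contDiff.contDiffAt Complex.imCLM.contDiff.contDiffAt him
    have h2 : ContDiffAt ℝ ∞ (fun z : ℂ => Real.log ‖z‖) (z : ℂ) :=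
      (contDiffAt_norm ℝ z.ne_zero).log hn
    have h3 : ContDiffAt ℝ ∞ V (z : ℂ) := by
      refine ContDiffAt.comp (g := fun p : ℝ × ℝ => conformalParam hα p.1 p.2)
        (f := fun z : ℂ => (axialSlope z, Real.log ‖z‖)) (z : ℂ)
        (contDiff_conformalParam hα).contDiffAt ?_
      exact h1.prodMk h2
    clear_value V
    have h4 : ContDiffAt ℝ ∞ (fun z => Real.cosh (α * V z)) (z : ℂ) := by fun_prop
    have h5 : ContDiffAt ℝ ∞ (fun z => √(Real.cosh (α * V z) ^ 2 + axialSlope z ^ 2)) (z : ℂ) :=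
      ContDiffAt.sqrt (by fun_prop) (by positivity)
    have h6 : ContDiffAt ℝ ∞ (fun z => sqHeight α (axialSlope z) (V z)) (z : ℂ) := by
      unfold sqHeight; fun_prop
    have hpos : 0 < sqHeight α (axialSlope z) (V z) := by
      rw [hVz]; exact (sqHeight_pos_iff hα _ _).2 hz
    exact (h6.sqrt hpos.ne').div_const α
  · intro z hz
    have := Real.sqrt_pos.2 ((sqHeight_pos_iff hα _ _).2 hz)
    exact div_pos this hα
  · ext p
    rw [mem_horizontalCatenoid_iff' hα hφ]
    simp only [Set.mem_ofPred_eq, frontier_bigraphDomain, hVz]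
    set F := sqHeight α (axialSlope p.fst) (pointParam hα p.fst) with hF
    have hmem : p.fst ∈ bigraphDomain hα ↔ 0 < F := (sqHeight_pos_iff hα _ _).symm
    rw [hmem, ← sqHeight_eq_zero_iff hα, ← hF]
    have key : ∀ t : ℝ, 0 ≤ F → ((α * t) ^ 2 = F ↔ t = √F / α ∨ t = -(√F / α)) := fun t h => by
      conv_lhs => rw [← Real.sq_sqrt h, sq_eq_sq_iff_eq_or_eq_neg]
      rw [eq_div_iff hα.ne', ← neg_div, eq_div_iff hα.ne', mul_comm]
    constructor
    · intro h
      have hF0 : 0 ≤ F := h ▸ sq_nonneg _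
      rcases hF0.eq_or_lt with h0 | h0
      · refine Or.inr ⟨h0.symm, ?_⟩
        rw [← h0] at h
        exact (mul_eq_zero.1 (pow_eq_zero_iff (two_ne_zero)|>.1 h)).resolve_left hα.ne'
      · exact Or.inl ⟨h0, (key _ hF0).1 h⟩
    · rintro (⟨h0, h⟩ | ⟨h0, h⟩)
      · exact (key _ h0.le).2 h
      · rw [h0, h]; simp

/-! ### The fibres of `ℍ² × ℝ → ℍ²` are metric invariants -/

lemma HypProd.dist_sq (p q : HypProd) :
    dist p q ^ 2 = dist p.fst q.fst ^ 2 + (p.snd - q.snd) ^ 2 := by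
  rw [WithLp.prod_dist_eq_add (by norm_num), ENNReal.toReal_ofNat, ← Real.sqrt_eq_rpow,
    Real.sq_sqrt (by positivity), Real.rpow_ofNat, Real.rpow_ofNat, Real.dist_eq p.snd, sq_abs]

lemma HypProd.ext {p q : HypProd} (h1 : p.fst = q.fst) (h2 : p.snd = q.snd) : p = q :=
  WithLp.ofLp_injective 2 (Prod.ext h1 h2)

/-- The points `p` and `q` satisfy the parallelogram law with every third point. -/
def IsParallelogramPair {M : Type*} [MetricSpace M] (p q : M) : Prop :=
  ∃ m, ∀ x, dist x m ^ 2 = dist x p ^ 2 / 2 + dist x q ^ 2 / 2 - dist p q ^ 2 / 4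

lemma IsParallelogramPair.map {M : Type*} [MetricSpace M] {p q : M} (h : IsParallelogramPair p q)
    (Ψ : M ≃ᵢ M) : IsParallelogramPair (Ψ p) (Ψ q) := by
  obtain ⟨m, hm⟩ := h
  refine ⟨Ψ m, fun x => ?_⟩
  have := hm (Ψ.symm x)
  rwa [← Ψ.dist_eq, ← Ψ.dist_eq _ p, ← Ψ.dist_eq _ q, ← Ψ.dist_eq p, Ψ.apply_symm_apply] at this

/-- The unit-speed geodesic ray `b + i e^{-L}`, which converges to the boundary point `b`. -/
def boundaryRay (b L : ℝ) : UpperHalfPlane := ⟨⟨b, Real.exp (-L)⟩, Real.exp_pos _⟩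

/-- The first-order term of the squared distance along a ray is a Busemann function. -/
lemma tendsto_dist_boundaryRay (b : ℝ) (p : UpperHalfPlane) :
    Filter.Tendsto (fun L : ℝ => (dist (boundaryRay b L) p ^ 2 - L ^ 2) / L) Filter.atTop
      (nhds (2 * Real.log (((b - p.re) ^ 2 + p.im ^ 2) / p.im))) := by
  have hp := p.im_pos
  set β := Real.log (((b - p.re) ^ 2 + p.im ^ 2) / p.im) with hβ
  set d : ℝ → ℝ := fun L => dist (boundaryRay b L) p with hd
  set r : ℝ → ℝ := fun L =>
    Real.log (((b - p.re) ^ 2 + p.im ^ 2 + Real.exp (-L) ^ 2) / p.im) with hr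
  have hexp : Filter.Tendsto (fun L : ℝ => Real.exp (-L)) Filter.atTop (nhds 0) :=
    Real.tendsto_exp_neg_atTop_nhds_zero
  have hrlim : Filter.Tendsto r Filter.atTop (nhds β) := by
    have h1 : Filter.Tendsto (fun L : ℝ =>
        ((b - p.re) ^ 2 + p.im ^ 2 + Real.exp (-L) ^ 2) / p.im) Filter.atTop
        (nhds (((b - p.re) ^ 2 + p.im ^ 2 + 0 ^ 2) / p.im)) :=
      ((hexp.pow 2).const_add _).div_const _
    rw [zero_pow two_ne_zero, add_zero] at h1
    exact h1.log (by positivity)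
  -- `log (2 cosh d)` is both `L + r` and `d + o(1)`, so `d - L` converges
  have hlog : ∀ L, Real.log (2 * Real.cosh (d L)) = L + r L := fun L => by
    have h1 : 2 * Real.cosh (d L)
        = Real.exp L * (((b - p.re) ^ 2 + p.im ^ 2 + Real.exp (-L) ^ 2) / p.im) := by
      rw [hd]
      simp only
      rw [UpperHalfPlane.cosh_dist']
      have h2 : (boundaryRay b L).re = b := rfl
      have h3 : (boundaryRay b L).im = Real.exp (-L) := rfl
      rw [h2, h3, Real.exp_neg]
      have := Real.exp_pos L
      field_simp
      ring
    rw [h1, Real.log_mul (by positivity) (by positivity), Real.log_exp]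
  have hlog2 : ∀ L, Real.log (2 * Real.cosh (d L)) = d L + Real.log (1 + Real.exp (-(2 * d L))) :=
    fun L => by
    have h1 : 2 * Real.cosh (d L) = Real.exp (d L) * (1 + Real.exp (-(2 * d L))) := by
      rw [Real.cosh_eq, mul_add, ← Real.exp_add]; ring_nf
    rw [h1, Real.log_mul (by positivity) (by positivity), Real.log_exp]
  have hdtop : Filter.Tendsto d Filter.atTop Filter.atTop := by
    have h1 : Filter.Tendsto (fun L => L + (r L - Real.log 2)) Filter.atTop Filter.atTop :=
      Filter.tendsto_id.atTop_add (hrlim.sub_const _)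
    refine Filter.tendsto_atTop_mono (fun L => ?_) h1
    have h2 : Real.log (1 + Real.exp (-(2 * d L))) ≤ Real.log 2 := by
      apply Real.log_le_log (by positivity)
      have : Real.exp (-(2 * d L)) ≤ 1 := Real.exp_le_one_iff.2 (by
        have : 0 ≤ d L := dist_nonneg
        linarith)
      linarith
    have := hlog L
    rw [hlog2 L] at this
    linarith
  have hdiff : Filter.Tendsto (fun L => d L - L) Filter.atTop (nhds β) := by
    have h1 : Filter.Tendsto (fun L => Real.exp (-(2 * d L))) Filter.atTop (nhds 0) :=
      Real.tendsto_exp_neg_atTop_nhds_zero.comp (hdtop.const_mul_atTop two_pos)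
    have h2 : Filter.Tendsto (fun L => Real.log (1 + Real.exp (-(2 * d L)))) Filter.atTop
        (nhds (Real.log (1 + 0))) := (h1.const_add 1).log (by norm_num)
    rw [add_zero, Real.log_one] at h2
    have h3 := hrlim.sub h2
    rw [sub_zero] at h3
    refine h3.congr fun L => ?_
    have := hlog L
    rw [hlog2 L] at this
    linarith
  have h4 : Filter.Tendsto (fun L => (d L - L) * (2 + (d L - L) * L⁻¹)) Filter.atTop
      (nhds (β * (2 + β * 0))) :=
    hdiff.mul ((hdiff.mul tendsto_inv_atTop_zero).const_add 2)
  have h5 : β * (2 + β * 0) = 2 * β := by ring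
  rw [h5] at h4
  refine h4.congr' ?_
  filter_upwards [Filter.eventually_gt_atTop 0] with L hL
  field_simp
  ring

/-- If `p, q` is a parallelogram pair with midpoint `m`, the Busemann functions of `m` are the means
of those of `p` and `q`, so that `N_m²` and `N_p N_q` are proportional, where
`N_p(b) = (b - p) (b - p̄)`; comparing roots gives `p = m = q`. -/
lemma eq_of_forall_dist_sq {p q m : UpperHalfPlane} {c : ℝ}
    (h : ∀ z : UpperHalfPlane, dist z m ^ 2 = dist z p ^ 2 / 2 + dist z q ^ 2 / 2 + c) :
    p = q := by
  have hm := m.im_pos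
  have hp := p.im_pos
  have hq := q.im_pos
  have key : ∀ b : ℝ, (((b - m.re) ^ 2 + m.im ^ 2) / m.im) ^ 2
      = ((b - p.re) ^ 2 + p.im ^ 2) / p.im * (((b - q.re) ^ 2 + q.im ^ 2) / q.im) := by
    intro b
    have h1 := tendsto_dist_boundaryRay b m
    have h2 := (((tendsto_dist_boundaryRay b p).div_const 2).add
      ((tendsto_dist_boundaryRay b q).div_const 2)).add (tendsto_inv_atTop_zero.const_mul c)
    have h3 := tendsto_nhds_unique h1 (h2.congr' (by
      filter_upwards [Filter.eventually_gt_atTop 0] with L hL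
      rw [h (boundaryRay b L)]
      field_simp
      ring))
    have h4 : Real.log ((((b - m.re) ^ 2 + m.im ^ 2) / m.im) ^ 2)
        = Real.log (((b - p.re) ^ 2 + p.im ^ 2) / p.im * (((b - q.re) ^ 2 + q.im ^ 2) / q.im)) := by
      rw [Real.log_pow, Real.log_mul (by positivity) (by positivity)]
      push_cast
      linarith
    exact Real.log_injOn_pos (Set.mem_Ioi.2 (by positivity)) (Set.mem_Ioi.2 (by positivity)) h4
  -- the identity of quadratic polynomials holds on `ℝ`, hence on `ℂ`
  obtain ⟨N, hN⟩ : ∃ N : UpperHalfPlane → Polynomial ℂ,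
      ∀ w x, (N w).eval x = ((x - w.re) ^ 2 + (w.im : ℂ) ^ 2) * ((w.im : ℂ)⁻¹) :=
    ⟨fun w => ((Polynomial.X - Polynomial.C (w.re : ℂ)) ^ 2 + Polynomial.C ((w.im : ℂ) ^ 2))
      * Polynomial.C ((w.im : ℂ)⁻¹), fun w x => by simp⟩
  have hpoly : N m ^ 2 - N p * N q = 0 := by
    refine Polynomial.eq_zero_of_infinite_isRoot _ ?_
    refine (Set.infinite_range_of_injective Complex.ofReal_injective).mono ?_
    rintro _ ⟨b, rfl⟩
    have hb := congrArg (Complex.ofReal) (key b)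
    change Polynomial.eval _ _ = 0
    rw [Polynomial.eval_sub, Polynomial.eval_pow, Polynomial.eval_mul, hN, hN, hN, sub_eq_zero]
    push_cast at hb
    simpa only [div_eq_mul_inv] using hb
  have hzero : ∀ w : UpperHalfPlane, (N w).eval (w : ℂ) = 0 := fun w => by
    have h1 : ((w : ℂ) - w.re) = w.im * Complex.I := by
      have := Complex.re_add_im (w : ℂ)
      rw [UpperHalfPlane.coe_re, UpperHalfPlane.coe_im] at this
      linear_combination (-1 : ℂ) * this
    rw [hN, h1, mul_pow, Complex.I_sq]; ring
  have hroot : ∀ w : UpperHalfPlane, (N m).eval (w : ℂ) = 0 → w = m := fun w hw => by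
    rw [hN] at hw
    have him : (m.im : ℂ)⁻¹ ≠ 0 := inv_ne_zero (Complex.ofReal_ne_zero.2 hm.ne')
    have h1 := (mul_eq_zero.1 hw).resolve_right him
    have h2 : ((w : ℂ) - m) * ((w : ℂ) - (starRingEnd ℂ) (m : ℂ)) = 0 := by
      rw [← h1]
      have h3 : (m : ℂ) = m.re + m.im * Complex.I := (Complex.re_add_im (m : ℂ)).symm
      rw [h3]
      simp only [map_add, map_mul, Complex.conj_ofReal, Complex.conj_I]
      ring_nf
      rw [Complex.I_sq]
      ring
    rcases mul_eq_zero.1 h2 with h3 | h3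
    · exact UpperHalfPlane.ext (sub_eq_zero.1 h3)
    · exfalso
      have := congrArg Complex.im (sub_eq_zero.1 h3)
      rw [Complex.conj_im, UpperHalfPlane.coe_im, UpperHalfPlane.coe_im] at this
      linarith [w.im_pos]
  have hpm : p = m := by
    apply hroot
    have := congrArg (Polynomial.eval (p : ℂ)) hpoly
    rw [Polynomial.eval_sub, Polynomial.eval_pow, Polynomial.eval_mul, hzero p, zero_mul, sub_zero,
      Polynomial.eval_zero] at this
    exact pow_eq_zero_iff two_ne_zero |>.1 this
  have hqm : q = m := by
    apply hroot
    have := congrArg (Polynomial.eval (q : ℂ)) hpoly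
    rw [Polynomial.eval_sub, Polynomial.eval_pow, Polynomial.eval_mul, hzero q, mul_zero, sub_zero,
      Polynomial.eval_zero] at this
    exact pow_eq_zero_iff two_ne_zero |>.1 this
  rw [hpm, hqm]

/-- The fibres of `ℍ² × ℝ → ℍ²` are determined by the metric. -/
lemma isParallelogramPair_iff (p q : HypProd) : IsParallelogramPair p q ↔ p.fst = q.fst := by
  constructor
  · rintro ⟨m, hm⟩
    refine eq_of_forall_dist_sq (m := m.fst) (c := (p.snd ^ 2 / 2 + q.snd ^ 2 / 2 - dist p q ^ 2 / 4
      - m.snd ^ 2)) fun z => ?_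
    have h := hm (WithLp.toLp 2 (z, 0))
    simp only [HypProd.dist_sq (WithLp.toLp 2 (z, 0))] at h
    change dist z m.fst ^ 2 + (0 - m.snd) ^ 2 = (dist z p.fst ^ 2 + (0 - p.snd) ^ 2) / 2
      + (dist z q.fst ^ 2 + (0 - q.snd) ^ 2) / 2 - _ at h
    linear_combination h
  · intro h
    refine ⟨WithLp.toLp 2 (p.fst, (p.snd + q.snd) / 2), fun x => ?_⟩
    simp only [HypProd.dist_sq]
    change dist x.fst p.fst ^ 2 + (x.snd - (p.snd + q.snd) / 2) ^ 2 = _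
    rw [h, dist_self]
    ring

lemma IsometryEquiv.fst_eq_iff (Ψ : HypProd ≃ᵢ HypProd) (p q : HypProd) :
    (Ψ p).fst = (Ψ q).fst ↔ p.fst = q.fst := by
  rw [← isParallelogramPair_iff, ← isParallelogramPair_iff]
  refine ⟨fun h => ?_, fun h => h.map Ψ⟩
  have := h.map Ψ.symm
  rwa [Ψ.symm_apply_apply, Ψ.symm_apply_apply] at this

/-! ### No one-parameter group of isometries preserves the catenoid -/

/-- The distance of the half-plane in terms of the slope and of `log |z|`. -/
lemma cosh_dist_eq_slope (z w : UpperHalfPlane) : Real.cosh (dist z w)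
    = √(1 + axialSlope z ^ 2) * √(1 + axialSlope w ^ 2)
      * Real.cosh (Real.log ‖(z : ℂ)‖ - Real.log ‖(w : ℂ)‖) - axialSlope z * axialSlope w := by
  have hz := z.im_pos
  have hw := w.im_pos
  have hzn : 0 < ‖(z : ℂ)‖ := norm_pos_iff.2 z.ne_zero
  have hwn : 0 < ‖(w : ℂ)‖ := norm_pos_iff.2 w.ne_zero
  have h1 : √(1 + axialSlope z ^ 2) = ‖(z : ℂ)‖ / z.im := by
    rw [norm_eq_im_mul z]; field_simp
  have h2 : √(1 + axialSlope w ^ 2) = ‖(w : ℂ)‖ / w.im := by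
    rw [norm_eq_im_mul w]; field_simp
  have h3 : ‖(z : ℂ)‖ ^ 2 = z.re ^ 2 + z.im ^ 2 := by
    rw [Complex.norm_eq_sqrt_sq_add_sq, Real.sq_sqrt (by positivity)]; rfl
  have h4 : ‖(w : ℂ)‖ ^ 2 = w.re ^ 2 + w.im ^ 2 := by
    rw [Complex.norm_eq_sqrt_sq_add_sq, Real.sq_sqrt (by positivity)]; rfl
  rw [UpperHalfPlane.cosh_dist', h1, h2, ← Real.log_div hzn.ne' hwn.ne',
    Real.cosh_log (by positivity)]
  simp only [axialSlope, UpperHalfPlane.coe_re, UpperHalfPlane.coe_im]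
  field_simp
  linear_combination (-1) * h3 - h4

/-- A continuous function on `ℝ` whose square is constant is constant. -/
lemma eq_of_continuous_of_sq_eq {f : ℝ → ℝ} (hf : Continuous f) (h : ∀ s, f s ^ 2 = f 0 ^ 2)
    (s : ℝ) : f s = f 0 := by
  rcases eq_or_ne (f 0) 0 with h0 | h0
  · have := h s
    rw [h0, zero_pow two_ne_zero] at this
    rw [h0]; exact pow_eq_zero_iff two_ne_zero |>.1 this
  · have h1 := isPreconnected_univ.eq_of_sq_eq (f := f) (g := fun _ => f 0) hf.continuousOn
      continuousOn_const (fun x _ => h x) (fun _ => h0) (Set.mem_univ 0) rfl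
    exact h1 (Set.mem_univ s)

lemma pos_of_continuous_of_ne_zero {f : ℝ → ℝ} (hf : Continuous f) (h : ∀ s, f s ≠ 0)
    (h0 : 0 < f 0) (s : ℝ) : 0 < f s := by
  by_contra hs
  obtain ⟨r, hr⟩ := mem_range_of_exists_le_of_exists_ge hf ⟨s, not_lt.1 hs⟩ ⟨0, h0.le⟩
  exact h r hr

/-- On the catenoid the points at height `0` are those that are alone in their fibre. -/
lemma snd_eq_zero_iff_of_mem {α : ℝ} (hα : 0 < α) {φ : ℝ → ℝ} (hφ : Function.Surjective φ)
    {p : HypProd} (hp : p ∈ horizontalCatenoid α φ) :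
    p.snd = 0 ↔ ∀ q ∈ horizontalCatenoid α φ, q.fst = p.fst → q = p := by
  have hp' := (mem_horizontalCatenoid_iff' hα hφ p).1 hp
  constructor
  · intro h q hq hqp
    have hq' := (mem_horizontalCatenoid_iff' hα hφ q).1 hq
    rw [hqp, ← hp', h, mul_zero, zero_pow two_ne_zero, pow_eq_zero_iff two_ne_zero] at hq'
    exact HypProd.ext hqp (by rw [h, (mul_eq_zero.1 hq').resolve_left hα.ne'])
  · intro h
    have h1 : reflectHorizontal p ∈ horizontalCatenoid α φ := by
      rw [← reflectHorizontal_image hα hφ]; exact Set.mem_image_of_mem _ hp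
    have h2 := congrArg (fun q : HypProd => q.snd) (h _ h1 rfl)
    have h3 : -p.snd = p.snd := h2
    linarith

/-- For `σ = ±1`, the points of the catenoid at height `0` with `v = 0`; they are the nearest points
of the two components of the horizontal section. -/
def neckPoint (α σ : ℝ) : HypProd :=
  WithLp.toLp 2 (paramPoint α (σ / (2 * √(α ^ 2 + 1) * α)) 0, 0)

/-- Isometries permute the fibres of `ℍ² × ℝ → ℍ²`, so that those that preserve the catenoid
preserve its section at height `0`. By continuity a one-parameter group preserves the two
components of the section, and hence the unique pair of nearest points in them. The fibres over
these two points are then fixed pointwise, which fixes the height, the slope and, up to sign,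
`log |z|` of every point. -/
theorem not_isInvariantUnderOneParameterGroup {α : ℝ} (hα : 0 < α) {φ : ℝ → ℝ}
    (hφ : Function.Surjective φ) :
    ¬ IsInvariantUnderOneParameterGroup (horizontalCatenoid α φ) := by
  rintro ⟨Φ, hcont, ⟨s₀, hs₀⟩, hinv⟩
  apply hs₀
  set F : ℝ → HypProd ≃ᵢ HypProd := fun s => Φ (Multiplicative.ofAdd s) with hF
  have hF0 : ∀ p, F 0 p = p := fun p => by
    rw [hF]; simp only [ofAdd_zero, map_one]; rfl
  have hFC : ∀ s, ∀ p ∈ horizontalCatenoid α φ, F s p ∈ horizontalCatenoid α φ := fun s p hp => by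
    rw [← hinv (Multiplicative.ofAdd s)]; exact Set.mem_image_of_mem _ hp
  have hfst : Continuous fun p : HypProd => p.fst := WithLp.continuous_fst 2 _ _
  have hsnd : Continuous fun p : HypProd => p.snd := WithLp.continuous_snd 2 _ _
  set k := 2 * √(α ^ 2 + 1) * α with hk
  have kpos : 0 < k := by positivity
  set Γ : Set HypProd := {p | p ∈ horizontalCatenoid α φ ∧ p.snd = 0} with hΓ
  -- the section at height `0`, in terms of slope and `v`
  have hΓk : ∀ p ∈ Γ, k * |axialSlope p.fst| = Real.cosh (α * pointParam hα p.fst) := by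
    rintro p ⟨hp, hp0⟩
    rw [mem_horizontalCatenoid_iff' hα hφ, hp0, mul_zero, zero_pow two_ne_zero] at hp
    exact (sqHeight_eq_zero_iff hα _ _).1 hp.symm
  have hFΓ : ∀ s, ∀ p ∈ Γ, F s p ∈ Γ := by
    rintro s p ⟨hp, hp0⟩
    refine ⟨hFC s p hp, (snd_eq_zero_iff_of_mem hα hφ (hFC s p hp)).2 fun q hq hqp => ?_⟩
    rw [← hinv (Multiplicative.ofAdd s)] at hq
    obtain ⟨q', hq', rfl⟩ := hq
    rw [(snd_eq_zero_iff_of_mem hα hφ hp).1 hp0 q' hq' ((IsometryEquiv.fst_eq_iff _ _ _).1 hqp)]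
  have hneckΓ : ∀ σ : ℝ, |σ| = 1 → neckPoint α σ ∈ Γ := fun σ hσ => by
    refine ⟨(mem_horizontalCatenoid_iff' hα hφ _).2 ?_, rfl⟩
    have h1 : (neckPoint α σ).snd = 0 := rfl
    have h2 : (neckPoint α σ).fst = paramPoint α (σ / k) 0 := rfl
    rw [h1, h2, mul_zero, zero_pow two_ne_zero, slope_paramPoint, pointParam_paramPoint, eq_comm,
      sqHeight_eq_zero_iff hα, abs_div, hσ, ← hk, abs_of_pos kpos, mul_zero, Real.cosh_zero]
    field_simp
  have hne : ∀ p ∈ Γ, axialSlope p.fst ≠ 0 := fun p hp h0 => by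
    have := hΓk p hp
    rw [h0, abs_zero, mul_zero] at this
    exact (Real.cosh_pos _).ne this
  have hslope : ∀ p ∈ Γ, 1 / k ≤ |axialSlope p.fst| := fun p hp => by
    rw [div_le_iff₀ kpos, mul_comm, hΓk p hp]; exact Real.one_le_cosh _
  have hneckslope : ∀ σ, axialSlope (neckPoint α σ).fst = σ / k := fun σ => slope_paramPoint _ _ _
  have hnecklog : ∀ σ, Real.log ‖((neckPoint α σ).fst : ℂ)‖ = 0 := fun σ => by
    change Real.log ‖(paramPoint α _ 0 : ℂ)‖ = 0
    rw [paramPoint, log_norm_polarPoint, logRadius_zero]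
  have hslopecont : ∀ p, Continuous fun s => axialSlope (F s p).fst := fun p =>
    continuous_slope.comp (hfst.comp (hcont p))
  -- the two nearest points stay in their components and at the same distance
  have hfix : ∀ s, F s (neckPoint α 1) = neckPoint α 1 ∧
      F s (neckPoint α (-1)) = neckPoint α (-1) := by
    intro s
    have hp := hFΓ s _ (hneckΓ 1 (by norm_num))
    have hq := hFΓ s _ (hneckΓ (-1) (by norm_num))
    have hXp : 0 < axialSlope (F s (neckPoint α 1)).fst := by
      refine pos_of_continuous_of_ne_zero (hslopecont _)
        (fun r => hne _ (hFΓ r _ (hneckΓ 1 (by norm_num)))) ?_ s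
      rw [hF0, hneckslope]; positivity
    have hXq : 0 < -axialSlope (F s (neckPoint α (-1))).fst := by
      refine pos_of_continuous_of_ne_zero (hslopecont _).neg
        (fun r => neg_ne_zero.2 (hne _ (hFΓ r _ (hneckΓ (-1) (by norm_num))))) ?_ s
      change 0 < -axialSlope (F 0 (neckPoint α (-1))).fst
      rw [hF0, hneckslope, neg_div, neg_neg]; positivity
    have hdist := (F s).dist_eq (neckPoint α 1) (neckPoint α (-1))
    have hX1 := hslope _ hp
    have hX2 := hslope _ hq
    have hv1 := hΓk _ hp
    have hv2 := hΓk _ hq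
    rw [abs_of_pos hXp] at hX1 hv1
    rw [abs_of_neg (neg_pos.1 hXq)] at hX2 hv2
    have hd2 : dist (F s (neckPoint α 1)).fst (F s (neckPoint α (-1))).fst
        = dist (neckPoint α 1).fst (neckPoint α (-1)).fst := by
      have h1 := congrArg (· ^ 2) hdist
      simp only [HypProd.dist_sq] at h1
      rw [hp.2, hq.2, (hneckΓ 1 (by norm_num)).2, (hneckΓ (-1) (by norm_num)).2] at h1
      simpa [sq_eq_sq₀ dist_nonneg dist_nonneg] using h1
    have hcosh := congrArg Real.cosh hd2
    rw [cosh_dist_eq_slope, cosh_dist_eq_slope, hneckslope, hneckslope, hnecklog, hnecklog,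
      sub_zero, Real.cosh_zero, mul_one] at hcosh
    set X := axialSlope (F s (neckPoint α 1)).fst with hX
    set X' := axialSlope (F s (neckPoint α (-1))).fst with hX'
    set c := Real.cosh (Real.log ‖((F s (neckPoint α 1)).fst : ℂ)‖
      - Real.log ‖((F s (neckPoint α (-1))).fst : ℂ)‖) with hc
    have hc1 : 1 ≤ c := Real.one_le_cosh _
    have hB : √(1 + (1 / k) ^ 2) * √(1 + (-1 / k) ^ 2) ≤ √(1 + X ^ 2) * √(1 + X' ^ 2) := by
      have hkp : 0 < 1 / k := by positivity
      refine mul_le_mul (Real.sqrt_le_sqrt ?_) (Real.sqrt_le_sqrt ?_) (by positivity)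
        (by positivity)
      · nlinarith
      · have : (-1 / k) ^ 2 = (1 / k) ^ 2 := by ring
        rw [this]; nlinarith
    have hB0 : 0 < √(1 + X ^ 2) * √(1 + X' ^ 2) := by positivity
    have hprod : X * -X' ≤ 1 / k * (1 / k) := by
      have h1 : √(1 + X ^ 2) * √(1 + X' ^ 2) ≤ √(1 + X ^ 2) * √(1 + X' ^ 2) * c := by nlinarith
      have h2 : 1 / k * (-1 / k) = -(1 / k * (1 / k)) := by ring
      linarith
    have hkp : 0 < 1 / k := by positivity
    have hXeq : X = 1 / k := by
      by_contra hne
      have : 1 / k < X := lt_of_le_of_ne hX1 (Ne.symm hne)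
      nlinarith
    have hXeq' : -X' = 1 / k := by
      by_contra hne
      have : 1 / k < -X' := lt_of_le_of_ne hX2 (Ne.symm hne)
      nlinarith
    have hzero : ∀ v : ℝ, k * (1 / k) = Real.cosh (α * v) → v = 0 := fun v hv => by
      rw [mul_one_div_cancel kpos.ne'] at hv
      have h0 : α * v = 0 := by
        by_contra h0
        exact (Real.one_lt_cosh.2 h0).ne hv
      exact (mul_eq_zero.1 h0).resolve_left hα.ne'
    rw [hXeq] at hv1
    rw [hXeq'] at hv2
    constructor
    · refine HypProd.ext ?_ hp.2
      rw [← paramPoint_pointParam hα (F s (neckPoint α 1)).fst, ← hX, hXeq, hzero _ hv1]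
      rfl
    · refine HypProd.ext ?_ hq.2
      rw [← paramPoint_pointParam hα (F s (neckPoint α (-1))).fst, ← hX', hzero _ hv2,
        show X' = -1 / k by rw [neg_div]; linarith]
      rfl
  -- the fibres over the two points are fixed pointwise
  have hfibre : ∀ σ, (∀ s, F s (neckPoint α σ) = neckPoint α σ) → ∀ h s,
      F s (WithLp.toLp 2 ((neckPoint α σ).fst, h)) = WithLp.toLp 2 ((neckPoint α σ).fst, h) := by
    intro σ hσ h s
    set P : HypProd := WithLp.toLp 2 ((neckPoint α σ).fst, h) with hP
    have hPf : ∀ s, (F s P).fst = (neckPoint α σ).fst := fun s => by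
      have h1 := (IsometryEquiv.fst_eq_iff (F s) P (neckPoint α σ)).2 rfl
      rwa [hσ s] at h1
    refine HypProd.ext (hPf s) ?_
    have h2 : ∀ s, (F s P).snd ^ 2 = h ^ 2 := fun s => by
      have h3 := congrArg (· ^ 2) ((F s).dist_eq P (neckPoint α σ))
      simp only [HypProd.dist_sq] at h3
      rw [hσ s, hPf s] at h3
      have h4 : (neckPoint α σ).snd = 0 := rfl
      rw [h4] at h3
      have h5 : P.snd = h := rfl
      have h6 : P.fst = (neckPoint α σ).fst := rfl
      rw [h5, h6, sub_zero, sub_zero] at h3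
      linarith
    have h7 := eq_of_continuous_of_sq_eq (f := fun s => (F s P).snd) (hsnd.comp (hcont P))
      (fun s => by rw [h2 s, h2 0]) s
    simp only [hF0] at h7
    exact h7
  -- comparing the distances to two points of a fixed fibre
  have hdist : ∀ σ, (∀ s, F s (neckPoint α σ) = neckPoint α σ) → ∀ p s,
      (F s p).snd = p.snd ∧
        dist (F s p).fst (neckPoint α σ).fst = dist p.fst (neckPoint α σ).fst := by
    intro σ hσ p s
    have key : ∀ h : ℝ, dist (F s p).fst (neckPoint α σ).fst ^ 2 + ((F s p).snd - h) ^ 2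
        = dist p.fst (neckPoint α σ).fst ^ 2 + (p.snd - h) ^ 2 := fun h => by
      have h3 := congrArg (· ^ 2) ((F s).dist_eq p (WithLp.toLp 2 ((neckPoint α σ).fst, h)))
      rw [hfibre σ hσ h s] at h3
      simp only [HypProd.dist_sq] at h3
      exact h3
    have h0 := key 0
    have h1 := key 1
    have hsn : (F s p).snd = p.snd := by linarith
    refine ⟨hsn, ?_⟩
    rw [hsn] at h0
    have h4 := add_right_cancel h0
    rwa [sq_eq_sq₀ dist_nonneg dist_nonneg] at h4
  -- the distances to the two fixed fibres determine the slope and `cosh (log |z|)`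
  have hall : ∀ s p, F s p = p := by
    intro s p
    have hX : ∀ s, axialSlope (F s p).fst = axialSlope p.fst ∧
        Real.log ‖((F s p).fst : ℂ)‖ ^ 2 = Real.log ‖(p.fst : ℂ)‖ ^ 2 := by
      intro s
      have h1 := congrArg Real.cosh (hdist 1 (fun s => (hfix s).1) p s).2
      have h2 := congrArg Real.cosh (hdist (-1) (fun s => (hfix s).2) p s).2
      rw [cosh_dist_eq_slope, cosh_dist_eq_slope, hneckslope, hnecklog, sub_zero, sub_zero] at h1 h2
      have h3 : (-1 / k) ^ 2 = (1 / k) ^ 2 := by ring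
      have h4 : -1 / k = -(1 / k) := by ring
      rw [h3, h4] at h2
      have hkp : 0 < 1 / k := by positivity
      have hb : 0 < √(1 + (1 / k) ^ 2) := by positivity
      have hs : axialSlope (F s p).fst = axialSlope p.fst := by
        have : axialSlope (F s p).fst * (1 / k) = axialSlope p.fst * (1 / k) := by linarith
        exact mul_right_cancel₀ hkp.ne' this
      refine ⟨hs, ?_⟩
      rw [hs] at h1
      have hB : 0 < √(1 + axialSlope p.fst ^ 2) * √(1 + (1 / k) ^ 2) := by positivity
      have h5 := mul_left_cancel₀ hB.ne' (sub_left_injective h1)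
      rw [← Real.cosh_abs, ← Real.cosh_abs (Real.log ‖(p.fst : ℂ)‖)] at h5
      have h6 := Real.cosh_strictMonoOn.injOn (Set.mem_Ici.2 (abs_nonneg _))
        (Set.mem_Ici.2 (abs_nonneg _)) h5
      rw [← sq_abs, h6, sq_abs]
    refine HypProd.ext ?_ (hdist 1 (fun s => (hfix s).1) p s).1
    have h7 := eq_of_continuous_of_sq_eq (f := fun s => Real.log ‖((F s p).fst : ℂ)‖)
      (continuous_log_norm.comp (hfst.comp (hcont p)))
      (fun s => by rw [(hX s).2, (hX 0).2]) s
    simp only [hF0] at h7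
    rw [← polarPoint_slope_log_norm (F s p).fst, (hX s).1, h7, polarPoint_slope_log_norm]
  exact IsometryEquiv.ext fun p => hall (Multiplicative.toAdd s₀) p

/-! ### The second fundamental form through directional derivatives of the metric -/

lemma metricInner_add_left (g : (Fin 3 → ℝ) → Matrix (Fin 3) (Fin 3) ℝ) (p a b n : Fin 3 → ℝ) :
    metricInner g p (a + b) n = metricInner g p a n + metricInner g p b n := add_dotProduct _ _ _

lemma metricInner_smul_left (g : (Fin 3 → ℝ) → Matrix (Fin 3) (Fin 3) ℝ) (p a n : Fin 3 → ℝ)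
    (r : ℝ) : metricInner g p (r • a) n = r * metricInner g p a n := smul_dotProduct _ _ _

/-- The derivative in the direction `w` of the metric, evaluated on constant vectors `a, b`. -/
def metricDeriv (g : (Fin 3 → ℝ) → Matrix (Fin 3) (Fin 3) ℝ) (p w a b : Fin 3 → ℝ) : ℝ :=
  fderiv ℝ (fun q => metricInner g q a b) p w

lemma sum_mul_partialDeriv (f : (Fin 3 → ℝ) → ℝ) (p w : Fin 3 → ℝ) :
    ∑ i, w i * partialDeriv i f p = fderiv ℝ f p w := by
  conv_rhs => rw [pi_eq_sum_univ' w]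
  rw [map_sum]
  refine Finset.sum_congr rfl fun i _ => ?_
  rw [map_smul, smul_eq_mul, partialDeriv]

lemma metricDeriv_eq_sum {g : (Fin 3 → ℝ) → Matrix (Fin 3) (Fin 3) ℝ} {p : Fin 3 → ℝ}
    (hg : ∀ i j, DifferentiableAt ℝ (fun q => g q i j) p) (w a b : Fin 3 → ℝ) :
    metricDeriv g p w a b
      = ∑ i, ∑ j, ∑ l, w l * a i * b j * partialDeriv l (fun q => g q i j) p := by
  have h1 : (fun q => metricInner g q a b) = fun q => ∑ i, ∑ j, (a i * b j) * g q i j := by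
    ext q
    simp only [metricInner, dotProduct, Matrix.mulVec, Finset.mul_sum]
    exact Finset.sum_congr rfl fun i _ => Finset.sum_congr rfl fun j _ => by ring
  have h2 : HasFDerivAt (fun q => metricInner g q a b)
      (∑ i, ∑ j, (a i * b j) • fderiv ℝ (fun q => g q i j) p) p := by
    rw [h1]
    refine HasFDerivAt.fun_sum fun i _ => HasFDerivAt.fun_sum fun j _ => ?_
    exact (hg i j).hasFDerivAt.const_mul _
  rw [metricDeriv, h2.fderiv, sum_apply]
  refine Finset.sum_congr rfl fun i _ => ?_
  rw [sum_apply]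
  refine Finset.sum_congr rfl fun j _ => ?_
  rw [smul_apply, smul_eq_mul, ← sum_mul_partialDeriv, Finset.mul_sum]
  exact Finset.sum_congr rfl fun l _ => by ring

/-- Koszul's formula: the metric turns the Christoffel symbols of the second kind into those of the
first kind. -/
lemma metricInner_christoffel {g : (Fin 3 → ℝ) → Matrix (Fin 3) (Fin 3) ℝ} {p : Fin 3 → ℝ}
    (hdet : IsUnit (g p).det) (hsymm : (g p).IsSymm)
    (hg : ∀ i j, DifferentiableAt ℝ (fun q => g q i j) p) (U V n : Fin 3 → ℝ) :
    metricInner g p (fun k => ∑ i, ∑ j, christoffel g k i j p * U i * V j) n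
      = (metricDeriv g p U V n + metricDeriv g p V U n - metricDeriv g p n U V) / 2 := by
  set W : Fin 3 → ℝ := fun l => ∑ i, ∑ j, (1 / 2) * (partialDeriv i (fun q => g q j l) p
    + partialDeriv j (fun q => g q i l) p - partialDeriv l (fun q => g q i j) p) * U i * V j with hW
  have h1 : (fun k => ∑ i, ∑ j, christoffel g k i j p * U i * V j) = (g p)⁻¹ *ᵥ W := by
    ext k
    simp only [Matrix.mulVec, dotProduct, hW, christoffel, Fin.sum_univ_three]
    ring
  have h2 : ((g p)⁻¹ *ᵥ W) ⬝ᵥ (g p *ᵥ n) = W ⬝ᵥ n := by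
    rw [Matrix.dotProduct_mulVec, ← Matrix.mulVec_transpose, hsymm.eq, Matrix.mulVec_mulVec,
      Matrix.mul_nonsing_inv _ hdet, Matrix.one_mulVec]
  rw [metricInner, h1, h2, metricDeriv_eq_sum hg, metricDeriv_eq_sum hg, metricDeriv_eq_sum hg]
  simp only [dotProduct, hW, Fin.sum_univ_three]
  ring

lemma secondForm_eq {g : (Fin 3 → ℝ) → Matrix (Fin 3) (Fin 3) ℝ} {X : ℂ → Fin 3 → ℝ} {z : ℂ}
    (hdet : IsUnit (g (X z)).det) (hsymm : (g (X z)).IsSymm)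
    (hg : ∀ i j, DifferentiableAt ℝ (fun q => g q i j) (X z)) (n : Fin 3 → ℝ) (a b : ℂ) :
    secondForm g X n z a b
      = metricInner g (X z) (fderiv ℝ (fun w => fderiv ℝ X w b) z a) n
        + (metricDeriv g (X z) (fderiv ℝ X z a) (fderiv ℝ X z b) n
          + metricDeriv g (X z) (fderiv ℝ X z b) (fderiv ℝ X z a) n
          - metricDeriv g (X z) n (fderiv ℝ X z a) (fderiv ℝ X z b)) / 2 := by
  rw [← metricInner_christoffel hdet hsymm hg, ← metricInner_add_left]
  rfl

/-! ### The two ambient metrics -/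

/-- The contact form `dx₃ + (x₂ dx₁ - x₁ dx₂) / 2`. -/
def contactForm (p a : Fin 3 → ℝ) : ℝ := p 1 / 2 * a 0 - p 0 / 2 * a 1 + a 2

lemma metricInner_nilMetric (p a b : Fin 3 → ℝ) :
    metricInner nilMetric p a b
      = a 0 * b 0 + a 1 * b 1 + contactForm p a * contactForm p b := by
  simp [metricInner, nilMetric, contactForm, Matrix.mulVec, dotProduct, Fin.sum_univ_three]
  ring

lemma metricInner_hypProdMetric (p a b : Fin 3 → ℝ) :
    metricInner hypProdMetric p a b = (a 0 * b 0 + a 1 * b 1) / p 1 ^ 2 + a 2 * b 2 := by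
  simp [metricInner, hypProdMetric, dotProduct, Fin.sum_univ_three, Matrix.mulVec_diagonal]
  ring

lemma metricDeriv_hypProdMetric {p : Fin 3 → ℝ} (hp : 0 < p 1) (w a b : Fin 3 → ℝ) :
    metricDeriv hypProdMetric p w a b = -2 * (a 0 * b 0 + a 1 * b 1) * w 1 / p 1 ^ 3 := by
  have h1 : HasFDerivAt (fun q : Fin 3 → ℝ => q 1)
      (ContinuousLinearMap.proj (R := ℝ) (φ := fun _ : Fin 3 => ℝ) 1) p := hasFDerivAt_apply 1 p
  have h2 : HasDerivAt (fun y : ℝ => (a 0 * b 0 + a 1 * b 1) / y ^ 2 + a 2 * b 2)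
      (-2 * (a 0 * b 0 + a 1 * b 1) / p 1 ^ 3) (p 1) := by
    have h := (((hasDerivAt_pow 2 (p 1)).fun_inv (pow_ne_zero 2 hp.ne')).const_mul
      (a 0 * b 0 + a 1 * b 1)).add_const (a 2 * b 2)
    refine h.congr_deriv ?_
    push_cast
    field_simp
  have h3 := h2.comp_hasFDerivAt p h1
  rw [metricDeriv]
  simp only [metricInner_hypProdMetric]
  rw [show (fun q : Fin 3 → ℝ => (a 0 * b 0 + a 1 * b 1) / q 1 ^ 2 + a 2 * b 2)
    = (fun y : ℝ => (a 0 * b 0 + a 1 * b 1) / y ^ 2 + a 2 * b 2) ∘ fun q => q 1 from rfl, h3.fderiv]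
  simp only [smul_apply, ContinuousLinearMap.proj_apply, smul_eq_mul]
  ring

lemma metricDeriv_nilMetric (p w a b : Fin 3 → ℝ) :
    metricDeriv nilMetric p w a b = (w 1 * a 0 - w 0 * a 1) / 2 * contactForm p b
      + contactForm p a * ((w 1 * b 0 - w 0 * b 1) / 2) := by
  have hθ : ∀ a : Fin 3 → ℝ, HasFDerivAt (fun q => contactForm q a)
      ((a 0 / 2) • ContinuousLinearMap.proj (R := ℝ) (φ := fun _ : Fin 3 => ℝ) 1
        - (a 1 / 2) • ContinuousLinearMap.proj (R := ℝ) (φ := fun _ : Fin 3 => ℝ) 0) p :=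
      fun a => by
    have h0 : HasFDerivAt (fun q : Fin 3 → ℝ => q 0)
      (ContinuousLinearMap.proj (R := ℝ) (φ := fun _ : Fin 3 => ℝ) 0) p := hasFDerivAt_apply 0 p
    have h1 : HasFDerivAt (fun q : Fin 3 → ℝ => q 1)
      (ContinuousLinearMap.proj (R := ℝ) (φ := fun _ : Fin 3 => ℝ) 1) p := hasFDerivAt_apply 1 p
    have h2 := ((h1.const_mul (a 0 / 2)).fun_sub (h0.const_mul (a 1 / 2))).add_const (a 2)
    refine h2.congr_of_eventuallyEq (Filter.Eventually.of_forall fun q => ?_)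
    simp only [contactForm]; ring
  have h := ((hθ a).fun_mul (hθ b)).const_add (a 0 * b 0 + a 1 * b 1)
  rw [metricDeriv]
  simp only [metricInner_nilMetric]
  rw [h.fderiv]
  simp only [add_apply, smul_apply,
    sub_apply, ContinuousLinearMap.proj_apply, smul_eq_mul]
  ring

lemma hypProdMetric_isSymm (p : Fin 3 → ℝ) : (hypProdMetric p).IsSymm :=
  Matrix.isSymm_diagonal _

lemma hypProdMetric_det {p : Fin 3 → ℝ} (hp : 0 < p 1) : IsUnit (hypProdMetric p).det := by
  rw [isUnit_iff_ne_zero, hypProdMetric, Matrix.det_diagonal, Fin.prod_univ_three]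
  simp [hp.ne']

lemma hypProdMetric_differentiableAt {p : Fin 3 → ℝ} (hp : 0 < p 1) (i j : Fin 3) :
    DifferentiableAt ℝ (fun q => hypProdMetric q i j) p := by
  have h : DifferentiableAt ℝ (fun q : Fin 3 → ℝ => (q 1 ^ 2)⁻¹) p :=
    DifferentiableAt.fun_inv (by fun_prop) (pow_ne_zero 2 hp.ne')
  rcases eq_or_ne i j with rfl | hij
  · fin_cases i
    · simpa [hypProdMetric] using h
    · simpa [hypProdMetric] using h
    · simp [hypProdMetric]
  · simp only [hypProdMetric, Matrix.diagonal_apply_ne _ hij]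
    exact differentiableAt_const _

lemma nilMetric_apply (p : Fin 3 → ℝ) : nilMetric p
    = !![1 + p 1 / 2 * (p 1 / 2), p 1 / 2 * (-p 0 / 2), p 1 / 2;
        -p 0 / 2 * (p 1 / 2), 1 + -p 0 / 2 * (-p 0 / 2), -p 0 / 2; p 1 / 2, -p 0 / 2, 1] := by
  ext i j
  fin_cases i <;> fin_cases j <;> simp [nilMetric]

lemma nilMetric_isSymm (p : Fin 3 → ℝ) : (nilMetric p).IsSymm := by
  apply Matrix.IsSymm.ext
  intro i j
  rw [nilMetric_apply]
  fin_cases i <;> fin_cases j <;> simp [mul_comm]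

lemma nilMetric_det (p : Fin 3 → ℝ) : IsUnit (nilMetric p).det := by
  rw [isUnit_iff_ne_zero, nilMetric_apply, Matrix.det_fin_three]
  simp only [Matrix.of_apply, Matrix.cons_val', Matrix.cons_val_zero, Matrix.cons_val_one,
    Matrix.cons_val]
  ring_nf
  norm_num

lemma nilMetric_differentiableAt (p : Fin 3 → ℝ) (i j : Fin 3) :
    DifferentiableAt ℝ (fun q => nilMetric q i j) p := by
  simp only [nilMetric_apply]
  fin_cases i <;> fin_cases j <;> simp <;> fun_prop

/-! ### Partial derivatives of a parametrised surface -/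

/-- `Xu` and `Xv` are the partial derivatives of the smooth map `X`. -/
structure HasPartials (X Xu Xv : ℂ → Fin 3 → ℝ) : Prop where
  contDiff : ContDiff ℝ ∞ X
  fst : ∀ z i, HasDerivAt (fun u : ℝ => X ⟨u, z.im⟩ i) (Xu z i) z.re
  snd : ∀ z i, HasDerivAt (fun v : ℝ => X ⟨z.re, v⟩ i) (Xv z i) z.im

lemma hasDerivAt_mk_left (z : ℂ) : HasDerivAt (fun u : ℝ => (⟨u, z.im⟩ : ℂ)) 1 z.re := by
  have h : (fun u : ℝ => (⟨u, z.im⟩ : ℂ)) = fun u : ℝ => (u : ℂ) + z.im * Complex.I := by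
    ext u; exact Complex.mk_eq_add_mul_I _ _
  rw [h]
  exact Complex.ofRealCLM.hasDerivAt.add_const _

lemma hasDerivAt_mk_right (z : ℂ) : HasDerivAt (fun v : ℝ => (⟨z.re, v⟩ : ℂ)) Complex.I z.im := by
  have h : (fun v : ℝ => (⟨z.re, v⟩ : ℂ)) = fun v : ℝ => (z.re : ℂ) + (v : ℂ) * Complex.I := by
    ext u; exact Complex.mk_eq_add_mul_I _ _
  rw [h]
  have h1 := (Complex.ofRealCLM.hasDerivAt (x := z.im)).mul_const Complex.I
  have h2 := h1.const_add (z.re : ℂ)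
  simpa using h2

namespace HasPartials

variable {X Xu Xv Xuu Xuv Xvu Xvv : ℂ → Fin 3 → ℝ}

lemma fderiv_one (h : HasPartials X Xu Xv) (z : ℂ) : fderiv ℝ X z 1 = Xu z := by
  have hd : HasFDerivAt X (fderiv ℝ X z) z :=
    (h.contDiff.differentiable (by simp)).differentiableAt.hasFDerivAt
  have h1 : HasDerivAt (fun u : ℝ => X ⟨u, z.im⟩) (fderiv ℝ X z 1) z.re :=
    HasFDerivAt.comp_hasDerivAt z.re (f := fun u : ℝ => (⟨u, z.im⟩ : ℂ)) hd (hasDerivAt_mk_left z)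
  ext i
  exact (hasDerivAt_pi.1 h1 i).unique (h.fst z i)

lemma fderiv_I (h : HasPartials X Xu Xv) (z : ℂ) : fderiv ℝ X z Complex.I = Xv z := by
  have hd : HasFDerivAt X (fderiv ℝ X z) z :=
    (h.contDiff.differentiable (by simp)).differentiableAt.hasFDerivAt
  have h1 : HasDerivAt (fun v : ℝ => X ⟨z.re, v⟩) (fderiv ℝ X z Complex.I) z.im :=
    HasFDerivAt.comp_hasDerivAt z.im (f := fun v : ℝ => (⟨z.re, v⟩ : ℂ)) hd (hasDerivAt_mk_right z)
  ext i
  exact (hasDerivAt_pi.1 h1 i).unique (h.snd z i)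

lemma fderiv_apply (h : HasPartials X Xu Xv) (z a : ℂ) :
    fderiv ℝ X z a = a.re • Xu z + a.im • Xv z := by
  have ha : a = a.re • (1 : ℂ) + a.im • Complex.I := by
    apply Complex.ext <;> simp
  conv_lhs => rw [ha, map_add, map_smul, map_smul, h.fderiv_one, h.fderiv_I]

lemma contDiff_fst (h : HasPartials X Xu Xv) : ContDiff ℝ ∞ Xu := by
  have h1 : ContDiff ℝ ∞ fun z => fderiv ℝ X z 1 :=
    (h.contDiff.fderiv_right (m := ∞) (by simp)).clm_apply contDiff_const
  simpa only [h.fderiv_one] using h1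

lemma contDiff_snd (h : HasPartials X Xu Xv) : ContDiff ℝ ∞ Xv := by
  have h1 : ContDiff ℝ ∞ fun z => fderiv ℝ X z Complex.I :=
    (h.contDiff.fderiv_right (m := ∞) (by simp)).clm_apply contDiff_const
  simpa only [h.fderiv_I] using h1

lemma fderiv_fderiv_apply (h : HasPartials X Xu Xv) (hu : HasPartials Xu Xuu Xuv)
    (hv : HasPartials Xv Xvu Xvv) (z a b : ℂ) :
    fderiv ℝ (fun w => fderiv ℝ X w b) z a
      = b.re • (a.re • Xuu z + a.im • Xuv z) + b.im • (a.re • Xvu z + a.im • Xvv z) := by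
  have h1 : (fun w => fderiv ℝ X w b) = fun w => b.re • Xu w + b.im • Xv w := by
    ext w i; rw [h.fderiv_apply]
  have hdu : DifferentiableAt ℝ Xu z := (hu.contDiff.differentiable (by simp)).differentiableAt
  have hdv : DifferentiableAt ℝ Xv z := (hv.contDiff.differentiable (by simp)).differentiableAt
  rw [h1, ((hdu.hasFDerivAt.fun_const_smul b.re).fun_add
    (hdv.hasFDerivAt.fun_const_smul b.im)).fderiv, add_apply, smul_apply, smul_apply,
    hu.fderiv_apply, hv.fderiv_apply]

end HasPartials

/-! ### Derivatives of the profile -/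

section Profile

variable {α : ℝ} {φ : ℝ → ℝ}

lemma sqrt_eq_profileDenom_sub (α : ℝ) (φ : ℝ → ℝ) (u : ℝ) :
    √(α ^ 2 + Real.cos (φ u) ^ 2) = profileDenom α φ u - α := by rw [profileDenom]; ring

lemma IsProfile.hasDerivAt_cos (h : IsProfile α φ) (u : ℝ) :
    HasDerivAt (fun u => Real.cos (φ u)) (Real.sin (φ u) * (profileDenom α φ u - α)) u := by
  refine (h.2 u).cos.congr_deriv ?_
  rw [sqrt_eq_profileDenom_sub]; ring

lemma IsProfile.hasDerivAt_sin (h : IsProfile α φ) (u : ℝ) :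
    HasDerivAt (fun u => Real.sin (φ u)) (-Real.cos (φ u) * (profileDenom α φ u - α)) u := by
  refine (h.2 u).sin.congr_deriv ?_
  rw [sqrt_eq_profileDenom_sub]; ring

lemma IsProfile.hasDerivAt_profileDenom (hα : 0 < α) (h : IsProfile α φ) (u : ℝ) :
    HasDerivAt (profileDenom α φ) (Real.cos (φ u) * Real.sin (φ u)) u := by
  have hpos := profile_radicand_pos hα (φ u)
  have h1 := ((((h.hasDerivAt_cos u).fun_pow 2).const_add (α ^ 2)).sqrt hpos.ne').const_add α
  refine h1.congr_deriv ?_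
  rw [sqrt_eq_profileDenom_sub]
  have h2 : profileDenom α φ u - α ≠ 0 := by
    rw [← sqrt_eq_profileDenom_sub]; exact (Real.sqrt_pos.2 hpos).ne'
  push_cast
  field_simp

lemma IsProfile.contDiff_profileDenom (hα : 0 < α) (h : IsProfile α φ) :
    ContDiff ℝ ∞ (profileDenom α φ) :=
  contDiff_const.add ((contDiff_profile_speed hα).comp (h.contDiff hα))

lemma hasDerivAt_profileG (hα : 0 < α) (h : IsProfile α φ) (u : ℝ) :
    HasDerivAt (profileG α φ) (-(1 / profileDenom α φ u)) u := by
  have hc : Continuous fun s => -(1 / profileDenom α φ s) :=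
    (continuous_const.div (h.contDiff_profileDenom hα).continuous
      fun s => (profileDenom_pos hα φ s).ne').neg
  exact intervalIntegral.integral_hasDerivAt_right (hc.intervalIntegrable _ _)
    (hc.stronglyMeasurableAtFilter _ _) hc.continuousAt

lemma contDiff_profileG (hα : 0 < α) (h : IsProfile α φ) : ContDiff ℝ ∞ (profileG α φ) := by
  have hd : deriv (profileG α φ) = fun u => -(1 / profileDenom α φ u) :=
    funext fun u => (hasDerivAt_profileG hα h u).deriv
  rw [contDiff_infty_iff_deriv, hd]
  refine ⟨fun u => (hasDerivAt_profileG hα h u).differentiableAt, ?_⟩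
  exact (contDiff_const.div (h.contDiff_profileDenom hα)
    fun s => (profileDenom_pos hα φ s).ne').neg

lemma hasDerivAt_sinh_mul (α v : ℝ) :
    HasDerivAt (fun v => Real.sinh (α * v)) (α * Real.cosh (α * v)) v := by
  refine ((hasDerivAt_id' v).const_mul α).sinh.congr_deriv ?_
  ring

lemma hasDerivAt_cosh_mul (α v : ℝ) :
    HasDerivAt (fun v => Real.cosh (α * v)) (α * Real.sinh (α * v)) v := by
  refine ((hasDerivAt_id' v).const_mul α).cosh.congr_deriv ?_
  ring

lemma contDiff_re : ContDiff ℝ ∞ (fun z : ℂ => z.re) := Complex.reCLM.contDiff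

lemma contDiff_im : ContDiff ℝ ∞ (fun z : ℂ => z.im) := Complex.imCLM.contDiff

lemma contDiff_sinh_mul_im (α : ℝ) : ContDiff ℝ ∞ (fun z : ℂ => Real.sinh (α * z.im)) :=
  Real.contDiff_sinh.comp (contDiff_const.mul contDiff_im)

lemma contDiff_cosh_mul_im (α : ℝ) : ContDiff ℝ ∞ (fun z : ℂ => Real.cosh (α * z.im)) :=
  Real.contDiff_cosh.comp (contDiff_const.mul contDiff_im)

lemma IsProfile.contDiff_cos_re (hα : 0 < α) (h : IsProfile α φ) :
    ContDiff ℝ ∞ (fun z : ℂ => Real.cos (φ z.re)) :=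
  Real.contDiff_cos.comp ((h.contDiff hα).comp contDiff_re)

lemma IsProfile.contDiff_sin_re (hα : 0 < α) (h : IsProfile α φ) :
    ContDiff ℝ ∞ (fun z : ℂ => Real.sin (φ z.re)) :=
  Real.contDiff_sin.comp ((h.contDiff hα).comp contDiff_re)

lemma IsProfile.contDiff_profileDenom_re (hα : 0 < α) (h : IsProfile α φ) :
    ContDiff ℝ ∞ (fun z : ℂ => profileDenom α φ z.re) :=
  (h.contDiff_profileDenom hα).comp contDiff_re

lemma IsProfile.hasDerivAt_cos_div (hα : 0 < α) (h : IsProfile α φ) (u : ℝ) :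
    HasDerivAt (fun u => Real.cos (φ u) / profileDenom α φ u)
      (α * Real.sin (φ u) / profileDenom α φ u) u := by
  have hd := (profileDenom_pos hα φ u).ne'
  refine ((h.hasDerivAt_cos u).fun_div (h.hasDerivAt_profileDenom hα u) hd).congr_deriv ?_
  have h2 := profileDenom_sq (α := α) φ u
  field_simp
  linear_combination Real.sin (φ u) * h2

lemma IsProfile.hasDerivAt_sin_div (hα : 0 < α) (h : IsProfile α φ) (u : ℝ) :
    HasDerivAt (fun u => Real.sin (φ u) / profileDenom α φ u)
      (-Real.cos (φ u) * (1 + α * profileDenom α φ u) / profileDenom α φ u ^ 2) u := by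
  have hd := (profileDenom_pos hα φ u).ne'
  refine ((h.hasDerivAt_sin u).fun_div (h.hasDerivAt_profileDenom hα u) hd).congr_deriv ?_
  have h2 := profileDenom_sq (α := α) φ u
  have h3 := Real.sin_sq_add_cos_sq (φ u)
  field_simp
  linear_combination (-Real.cos (φ u)) * h2 - Real.cos (φ u) * h3

lemma IsProfile.hasDerivAt_inv (hα : 0 < α) (h : IsProfile α φ) (u : ℝ) :
    HasDerivAt (fun u => 1 / profileDenom α φ u)
      (-(Real.cos (φ u) * Real.sin (φ u)) / profileDenom α φ u ^ 2) u := by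
  have hd := (profileDenom_pos hα φ u).ne'
  simpa only [one_div] using (h.hasDerivAt_profileDenom hα u).fun_inv hd

end Profile

/-! ### The helicoidal surface in the Heisenberg group -/

section Helicoid

/-- The vector at `p` with horizontal components `a`, `b` on which the contact form is `c`. -/
def contactLift (p : Fin 3 → ℝ) (a b c : ℝ) : Fin 3 → ℝ := ![a, b, c - p 1 / 2 * a + p 0 / 2 * b]

lemma contactLift_zero (p : Fin 3 → ℝ) (a b c : ℝ) : contactLift p a b c 0 = a := rfl

lemma contactLift_one (p : Fin 3 → ℝ) (a b c : ℝ) : contactLift p a b c 1 = b := rfl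

lemma contactLift_two (p : Fin 3 → ℝ) (a b c : ℝ) :
    contactLift p a b c 2 = c - p 1 / 2 * a + p 0 / 2 * b := rfl

@[simp] lemma contactForm_contactLift (p : Fin 3 → ℝ) (a b c : ℝ) :
    contactForm p (contactLift p a b c) = c := by
  simp only [contactForm, contactLift_zero, contactLift_one, contactLift_two]; ring

lemma contDiff_contactLift {X : ℂ → Fin 3 → ℝ} {a b c : ℂ → ℝ} (hX : ContDiff ℝ ∞ X)
    (ha : ContDiff ℝ ∞ a) (hb : ContDiff ℝ ∞ b) (hc : ContDiff ℝ ∞ c) :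
    ContDiff ℝ ∞ fun z => contactLift (X z) (a z) (b z) (c z) := by
  have h0 : ContDiff ℝ ∞ fun z => X z 0 := contDiff_pi.1 hX 0
  have h1 : ContDiff ℝ ∞ fun z => X z 1 := contDiff_pi.1 hX 1
  rw [contDiff_pi]
  intro i
  fin_cases i
  · exact ha
  · exact hb
  · exact (hc.sub ((h1.div_const 2).mul ha)).add ((h0.div_const 2).mul hb)

variable (α : ℝ) (φ : ℝ → ℝ)

/-- The derivative `∂ᵤ` of the helicoidal surface. -/
def helicoidU (z : ℂ) : Fin 3 → ℝ :=
  contactLift (helicoidParam α φ z)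
    (-Real.sinh (α * z.im) * (Real.sin (φ z.re) / profileDenom α φ z.re))
    (1 / profileDenom α φ z.re)
    (-Real.sinh (α * z.im) * (Real.cos (φ z.re) / profileDenom α φ z.re))

/-- The derivative `∂ᵥ` of the helicoidal surface. -/
def helicoidV (z : ℂ) : Fin 3 → ℝ :=
  contactLift (helicoidParam α φ z)
    (-Real.cosh (α * z.im) * (Real.cos (φ z.re) / profileDenom α φ z.re)) 0
    (Real.cosh (α * z.im) * (Real.sin (φ z.re) / profileDenom α φ z.re))

/-- The derivative `∂ᵤ²` of the helicoidal surface. -/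
def helicoidUU (z : ℂ) : Fin 3 → ℝ :=
  contactLift (helicoidParam α φ z)
    (Real.sinh (α * z.im) *
      (Real.cos (φ z.re) * (1 + α * profileDenom α φ z.re) / profileDenom α φ z.re ^ 2))
    (-(Real.cos (φ z.re) * Real.sin (φ z.re)) / profileDenom α φ z.re ^ 2)
    (-Real.sinh (α * z.im) * (α * Real.sin (φ z.re) / profileDenom α φ z.re))

/-- The mixed derivative `∂ᵤ∂ᵥ` of the helicoidal surface. -/
def helicoidUV (z : ℂ) : Fin 3 → ℝ :=
  contactLift (helicoidParam α φ z)
    (-(α * Real.cosh (α * z.im)) * (Real.sin (φ z.re) / profileDenom α φ z.re)) 0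
    (-(α * Real.cosh (α * z.im)) * (Real.cos (φ z.re) / profileDenom α φ z.re)
      - Real.cosh (α * z.im) * Real.cos (φ z.re) / (2 * profileDenom α φ z.re ^ 2))

/-- The derivative `∂ᵥ²` of the helicoidal surface. -/
def helicoidVV (z : ℂ) : Fin 3 → ℝ :=
  contactLift (helicoidParam α φ z)
    (-(α * Real.sinh (α * z.im)) * (Real.cos (φ z.re) / profileDenom α φ z.re)) 0
    (α * Real.sinh (α * z.im) * (Real.sin (φ z.re) / profileDenom α φ z.re))

/-- The unit normal of the helicoidal surface. -/
def helicoidNormal (z : ℂ) : Fin 3 → ℝ :=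
  contactLift (helicoidParam α φ z) (Real.sin (φ z.re) / Real.cosh (α * z.im))
    (Real.sinh (α * z.im) / Real.cosh (α * z.im)) (Real.cos (φ z.re) / Real.cosh (α * z.im))

variable {α φ}

lemma helicoidParam_zero (z : ℂ) : helicoidParam α φ z 0
    = -(Real.cos (φ z.re) / profileDenom α φ z.re) * (Real.sinh (α * z.im) / α) := by
  simp only [helicoidParam, Matrix.cons_val_zero]; ring

lemma helicoidParam_one (z : ℂ) : helicoidParam α φ z 1 = -profileG α φ z.re := rfl

lemma helicoidParam_two (z : ℂ) : helicoidParam α φ z 2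
    = Real.sin (φ z.re) / profileDenom α φ z.re * (Real.sinh (α * z.im) / α)
      - helicoidParam α φ z 0 * helicoidParam α φ z 1 / 2 := by
  simp only [helicoidParam, Matrix.cons_val_zero, Matrix.cons_val_one, Matrix.cons_val]; ring

lemma contDiff_helicoidParam (hα : 0 < α) (h : IsProfile α φ) :
    ContDiff ℝ ∞ (helicoidParam α φ) := by
  have hc := h.contDiff_cos_re hα
  have hs := h.contDiff_sin_re hα
  have hd := h.contDiff_profileDenom_re hα
  have hS := contDiff_sinh_mul_im α
  have hd0 : ∀ z : ℂ, profileDenom α φ z.re ≠ 0 := fun z => (profileDenom_pos hα φ _).ne'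
  have h0 : ContDiff ℝ ∞ fun z => helicoidParam α φ z 0 := by
    simp only [helicoidParam_zero]
    exact (hc.div hd hd0).neg.mul (hS.div_const _)
  have h1 : ContDiff ℝ ∞ fun z => helicoidParam α φ z 1 :=
    ((contDiff_profileG hα h).comp contDiff_re).neg
  rw [contDiff_pi]
  intro i
  fin_cases i
  · exact h0
  · exact h1
  · change ContDiff ℝ ∞ fun z => helicoidParam α φ z 2
    simp only [helicoidParam_two]
    exact ((hs.div hd hd0).mul (hS.div_const _)).sub ((h0.mul h1).div_const 2)

lemma hasPartials_helicoidParam (hα : 0 < α) (h : IsProfile α φ) :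
    HasPartials (helicoidParam α φ) (helicoidU α φ) (helicoidV α φ) := by
  have hd0 : ∀ z : ℂ, profileDenom α φ z.re ≠ 0 := fun z => (profileDenom_pos hα φ _).ne'
  have hα0 := hα.ne'
  have u0 : ∀ z : ℂ, HasDerivAt (fun u : ℝ => helicoidParam α φ ⟨u, z.im⟩ 0)
      (helicoidU α φ z 0) z.re := fun z => by
    simp only [helicoidParam_zero]
    refine ((h.hasDerivAt_cos_div hα z.re).fun_neg.mul_const _).congr_deriv ?_
    simp only [helicoidU, contactLift_zero]
    field_simp
  have u1 : ∀ z : ℂ, HasDerivAt (fun u : ℝ => helicoidParam α φ ⟨u, z.im⟩ 1)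
      (helicoidU α φ z 1) z.re := fun z => by
    simp only [helicoidParam_one]
    refine (hasDerivAt_profileG hα h z.re).fun_neg.congr_deriv ?_
    simp only [helicoidU, contactLift_one, neg_neg]
  have v0 : ∀ z : ℂ, HasDerivAt (fun v : ℝ => helicoidParam α φ ⟨z.re, v⟩ 0)
      (helicoidV α φ z 0) z.im := fun z => by
    simp only [helicoidParam_zero]
    refine (((hasDerivAt_sinh_mul α z.im).div_const α).const_mul _).congr_deriv ?_
    simp only [helicoidV, contactLift_zero]
    field_simp
  have v1 : ∀ z : ℂ, HasDerivAt (fun v : ℝ => helicoidParam α φ ⟨z.re, v⟩ 1)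
      (helicoidV α φ z 1) z.im := fun z => by
    simp only [helicoidParam_one]
    exact hasDerivAt_const _ _
  refine ⟨contDiff_helicoidParam hα h, fun z i => ?_, fun z i => ?_⟩
  · fin_cases i
    · exact u0 z
    · exact u1 z
    · change HasDerivAt (fun u : ℝ => helicoidParam α φ ⟨u, z.im⟩ 2) _ _
      simp only [helicoidParam_two]
      refine (((h.hasDerivAt_sin_div hα z.re).mul_const _).fun_sub
        (((u0 z).fun_mul (u1 z)).div_const 2)).congr_deriv ?_
      change _ = helicoidU α φ z 2
      simp only [helicoidU, contactLift_zero, contactLift_one, contactLift_two, helicoidParam_zero,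
        Complex.eta]
      have := hd0 z
      field_simp
      ring
  · fin_cases i
    · exact v0 z
    · exact v1 z
    · change HasDerivAt (fun v : ℝ => helicoidParam α φ ⟨z.re, v⟩ 2) _ _
      simp only [helicoidParam_two]
      refine ((((hasDerivAt_sinh_mul α z.im).div_const α).const_mul _).fun_sub
        (((v0 z).fun_mul (v1 z)).div_const 2)).congr_deriv ?_
      change _ = helicoidV α φ z 2
      simp only [helicoidV, contactLift_zero, contactLift_one, contactLift_two, helicoidParam_zero,
        Complex.eta]
      have := hd0 z
      field_simp
      ring

/-- The derivative of a `contactLift` along a curve: the contact component is corrected by the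
motion of the base point. -/
lemma hasDerivAt_contactLift {p : ℝ → Fin 3 → ℝ} {a b c : ℝ → ℝ} {p' : Fin 3 → ℝ} {a' b' c' u : ℝ}
    (hp : ∀ i, HasDerivAt (fun u => p u i) (p' i) u) (ha : HasDerivAt a a' u)
    (hb : HasDerivAt b b' u) (hc : HasDerivAt c c' u) (i : Fin 3) :
    HasDerivAt (fun u => contactLift (p u) (a u) (b u) (c u) i)
      (contactLift (p u) a' b' (c' - p' 1 / 2 * a u + p' 0 / 2 * b u) i) u := by
  fin_cases i
  · exact ha
  · exact hb
  · refine ((hc.fun_sub (((hp 1).div_const 2).fun_mul ha)).fun_add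
      (((hp 0).div_const 2).fun_mul hb)).congr_deriv ?_
    change _ = contactLift (p u) a' b' _ 2
    rw [contactLift_two]
    ring

lemma contactLift_congr (p : Fin 3 → ℝ) {a a' b b' c c' : ℝ} (ha : a = a') (hb : b = b')
    (hc : c = c') (i : Fin 3) : contactLift p a b c i = contactLift p a' b' c' i := by
  rw [ha, hb, hc]

lemma hasPartials_helicoidU (hα : 0 < α) (h : IsProfile α φ) :
    HasPartials (helicoidU α φ) (helicoidUU α φ) (helicoidUV α φ) := by
  have hX := hasPartials_helicoidParam hα h
  refine ⟨hX.contDiff_fst, fun z i => ?_, fun z i => ?_⟩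
  · simp only [helicoidU]
    refine (hasDerivAt_contactLift (hX.fst z) ((h.hasDerivAt_sin_div hα z.re).const_mul _)
      (h.hasDerivAt_inv hα z.re) ((h.hasDerivAt_cos_div hα z.re).const_mul _) i).congr_deriv ?_
    refine contactLift_congr _ (by ring) rfl ?_ i
    simp only [helicoidU, contactLift_zero, contactLift_one]
    ring
  · simp only [helicoidU]
    refine (hasDerivAt_contactLift (hX.snd z) ((hasDerivAt_sinh_mul α z.im).fun_neg.mul_const _)
      (hasDerivAt_const _ _) ((hasDerivAt_sinh_mul α z.im).fun_neg.mul_const _) i).congr_deriv ?_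
    refine contactLift_congr _ rfl rfl ?_ i
    simp only [helicoidV, contactLift_zero, contactLift_one]
    field_simp
    ring

lemma hasPartials_helicoidV (hα : 0 < α) (h : IsProfile α φ) :
    HasPartials (helicoidV α φ) (helicoidUV α φ) (helicoidVV α φ) := by
  have hX := hasPartials_helicoidParam hα h
  refine ⟨hX.contDiff_snd, fun z i => ?_, fun z i => ?_⟩
  · simp only [helicoidV]
    refine (hasDerivAt_contactLift (hX.fst z) ((h.hasDerivAt_cos_div hα z.re).const_mul _)
      (hasDerivAt_const _ _) ((h.hasDerivAt_sin_div hα z.re).const_mul _) i).congr_deriv ?_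
    refine contactLift_congr _ (by ring) rfl ?_ i
    simp only [helicoidU, contactLift_zero, contactLift_one]
    field_simp
    ring
  · simp only [helicoidV]
    refine (hasDerivAt_contactLift (hX.snd z) ((hasDerivAt_cosh_mul α z.im).fun_neg.mul_const _)
      (hasDerivAt_const _ _) ((hasDerivAt_cosh_mul α z.im).mul_const _) i).congr_deriv ?_
    refine contactLift_congr _ rfl rfl ?_ i
    simp only [helicoidV, contactLift_zero, contactLift_one]
    ring

end Helicoid

/-! ### Geometry of the helicoidal surface -/

section

variable {α : ℝ} {φ : ℝ → ℝ}

lemma secondForm_nilMetric (X : ℂ → Fin 3 → ℝ) (z : ℂ) (n : Fin 3 → ℝ) (a b : ℂ) :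
    secondForm nilMetric X n z a b
      = metricInner nilMetric (X z) (fderiv ℝ (fun w => fderiv ℝ X w b) z a) n
        + contactForm (X z) (fderiv ℝ X z b)
            * ((fderiv ℝ X z a 1 * n 0 - fderiv ℝ X z a 0 * n 1) / 2)
        + contactForm (X z) (fderiv ℝ X z a)
            * ((fderiv ℝ X z b 1 * n 0 - fderiv ℝ X z b 0 * n 1) / 2) := by
  rw [secondForm_eq (nilMetric_det _) (nilMetric_isSymm _) (nilMetric_differentiableAt _),
    metricDeriv_nilMetric, metricDeriv_nilMetric, metricDeriv_nilMetric]
  ring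

lemma contactForm_add (p a b : Fin 3 → ℝ) :
    contactForm p (a + b) = contactForm p a + contactForm p b := by
  simp only [contactForm, Pi.add_apply]; ring

lemma contactForm_smul (p a : Fin 3 → ℝ) (r : ℝ) :
    contactForm p (r • a) = r * contactForm p a := by
  simp only [contactForm, Pi.smul_apply, smul_eq_mul]; ring

lemma firstForm_helicoidParam (hα : 0 < α) (h : IsProfile α φ) (z a b : ℂ) :
    firstForm nilMetric (helicoidParam α φ) z a b
      = (Real.cosh (α * z.im) / profileDenom α φ z.re) ^ 2 * (a.re * b.re + a.im * b.im) := by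
  have hX := hasPartials_helicoidParam hα h
  have hd := (profileDenom_pos hα φ z.re).ne'
  rw [firstForm, hX.fderiv_apply, hX.fderiv_apply, metricInner_nilMetric]
  simp only [contactForm_add, contactForm_smul, Pi.add_apply, Pi.smul_apply, smul_eq_mul,
    helicoidU, helicoidV, contactForm_contactLift, contactLift_zero, contactLift_one]
  have h1 := Real.cosh_sq' (α * z.im)
  have h2 := Real.sin_sq_add_cos_sq (φ z.re)
  set S := Real.sinh (α * z.im)
  set C := Real.cosh (α * z.im)
  field_simp
  linear_combination (S ^ 2 * a.re * b.re + C ^ 2 * a.im * b.im) * h2 - a.re * b.re * h1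

lemma isUnitNormalAt_helicoidNormal (hα : 0 < α) (h : IsProfile α φ) (z : ℂ) :
    IsUnitNormalAt nilMetric (helicoidParam α φ) (helicoidNormal α φ z) z := by
  have hX := hasPartials_helicoidParam hα h
  have hd := (profileDenom_pos hα φ z.re).ne'
  have h1 := Real.cosh_sq' (α * z.im)
  have h2 := Real.sin_sq_add_cos_sq (φ z.re)
  have hC := (Real.cosh_pos (α * z.im)).ne'
  constructor
  · rw [metricInner_nilMetric]
    simp only [helicoidNormal, contactForm_contactLift, contactLift_zero, contactLift_one]
    field_simp
    linear_combination h2 - h1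
  · intro a
    rw [hX.fderiv_apply, metricInner_nilMetric]
    simp only [contactForm_add, contactForm_smul, Pi.add_apply, Pi.smul_apply, smul_eq_mul,
      helicoidU, helicoidV, helicoidNormal, contactForm_contactLift, contactLift_zero,
      contactLift_one]
    field_simp
    linear_combination (-Real.sinh (α * z.im) * a.re) * h2

/-- The second fundamental form of the helicoidal surface. -/
lemma secondForm_helicoidParam (hα : 0 < α) (h : IsProfile α φ) (z a b : ℂ) :
    secondForm nilMetric (helicoidParam α φ) (helicoidNormal α φ z) z a b
      = -(Real.cos (φ z.re) * Real.sin (φ z.re) * Real.sinh (α * z.im) * Real.cosh (α * z.im)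
            / profileDenom α φ z.re ^ 2) * (a.re * b.re - a.im * b.im)
        + (-(α / profileDenom α φ z.re) + Real.cosh (α * z.im) ^ 2
            * (Real.sin (φ z.re) ^ 2 - Real.cos (φ z.re) ^ 2) / (2 * profileDenom α φ z.re ^ 2))
          * (a.re * b.im + a.im * b.re) := by
  have hX := hasPartials_helicoidParam hα h
  have hd := (profileDenom_pos hα φ z.re).ne'
  have h1 := Real.cosh_sq' (α * z.im)
  have h2 := Real.sin_sq_add_cos_sq (φ z.re)
  have hC := (Real.cosh_pos (α * z.im)).ne'
  rw [secondForm_nilMetric, hX.fderiv_fderiv_apply (hasPartials_helicoidU hα h)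
    (hasPartials_helicoidV hα h), hX.fderiv_apply, hX.fderiv_apply, metricInner_nilMetric]
  simp only [contactForm_add, contactForm_smul, Pi.add_apply, Pi.smul_apply, smul_eq_mul,
    helicoidU, helicoidV, helicoidUU, helicoidUV, helicoidVV, helicoidNormal,
    contactForm_contactLift, contactLift_zero, contactLift_one]
  set S := Real.sinh (α * z.im)
  set C := Real.cosh (α * z.im)
  set s := Real.sin (φ z.re)
  set c := Real.cos (φ z.re)
  set d := profileDenom α φ z.re
  have hc2 : c ^ 2 = 1 - s ^ 2 := by linear_combination h2
  have hS2 : S ^ 2 = C ^ 2 - 1 := by linear_combination -h1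
  field_simp
  ring_nf
  simp only [hc2, hS2, show S ^ 3 = S * (C ^ 2 - 1) by rw [← hS2]; ring]
  ring

lemma continuous_helicoidNormal (hα : 0 < α) (h : IsProfile α φ) :
    Continuous (helicoidNormal α φ) := by
  have hc := (h.contDiff_cos_re hα)
  have hs := (h.contDiff_sin_re hα)
  have hC : ∀ z : ℂ, Real.cosh (α * z.im) ≠ 0 := fun z => (Real.cosh_pos _).ne'
  have hCc := (contDiff_cosh_mul_im α)
  exact (contDiff_contactLift (contDiff_helicoidParam hα h) (hs.div hCc hC)
    ((contDiff_sinh_mul_im α).div hCc hC) (hc.div hCc hC)).continuous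

lemma det_helicoid_pos (hα : 0 < α) (h : IsProfile α φ) (z : ℂ) :
    0 < (Matrix.of ![fderiv ℝ (helicoidParam α φ) z 1, fderiv ℝ (helicoidParam α φ) z Complex.I,
      helicoidNormal α φ z]).det := by
  have hX := hasPartials_helicoidParam hα h
  have hd := profileDenom_pos hα φ z.re
  have h1 := Real.cosh_sq' (α * z.im)
  have h2 := Real.sin_sq_add_cos_sq (φ z.re)
  have hC := Real.cosh_pos (α * z.im)
  have hdet : (Matrix.of ![fderiv ℝ (helicoidParam α φ) z 1,
      fderiv ℝ (helicoidParam α φ) z Complex.I, helicoidNormal α φ z]).det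
      = (Real.cosh (α * z.im) / profileDenom α φ z.re) ^ 2 := by
    rw [hX.fderiv_one, hX.fderiv_I, Matrix.det_fin_three]
    simp only [Matrix.of_apply, Matrix.cons_val_zero, Matrix.cons_val_one, Matrix.cons_val]
    simp only [helicoidU, helicoidV, helicoidNormal, contactLift_zero, contactLift_one,
      contactLift_two]
    set S := Real.sinh (α * z.im)
    set C := Real.cosh (α * z.im)
    set s := Real.sin (φ z.re)
    set c := Real.cos (φ z.re)
    set d := profileDenom α φ z.re
    field_simp
    linear_combination 2 * C * (1 + S ^ 2) * h2 - 2 * C * h1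
  rw [hdet]
  positivity

end

/-! ### Moving frames in `ℍ² × ℝ` -/

section

/-- The connection of `ℍ² × ℝ` in half-plane coordinates: the inner product with `n` of the
covariant derivative `W + Γ(U, V)`. -/
def hypConnection (p W U V n : Fin 3 → ℝ) : ℝ :=
  (W 0 * n 0 + W 1 * n 1) / p 1 ^ 2 + W 2 * n 2
    - ((V 0 * n 0 + V 1 * n 1) * U 1 + (U 0 * n 0 + U 1 * n 1) * V 1
      - (U 0 * V 0 + U 1 * V 1) * n 1) / p 1 ^ 3

lemma secondForm_hypProdMetric {X Xu Xv Xuu Xuv Xvu Xvv : ℂ → Fin 3 → ℝ} {z : ℂ}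
    (hz : 0 < X z 1) (h : HasPartials X Xu Xv) (hu : HasPartials Xu Xuu Xuv)
    (hv : HasPartials Xv Xvu Xvv) (n : Fin 3 → ℝ) (a b : ℂ) :
    secondForm hypProdMetric X n z a b
      = a.re * b.re * hypConnection (X z) (Xuu z) (Xu z) (Xu z) n
        + a.re * b.im * hypConnection (X z) (Xvu z) (Xu z) (Xv z) n
        + a.im * b.re * hypConnection (X z) (Xuv z) (Xv z) (Xu z) n
        + a.im * b.im * hypConnection (X z) (Xvv z) (Xv z) (Xv z) n := by
  rw [secondForm_eq (hypProdMetric_det hz) (hypProdMetric_isSymm _)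
    (hypProdMetric_differentiableAt hz), metricDeriv_hypProdMetric hz,
    metricDeriv_hypProdMetric hz, metricDeriv_hypProdMetric hz, h.fderiv_fderiv_apply hu hv,
    h.fderiv_apply, h.fderiv_apply, metricInner_hypProdMetric]
  simp only [Pi.add_apply, Pi.smul_apply, smul_eq_mul, hypConnection]
  ring

/-- The coordinate vector whose components in the orthonormal frame `y ∂ₓ, y ∂_y, ∂ₜ` are the
components of `n` divided by `D`. -/
def frameVec (y D : ℝ) (n : Fin 3 → ℝ) : Fin 3 → ℝ := ![y * (n 0 / D), y * (n 1 / D), n 2 / D]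

/-- The derivative of `frameVec y D n` when `n`, `D`, `y` have derivatives `n'`, `D'`, `y ρ`. -/
def frameDeriv (y D D' ρ : ℝ) (n n' : Fin 3 → ℝ) : Fin 3 → ℝ :=
  ![y * ((n' 0 * D - n 0 * D') / D ^ 2 + ρ * (n 0 / D)),
    y * ((n' 1 * D - n 1 * D') / D ^ 2 + ρ * (n 1 / D)), (n' 2 * D - n 2 * D') / D ^ 2]

lemma frameVec_zero (y D : ℝ) (n : Fin 3 → ℝ) : frameVec y D n 0 = y * (n 0 / D) := rfl
lemma frameVec_one (y D : ℝ) (n : Fin 3 → ℝ) : frameVec y D n 1 = y * (n 1 / D) := rfl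
lemma frameVec_two (y D : ℝ) (n : Fin 3 → ℝ) : frameVec y D n 2 = n 2 / D := rfl

lemma frameDeriv_zero (y D D' ρ : ℝ) (n n' : Fin 3 → ℝ) : frameDeriv y D D' ρ n n' 0
    = y * ((n' 0 * D - n 0 * D') / D ^ 2 + ρ * (n 0 / D)) := rfl
lemma frameDeriv_one (y D D' ρ : ℝ) (n n' : Fin 3 → ℝ) : frameDeriv y D D' ρ n n' 1
    = y * ((n' 1 * D - n 1 * D') / D ^ 2 + ρ * (n 1 / D)) := rfl
lemma frameDeriv_two (y D D' ρ : ℝ) (n n' : Fin 3 → ℝ) : frameDeriv y D D' ρ n n' 2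
    = (n' 2 * D - n 2 * D') / D ^ 2 := rfl

lemma hasDerivAt_frameVec {y D : ℝ → ℝ} {n : ℝ → Fin 3 → ℝ} {D' ρ u : ℝ} {n' : Fin 3 → ℝ}
    (hy : HasDerivAt y (y u * ρ) u) (hD : HasDerivAt D D' u) (hD0 : D u ≠ 0)
    (hn : ∀ i, HasDerivAt (fun u => n u i) (n' i) u) (i : Fin 3) :
    HasDerivAt (fun u => frameVec (y u) (D u) (n u) i)
      (frameDeriv (y u) (D u) D' ρ (n u) n' i) u := by
  have h := fun i => (hn i).fun_div hD hD0
  fin_cases i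
  · refine (hy.fun_mul (h 0)).congr_deriv ?_
    change _ = frameDeriv (y u) (D u) D' ρ (n u) n' 0
    rw [frameDeriv_zero]; ring
  · refine (hy.fun_mul (h 1)).congr_deriv ?_
    change _ = frameDeriv (y u) (D u) D' ρ (n u) n' 1
    rw [frameDeriv_one]; ring
  · exact h 2

lemma metricInner_frameVec {p : Fin 3 → ℝ} (hp : 0 < p 1) (D K : ℝ) (m n : Fin 3 → ℝ) :
    metricInner hypProdMetric p (frameVec (p 1) D m) (frameVec (p 1) K n)
      = (m 0 * n 0 + m 1 * n 1 + m 2 * n 2) / (D * K) := by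
  rw [metricInner_hypProdMetric]
  simp only [frameVec_zero, frameVec_one, frameVec_two]
  field_simp

/-- The connection in terms of frame components. As `mb` is orthogonal to the normal, the derivative
`D'` of the common denominator drops out. -/
lemma hypConnection_frame {p : Fin 3 → ℝ} (hp : 0 < p 1) {D K D' : ℝ} (hD : D ≠ 0) (hK : K ≠ 0)
    {ma mb mb' ν : Fin 3 → ℝ} (horth : mb 0 * ν 0 + mb 1 * ν 1 + mb 2 * ν 2 = 0) :
    hypConnection p (frameDeriv (p 1) D D' (ma 1 / D) mb mb') (frameVec (p 1) D ma)
        (frameVec (p 1) D mb) (frameVec (p 1) K ν)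
      = (D * (mb' 0 * ν 0 + mb' 1 * ν 1 + mb' 2 * ν 2)
          + ma 0 * (mb 0 * ν 1 - mb 1 * ν 0)) / (D ^ 2 * K) := by
  simp only [hypConnection, frameVec_zero, frameVec_one, frameVec_two, frameDeriv_zero,
    frameDeriv_one, frameDeriv_two]
  field_simp
  linear_combination (-D') * horth

end

/-! ### Partial derivatives of the catenoid -/

section

variable (α : ℝ) (φ : ℝ → ℝ)

/-- With `a = √(α² + 1)`, `C = cosh (α v)` and `S = sinh (α v)`, the function
`M = (1 + α d) C + a d S`; the ordinate of the catenoid is `a d e^{a v} / M`. -/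
def catM (z : ℂ) : ℝ := (1 + α * profileDenom α φ z.re) * Real.cosh (α * z.im)
  + √(α ^ 2 + 1) * profileDenom α φ z.re * Real.sinh (α * z.im)

/-- The companion `P = a d C + (1 + α d) S` of `M`; `(M, P)` is the image of `(C, S)` under a
hyperbolic similarity that depends on `u` only, and `M² - P² = sin² φ`. -/
def catP (z : ℂ) : ℝ := √(α ^ 2 + 1) * profileDenom α φ z.re * Real.cosh (α * z.im)
  + (1 + α * profileDenom α φ z.re) * Real.sinh (α * z.im)

/-- Frame components of `∂ᵤ`, times `d M`. -/
def catU (z : ℂ) : Fin 3 → ℝ :=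
  ![Real.cos (φ z.re) * Real.cosh (α * z.im) * catP α φ z,
    Real.cos (φ z.re) * Real.sin (φ z.re) * Real.cosh (α * z.im),
    -(Real.sin (φ z.re) * Real.cosh (α * z.im) * catM α φ z)]

/-- Frame components of `∂ᵥ`, times `d M`. -/
def catV (z : ℂ) : Fin 3 → ℝ :=
  ![-(Real.sin (φ z.re) * (Real.sinh (α * z.im) * catP α φ z + 1)),
    catP α φ z - Real.sin (φ z.re) ^ 2 * Real.sinh (α * z.im),
    -(Real.cos (φ z.re) * Real.sinh (α * z.im) * catM α φ z)]

/-- Frame components of the unit normal, times `C M`. -/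
def catN (z : ℂ) : Fin 3 → ℝ :=
  ![Real.sin (φ z.re) * (catP α φ z - Real.sinh (α * z.im)),
    Real.sinh (α * z.im) * catP α φ z + Real.sin (φ z.re) ^ 2,
    Real.cos (φ z.re) * catM α φ z]

/-- The derivative `∂ᵤ` of the catenoid. -/
def catenoidU (z : ℂ) : Fin 3 → ℝ :=
  frameVec (catenoidParam α φ z 1) (profileDenom α φ z.re * catM α φ z) (catU α φ z)

/-- The derivative `∂ᵥ` of the catenoid. -/
def catenoidV (z : ℂ) : Fin 3 → ℝ :=
  frameVec (catenoidParam α φ z 1) (profileDenom α φ z.re * catM α φ z) (catV α φ z)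

/-- The unit normal of the catenoid. -/
def catenoidNormal (z : ℂ) : Fin 3 → ℝ :=
  frameVec (catenoidParam α φ z 1) (Real.cosh (α * z.im) * catM α φ z) (catN α φ z)

variable {α φ}

lemma catM_sq (z : ℂ) : catM α φ z ^ 2 = catP α φ z ^ 2 + Real.sin (φ z.re) ^ 2 := by
  have h1 := Real.cosh_sq (α * z.im)
  have h2 := Real.sin_sq_add_cos_sq (φ z.re)
  have h3 := profileDenom_sq (α := α) φ z.re
  have h4 := sq_sqrt_sq_add_one α
  simp only [catM, catP]
  set a := √(α ^ 2 + 1)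
  set d := profileDenom α φ z.re
  linear_combination ((1 + α * d) ^ 2 - a ^ 2 * d ^ 2) * h1 - d ^ 2 * h4 - h3 - h2

lemma cosh_mul_catP_sub (z : ℂ) : Real.cosh (α * z.im) * catP α φ z
    - Real.sinh (α * z.im) * catM α φ z = √(α ^ 2 + 1) * profileDenom α φ z.re := by
  have h1 := Real.cosh_sq (α * z.im)
  simp only [catM, catP]
  linear_combination (√(α ^ 2 + 1) * profileDenom α φ z.re) * h1

lemma cosh_mul_catM_sub (z : ℂ) : Real.cosh (α * z.im) * catM α φ z
    - Real.sinh (α * z.im) * catP α φ z = 1 + α * profileDenom α φ z.re := by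
  have h1 := Real.cosh_sq (α * z.im)
  simp only [catM, catP]
  linear_combination (1 + α * profileDenom α φ z.re) * h1

lemma catM_pos (hα : 0 < α) (φ : ℝ → ℝ) (z : ℂ) : 0 < catM α φ z := by
  have hd := profileDenom_pos hα φ z.re
  have h2 := Real.sin_sq_add_cos_sq (φ z.re)
  have h3 := profileDenom_sq (α := α) φ z.re
  have h4 := sq_sqrt_sq_add_one α
  have ha : 0 < √(α ^ 2 + 1) := by positivity
  have hle : √(α ^ 2 + 1) * profileDenom α φ z.re ≤ 1 + α * profileDenom α φ z.re := by
    apply le_of_sq_le_sq _ (by positivity)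
    nlinarith [sq_nonneg (Real.sin (φ z.re))]
  have hS : -Real.sinh (α * z.im) < Real.cosh (α * z.im) := by
    have := Real.exp_pos (α * z.im)
    rw [← Real.cosh_add_sinh] at this
    linarith
  have hC := Real.cosh_pos (α * z.im)
  have had : 0 < √(α ^ 2 + 1) * profileDenom α φ z.re := by positivity
  unfold catM
  nlinarith

lemma catenoidParam_one_eq (hα : 0 < α) (φ : ℝ → ℝ) (z : ℂ) : catenoidParam α φ z 1
    = Real.exp (√(α ^ 2 + 1) * z.im) * (√(α ^ 2 + 1) * profileDenom α φ z.re / catM α φ z) := by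
  have hd := (profileDenom_pos hα φ z.re).ne'
  have hM := (catM_pos hα φ z).ne'
  have ha : √(α ^ 2 + 1) ≠ 0 := by positivity
  rw [catenoidParam_one hα, exp_logRadius, sqrt_cosh_sq_add_catenoidSlope_sq hα, div_eq_mul_inv]
  congr 1
  rw [eq_div_iff hM, inv_mul_eq_div, div_eq_iff]
  · rw [catM]; field_simp; ring
  · intro h0
    apply hM
    have : catM α φ z = (√(α ^ 2 + 1) * profileDenom α φ z.re) * (Real.sinh (α * z.im)
      + (1 + α * profileDenom α φ z.re) / (√(α ^ 2 + 1) * profileDenom α φ z.re)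
        * Real.cosh (α * z.im)) := by rw [catM]; field_simp; ring
    rw [this, h0, mul_zero]

lemma catenoidParam_one_pos (hα : 0 < α) (φ : ℝ → ℝ) (z : ℂ) : 0 < catenoidParam α φ z 1 := by
  have hd := profileDenom_pos hα φ z.re
  have hM := catM_pos hα φ z
  rw [catenoidParam_one_eq hα]
  positivity

lemma contDiff_catM (hα : 0 < α) (h : IsProfile α φ) : ContDiff ℝ ∞ (catM α φ) := by
  have hd := h.contDiff_profileDenom_re hα
  exact ((contDiff_const.add (contDiff_const.mul hd)).mul (contDiff_cosh_mul_im α)).add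
    ((contDiff_const.mul hd).mul (contDiff_sinh_mul_im α))

lemma contDiff_catP (hα : 0 < α) (h : IsProfile α φ) : ContDiff ℝ ∞ (catP α φ) := by
  have hd := h.contDiff_profileDenom_re hα
  exact ((contDiff_const.mul hd).mul (contDiff_cosh_mul_im α)).add
    ((contDiff_const.add (contDiff_const.mul hd)).mul (contDiff_sinh_mul_im α))

lemma contDiff_catenoidParam (hα : 0 < α) (h : IsProfile α φ) :
    ContDiff ℝ ∞ (catenoidParam α φ) := by
  have hc := h.contDiff_cos_re hα
  have hs := h.contDiff_sin_re hα
  have hd := h.contDiff_profileDenom_re hα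
  have hC := contDiff_cosh_mul_im α
  have hM := contDiff_catM hα h
  have hd0 : ∀ z : ℂ, profileDenom α φ z.re ≠ 0 := fun z => (profileDenom_pos hα φ _).ne'
  have ha : √(α ^ 2 + 1) ≠ 0 := by positivity
  have h1 : ContDiff ℝ ∞ fun z => catenoidParam α φ z 1 := by
    simp only [catenoidParam_one_eq hα]
    exact (contDiff_const.mul contDiff_im).exp.mul
      ((contDiff_const.mul hd).div hM fun z => (catM_pos hα φ z).ne')
  rw [contDiff_pi]
  intro i
  fin_cases i
  · change ContDiff ℝ ∞ fun z => catenoidParam α φ z 0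
    simp only [catenoidParam_zero]
    refine ContDiff.mul ?_ h1
    exact (hs.mul hC).neg.div (contDiff_const.mul hd) fun z => mul_ne_zero ha (hd0 z)
  · exact h1
  · change ContDiff ℝ ∞ fun z => catenoidParam α φ z 2
    simp only [catenoidParam_two]
    exact (hc.mul hC).neg.div (contDiff_const.mul hd) fun z => mul_ne_zero hα.ne' (hd0 z)

lemma hasDerivAt_catM_left (hα : 0 < α) (h : IsProfile α φ) (z : ℂ) :
    HasDerivAt (fun u : ℝ => catM α φ ⟨u, z.im⟩) (Real.cos (φ z.re) * Real.sin (φ z.re)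
      * (catM α φ z - Real.cosh (α * z.im)) / profileDenom α φ z.re) z.re := by
  have hd := h.hasDerivAt_profileDenom hα z.re
  have hd0 := (profileDenom_pos hα φ z.re).ne'
  simp only [catM]
  refine ((((hd.const_mul α).const_add 1).mul_const (Real.cosh (α * z.im))).fun_add
    ((hd.const_mul √(α ^ 2 + 1)).mul_const (Real.sinh (α * z.im)))).congr_deriv ?_
  field_simp
  ring

lemma hasDerivAt_catP_left (hα : 0 < α) (h : IsProfile α φ) (z : ℂ) :
    HasDerivAt (fun u : ℝ => catP α φ ⟨u, z.im⟩) (Real.cos (φ z.re) * Real.sin (φ z.re)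
      * (catP α φ z - Real.sinh (α * z.im)) / profileDenom α φ z.re) z.re := by
  have hd := h.hasDerivAt_profileDenom hα z.re
  have hd0 := (profileDenom_pos hα φ z.re).ne'
  simp only [catP]
  refine (((hd.const_mul √(α ^ 2 + 1)).mul_const (Real.cosh (α * z.im))).fun_add
    (((hd.const_mul α).const_add 1).mul_const (Real.sinh (α * z.im)))).congr_deriv ?_
  field_simp
  ring

lemma hasDerivAt_catM_right (z : ℂ) :
    HasDerivAt (fun v : ℝ => catM α φ ⟨z.re, v⟩) (α * catP α φ z) z.im := by
  simp only [catM, catP]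
  refine (((hasDerivAt_cosh_mul α z.im).const_mul _).fun_add
    ((hasDerivAt_sinh_mul α z.im).const_mul _)).congr_deriv ?_
  ring

lemma hasDerivAt_catP_right (z : ℂ) :
    HasDerivAt (fun v : ℝ => catP α φ ⟨z.re, v⟩) (α * catM α φ z) z.im := by
  simp only [catM, catP]
  refine (((hasDerivAt_cosh_mul α z.im).const_mul _).fun_add
    ((hasDerivAt_sinh_mul α z.im).const_mul _)).congr_deriv ?_
  ring

lemma hasDerivAt_ordinate_left (hα : 0 < α) (h : IsProfile α φ) (z : ℂ) :
    HasDerivAt (fun u : ℝ => catenoidParam α φ ⟨u, z.im⟩ 1) (catenoidParam α φ z 1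
      * (catU α φ z 1 / (profileDenom α φ z.re * catM α φ z))) z.re := by
  have hd := h.hasDerivAt_profileDenom hα z.re
  have hd0 := (profileDenom_pos hα φ z.re).ne'
  have hM := (catM_pos hα φ z).ne'
  simp only [catenoidParam_one_eq hα]
  refine (((hd.const_mul √(α ^ 2 + 1)).fun_div (hasDerivAt_catM_left hα h z) hM).const_mul
    _).congr_deriv ?_
  simp only [catU, Matrix.cons_val_one, Matrix.cons_val_zero, Complex.eta]
  field_simp
  ring

lemma hasDerivAt_ordinate_right (hα : 0 < α) (φ : ℝ → ℝ) (z : ℂ) :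
    HasDerivAt (fun v : ℝ => catenoidParam α φ ⟨z.re, v⟩ 1) (catenoidParam α φ z 1
      * (catV α φ z 1 / (profileDenom α φ z.re * catM α φ z))) z.im := by
  have hd0 := (profileDenom_pos hα φ z.re).ne'
  have hM := (catM_pos hα φ z).ne'
  simp only [catenoidParam_one_eq hα]
  have h1 := ((hasDerivAt_id' z.im).const_mul √(α ^ 2 + 1)).exp.fun_mul
    ((hasDerivAt_const z.im (√(α ^ 2 + 1) * profileDenom α φ z.re)).fun_div
      (hasDerivAt_catM_right z) hM)
  refine h1.congr_deriv ?_
  simp only [catV, Matrix.cons_val_one, Matrix.cons_val_zero, Complex.eta]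
  have e1 := cosh_mul_catM_sub (α := α) (φ := φ) z
  have e2 := cosh_mul_catP_sub (α := α) (φ := φ) z
  have e3 := catM_sq (α := α) (φ := φ) z
  field_simp
  linear_combination √(α ^ 2 + 1) * ((-catM α φ z) * e2 + catP α φ z * e1
    - Real.sinh (α * z.im) * e3)

end

section

variable {α : ℝ} {φ : ℝ → ℝ}

lemma catenoidSlope_eq_div (hα : 0 < α) (φ : ℝ → ℝ) (z : ℂ) : catenoidSlope α φ z
    = -(Real.sin (φ z.re) / profileDenom α φ z.re) * (Real.cosh (α * z.im) / √(α ^ 2 + 1)) := by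
  have hd := (profileDenom_pos hα φ z.re).ne'
  have ha : √(α ^ 2 + 1) ≠ 0 := by positivity
  rw [catenoidSlope]; field_simp

lemma catenoidHeight_eq_div (hα : 0 < α) (φ : ℝ → ℝ) (z : ℂ) : catenoidHeight α φ z
    = -(Real.cos (φ z.re) / profileDenom α φ z.re) * (Real.cosh (α * z.im) / α) := by
  have hd := (profileDenom_pos hα φ z.re).ne'
  rw [catenoidHeight]; field_simp

lemma hasPartials_catenoidParam (hα : 0 < α) (h : IsProfile α φ) :
    HasPartials (catenoidParam α φ) (catenoidU α φ) (catenoidV α φ) := by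
  have hα0 := hα.ne'
  have ha : √(α ^ 2 + 1) ≠ 0 := by positivity
  refine ⟨contDiff_catenoidParam hα h, fun z i => ?_, fun z i => ?_⟩
  · have hd0 := (profileDenom_pos hα φ z.re).ne'
    have hM := (catM_pos hα φ z).ne'
    have e1 := cosh_mul_catM_sub (α := α) (φ := φ) z
    have e2 := cosh_mul_catP_sub (α := α) (φ := φ) z
    have e3 := catM_sq (α := α) (φ := φ) z
    have hy := hasDerivAt_ordinate_left hα h z
    fin_cases i
    · change HasDerivAt (fun u : ℝ => catenoidParam α φ ⟨u, z.im⟩ 0) _ _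
      simp only [catenoidParam_zero, catenoidSlope_eq_div hα]
      refine (((h.hasDerivAt_sin_div hα z.re).fun_neg.mul_const _).fun_mul hy).congr_deriv ?_
      change _ = catenoidU α φ z 0
      simp only [catenoidU, frameVec_zero, catU, Matrix.cons_val_one, Matrix.cons_val_zero,
        Complex.eta]
      rw [← e1]
      field_simp
      linear_combination Real.cos (φ z.re) * catenoidParam α φ z 1
        * (catP α φ z * e2 + Real.cosh (α * z.im) * e3)
    · exact hy
    · change HasDerivAt (fun u : ℝ => catenoidParam α φ ⟨u, z.im⟩ 2) _ _
      simp only [catenoidParam_two, catenoidHeight_eq_div hα]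
      refine ((h.hasDerivAt_cos_div hα z.re).fun_neg.mul_const _).congr_deriv ?_
      change _ = catenoidU α φ z 2
      simp only [catenoidU, frameVec_two, catU, Matrix.cons_val]
      field_simp
  · have hd0 := (profileDenom_pos hα φ z.re).ne'
    have hM := (catM_pos hα φ z).ne'
    have e1 := cosh_mul_catM_sub (α := α) (φ := φ) z
    have e2 := cosh_mul_catP_sub (α := α) (φ := φ) z
    have e3 := catM_sq (α := α) (φ := φ) z
    have e4 := Real.cosh_sq (α * z.im)
    have hy := hasDerivAt_ordinate_right hα φ z
    fin_cases i
    · change HasDerivAt (fun v : ℝ => catenoidParam α φ ⟨z.re, v⟩ 0) _ _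
      simp only [catenoidParam_zero, catenoidSlope_eq_div hα]
      refine ((((hasDerivAt_cosh_mul α z.im).div_const _).const_mul _).fun_mul hy).congr_deriv ?_
      change _ = catenoidV α φ z 0
      simp only [catenoidV, frameVec_zero, catV, Matrix.cons_val_one, Matrix.cons_val_zero,
        Complex.eta]
      field_simp
      linear_combination (-Real.sin (φ z.re)) * catenoidParam α φ z 1
        * (Real.cosh (α * z.im) * Real.sinh (α * z.im) * e3 - Real.sinh (α * z.im) * catM α φ z * e1
          + (Real.sinh (α * z.im) * catP α φ z + 1) * e2)
    · exact hy
    · change HasDerivAt (fun v : ℝ => catenoidParam α φ ⟨z.re, v⟩ 2) _ _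
      simp only [catenoidParam_two, catenoidHeight_eq_div hα]
      refine (((hasDerivAt_cosh_mul α z.im).div_const _).const_mul _).congr_deriv ?_
      change _ = catenoidV α φ z 2
      simp only [catenoidV, frameVec_two, catV, Matrix.cons_val]
      field_simp

/-- The derivative in `u` of `catU`; the letter `r` stands for `d (d - α) = -d φ'`. -/
def catUu (α : ℝ) (φ : ℝ → ℝ) (z : ℂ) : Fin 3 → ℝ :=
  let c := Real.cos (φ z.re)
  let s := Real.sin (φ z.re)
  let C := Real.cosh (α * z.im)
  let S := Real.sinh (α * z.im)
  let M := catM α φ z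
  let P := catP α φ z
  let d := profileDenom α φ z.re
  let r := C * M - S * P - 1 + c ^ 2
  ![(s * r * C * P + c ^ 2 * s * C * (P - S)) / d, C * r * (s ^ 2 - c ^ 2) / d,
    (c * r * C * M - s ^ 2 * c * C * (M - C)) / d]

/-- The derivative in `v` of `catU`. -/
def catUv (α : ℝ) (φ : ℝ → ℝ) (z : ℂ) : Fin 3 → ℝ :=
  let c := Real.cos (φ z.re)
  let s := Real.sin (φ z.re)
  let C := Real.cosh (α * z.im)
  let S := Real.sinh (α * z.im)
  let M := catM α φ z
  let P := catP α φ z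
  ![c * α * S * P + c * C * α * M, c * s * α * S, -(s * α * S * M) - s * C * α * P]

/-- The derivative in `u` of `catV`; the letter `r` stands for `d (d - α) = -d φ'`. -/
def catVu (α : ℝ) (φ : ℝ → ℝ) (z : ℂ) : Fin 3 → ℝ :=
  let c := Real.cos (φ z.re)
  let s := Real.sin (φ z.re)
  let C := Real.cosh (α * z.im)
  let S := Real.sinh (α * z.im)
  let M := catM α φ z
  let P := catP α φ z
  let d := profileDenom α φ z.re
  let r := C * M - S * P - 1 + c ^ 2
  ![(c * r * (S * P + 1) - s ^ 2 * c * S * (P - S)) / d,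
    (c * s * (P - S) + 2 * s * c * r * S) / d, (-(s * r * S * M) - c ^ 2 * s * S * (M - C)) / d]

/-- The derivative in `v` of `catV`. -/
def catVv (α : ℝ) (φ : ℝ → ℝ) (z : ℂ) : Fin 3 → ℝ :=
  let c := Real.cos (φ z.re)
  let s := Real.sin (φ z.re)
  let C := Real.cosh (α * z.im)
  let S := Real.sinh (α * z.im)
  let M := catM α φ z
  let P := catP α φ z
  ![-(s * α * (C * P + S * M)), α * M - s ^ 2 * α * C, -(c * α * C * M) - c * α * S * P]

lemma profileDenom_mul_sub (z : ℂ) :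
    profileDenom α φ z.re * (profileDenom α φ z.re - α) = Real.cosh (α * z.im) * catM α φ z
      - Real.sinh (α * z.im) * catP α φ z - 1 + Real.cos (φ z.re) ^ 2 := by
  have h3 := profileDenom_sq (α := α) φ z.re
  rw [cosh_mul_catM_sub]
  linear_combination h3

lemma hasDerivAt_catU_left (hα : 0 < α) (h : IsProfile α φ) (z : ℂ) (i : Fin 3) :
    HasDerivAt (fun u : ℝ => catU α φ ⟨u, z.im⟩ i) (catUu α φ z i) z.re := by
  have hd0 := (profileDenom_pos hα φ z.re).ne'
  have hr := profileDenom_mul_sub (α := α) (φ := φ) z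
  have hc := h.hasDerivAt_cos z.re
  have hs := h.hasDerivAt_sin z.re
  have hM := hasDerivAt_catM_left hα h z
  have hP := hasDerivAt_catP_left hα h z
  fin_cases i
  · refine ((hc.mul_const (Real.cosh (α * z.im))).fun_mul hP).congr_deriv ?_
    change _ = (Real.sin (φ z.re) * _ * _ * _ + _) / _
    rw [← hr]
    simp only [Complex.eta]
    field_simp
  · refine ((hc.fun_mul hs).mul_const (Real.cosh (α * z.im))).congr_deriv ?_
    change _ = Real.cosh (α * z.im) * _ * _ / _
    rw [← hr]
    field_simp
    ring
  · refine ((hs.mul_const (Real.cosh (α * z.im))).fun_mul hM).fun_neg.congr_deriv ?_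
    change _ = (Real.cos (φ z.re) * _ * _ * _ - _) / _
    rw [← hr]
    simp only [Complex.eta]
    field_simp
    ring

lemma hasDerivAt_catU_right (z : ℂ) (i : Fin 3) :
    HasDerivAt (fun v : ℝ => catU α φ ⟨z.re, v⟩ i) (catUv α φ z i) z.im := by
  have hM := hasDerivAt_catM_right (α := α) (φ := φ) z
  have hP := hasDerivAt_catP_right (α := α) (φ := φ) z
  have hC := hasDerivAt_cosh_mul α z.im
  fin_cases i
  · refine ((hC.const_mul (Real.cos (φ z.re))).fun_mul hP).congr_deriv ?_
    change _ = Real.cos (φ z.re) * _ * _ * _ + _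
    simp only [Complex.eta]
    ring
  · refine (hC.const_mul (Real.cos (φ z.re) * Real.sin (φ z.re))).congr_deriv ?_
    change _ = Real.cos (φ z.re) * Real.sin (φ z.re) * _ * _
    ring
  · refine ((hC.const_mul (Real.sin (φ z.re))).fun_mul hM).fun_neg.congr_deriv ?_
    change _ = -(Real.sin (φ z.re) * _ * _ * _) - _
    simp only [Complex.eta]
    ring

lemma hasDerivAt_catV_left (hα : 0 < α) (h : IsProfile α φ) (z : ℂ) (i : Fin 3) :
    HasDerivAt (fun u : ℝ => catV α φ ⟨u, z.im⟩ i) (catVu α φ z i) z.re := by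
  have hd0 := (profileDenom_pos hα φ z.re).ne'
  have hr := profileDenom_mul_sub (α := α) (φ := φ) z
  have hc := h.hasDerivAt_cos z.re
  have hs := h.hasDerivAt_sin z.re
  have hM := hasDerivAt_catM_left hα h z
  have hP := hasDerivAt_catP_left hα h z
  fin_cases i
  · refine (hs.fun_mul ((hP.const_mul (Real.sinh (α * z.im))).add_const 1)).fun_neg.congr_deriv ?_
    change _ = (Real.cos (φ z.re) * _ * _ - _) / _
    rw [← hr]
    simp only [Complex.eta]
    field_simp
    ring
  · refine (hP.fun_sub ((hs.fun_pow 2).mul_const (Real.sinh (α * z.im)))).congr_deriv ?_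
    change _ = (Real.cos (φ z.re) * _ * _ + 2 * _ * _ * _ * _) / _
    rw [← hr]
    push_cast
    field_simp
    ring
  · refine ((hc.mul_const (Real.sinh (α * z.im))).fun_mul hM).fun_neg.congr_deriv ?_
    change _ = (-(Real.sin (φ z.re) * _ * _ * _) - _) / _
    rw [← hr]
    simp only [Complex.eta]
    field_simp
    ring

lemma hasDerivAt_catV_right (z : ℂ) (i : Fin 3) :
    HasDerivAt (fun v : ℝ => catV α φ ⟨z.re, v⟩ i) (catVv α φ z i) z.im := by
  have hM := hasDerivAt_catM_right (α := α) (φ := φ) z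
  have hP := hasDerivAt_catP_right (α := α) (φ := φ) z
  have hS := hasDerivAt_sinh_mul α z.im
  fin_cases i
  · refine (((hS.fun_mul hP).add_const 1).const_mul (Real.sin (φ z.re))).fun_neg.congr_deriv ?_
    change _ = -(Real.sin (φ z.re) * _ * _)
    simp only [Complex.eta]
    ring
  · refine (hP.fun_sub (hS.const_mul (Real.sin (φ z.re) ^ 2))).congr_deriv ?_
    change _ = α * _ - _
    ring
  · refine ((hS.const_mul (Real.cos (φ z.re))).fun_mul hM).fun_neg.congr_deriv ?_
    change _ = -(Real.cos (φ z.re) * _ * _ * _) - _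
    simp only [Complex.eta]
    ring

/-- The common denominator `d M` of the frame components. -/
def catD (α : ℝ) (φ : ℝ → ℝ) (z : ℂ) : ℝ := profileDenom α φ z.re * catM α φ z

/-- The derivative in `u` of `catD`. -/
def catDu (α : ℝ) (φ : ℝ → ℝ) (z : ℂ) : ℝ :=
  Real.cos (φ z.re) * Real.sin (φ z.re) * (2 * catM α φ z - Real.cosh (α * z.im))

/-- The derivative in `v` of `catD`. -/
def catDv (α : ℝ) (φ : ℝ → ℝ) (z : ℂ) : ℝ := profileDenom α φ z.re * (α * catP α φ z)

lemma catD_pos (hα : 0 < α) (φ : ℝ → ℝ) (z : ℂ) : 0 < catD α φ z :=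
  mul_pos (profileDenom_pos hα φ _) (catM_pos hα φ z)

lemma hasDerivAt_catD_left (hα : 0 < α) (h : IsProfile α φ) (z : ℂ) :
    HasDerivAt (fun u : ℝ => catD α φ ⟨u, z.im⟩) (catDu α φ z) z.re := by
  have hd0 := (profileDenom_pos hα φ z.re).ne'
  refine ((h.hasDerivAt_profileDenom hα z.re).fun_mul (hasDerivAt_catM_left hα h z)).congr_deriv ?_
  simp only [catDu, Complex.eta]
  field_simp
  ring

lemma hasDerivAt_catD_right (z : ℂ) :
    HasDerivAt (fun v : ℝ => catD α φ ⟨z.re, v⟩) (catDv α φ z) z.im :=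
  (hasDerivAt_catM_right z).const_mul (profileDenom α φ z.re)

lemma hasPartials_catenoidU (hα : 0 < α) (h : IsProfile α φ) :
    HasPartials (catenoidU α φ)
      (fun z => frameDeriv (catenoidParam α φ z 1) (catD α φ z) (catDu α φ z)
        (catU α φ z 1 / catD α φ z) (catU α φ z) (catUu α φ z))
      (fun z => frameDeriv (catenoidParam α φ z 1) (catD α φ z) (catDv α φ z)
        (catV α φ z 1 / catD α φ z) (catU α φ z) (catUv α φ z)) :=
  ⟨(hasPartials_catenoidParam hα h).contDiff_fst,
    fun z => hasDerivAt_frameVec (hasDerivAt_ordinate_left hα h z) (hasDerivAt_catD_left hα h z)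
      (catD_pos hα φ z).ne' (hasDerivAt_catU_left hα h z),
    fun z => hasDerivAt_frameVec (hasDerivAt_ordinate_right hα φ z) (hasDerivAt_catD_right z)
      (catD_pos hα φ z).ne' (hasDerivAt_catU_right z)⟩

lemma hasPartials_catenoidV (hα : 0 < α) (h : IsProfile α φ) :
    HasPartials (catenoidV α φ)
      (fun z => frameDeriv (catenoidParam α φ z 1) (catD α φ z) (catDu α φ z)
        (catU α φ z 1 / catD α φ z) (catV α φ z) (catVu α φ z))
      (fun z => frameDeriv (catenoidParam α φ z 1) (catD α φ z) (catDv α φ z)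
        (catV α φ z 1 / catD α φ z) (catV α φ z) (catVv α φ z)) :=
  ⟨(hasPartials_catenoidParam hα h).contDiff_snd,
    fun z => hasDerivAt_frameVec (hasDerivAt_ordinate_left hα h z) (hasDerivAt_catD_left hα h z)
      (catD_pos hα φ z).ne' (hasDerivAt_catV_left hα h z),
    fun z => hasDerivAt_frameVec (hasDerivAt_ordinate_right hα φ z) (hasDerivAt_catD_right z)
      (catD_pos hα φ z).ne' (hasDerivAt_catV_right z)⟩

end

/-! ### Geometry of the catenoid and the sister relation -/

section

variable {α : ℝ} {φ : ℝ → ℝ}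

lemma catP_sq (z : ℂ) : catP α φ z ^ 2 = catM α φ z ^ 2 - Real.sin (φ z.re) ^ 2 := by
  rw [catM_sq]; ring

lemma catU_zero (z : ℂ) : catU α φ z 0
    = Real.cos (φ z.re) * Real.cosh (α * z.im) * catP α φ z := rfl
lemma catU_one (z : ℂ) : catU α φ z 1
    = Real.cos (φ z.re) * Real.sin (φ z.re) * Real.cosh (α * z.im) := rfl
lemma catU_two (z : ℂ) : catU α φ z 2
    = -(Real.sin (φ z.re) * Real.cosh (α * z.im) * catM α φ z) := rfl
lemma catV_zero (z : ℂ) : catV α φ z 0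
    = -(Real.sin (φ z.re) * (Real.sinh (α * z.im) * catP α φ z + 1)) := rfl
lemma catV_one (z : ℂ) : catV α φ z 1
    = catP α φ z - Real.sin (φ z.re) ^ 2 * Real.sinh (α * z.im) := rfl
lemma catV_two (z : ℂ) : catV α φ z 2
    = -(Real.cos (φ z.re) * Real.sinh (α * z.im) * catM α φ z) := rfl
lemma catN_zero (z : ℂ) : catN α φ z 0
    = Real.sin (φ z.re) * (catP α φ z - Real.sinh (α * z.im)) := rfl
lemma catN_one (z : ℂ) : catN α φ z 1
    = Real.sinh (α * z.im) * catP α φ z + Real.sin (φ z.re) ^ 2 := rfl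
lemma catN_two (z : ℂ) : catN α φ z 2 = Real.cos (φ z.re) * catM α φ z := rfl

lemma catU_orthogonal (z : ℂ) : catU α φ z 0 * catN α φ z 0 + catU α φ z 1 * catN α φ z 1
    + catU α φ z 2 * catN α φ z 2 = 0 := by
  simp only [catU_zero, catU_one, catU_two, catN_zero, catN_one, catN_two]
  linear_combination (Real.cos (φ z.re) * Real.sin (φ z.re) * Real.cosh (α * z.im)) *
    catP_sq (α := α) (φ := φ) z

lemma catV_orthogonal (z : ℂ) : catV α φ z 0 * catN α φ z 0 + catV α φ z 1 * catN α φ z 1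
    + catV α φ z 2 * catN α φ z 2 = 0 := by
  have hc := Real.cos_sq' (φ z.re)
  simp only [catV_zero, catV_one, catV_two, catN_zero, catN_one, catN_two]
  linear_combination (-Real.sin (φ z.re) ^ 2 * Real.sinh (α * z.im) + Real.sinh (α * z.im)) *
    catP_sq (α := α) (φ := φ) z + (-Real.sinh (α * z.im) * catM α φ z ^ 2) * hc

lemma catU_catV_orthogonal (z : ℂ) : catU α φ z 0 * catV α φ z 0 + catU α φ z 1 * catV α φ z 1
    + catU α φ z 2 * catV α φ z 2 = 0 := by
  simp only [catU_zero, catU_one, catU_two, catV_zero, catV_one, catV_two]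
  linear_combination (-Real.cos (φ z.re) * Real.sin (φ z.re) * Real.cosh (α * z.im)
    * Real.sinh (α * z.im)) * catP_sq (α := α) (φ := φ) z

lemma catU_normSq (z : ℂ) : catU α φ z 0 * catU α φ z 0 + catU α φ z 1 * catU α φ z 1
    + catU α φ z 2 * catU α φ z 2 = (Real.cosh (α * z.im) * catM α φ z) ^ 2 := by
  have hc := Real.cos_sq' (φ z.re)
  simp only [catU_zero, catU_one, catU_two]
  linear_combination (Real.cos (φ z.re) ^ 2 * Real.cosh (α * z.im) ^ 2)
    * catP_sq (α := α) (φ := φ) z + (Real.cosh (α * z.im) ^ 2 * catM α φ z ^ 2) * hc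

lemma catV_normSq (z : ℂ) : catV α φ z 0 * catV α φ z 0 + catV α φ z 1 * catV α φ z 1
    + catV α φ z 2 * catV α φ z 2 = (Real.cosh (α * z.im) * catM α φ z) ^ 2 := by
  have hc := Real.cos_sq' (φ z.re)
  have hC := Real.sinh_sq (α * z.im)
  simp only [catV_zero, catV_one, catV_two]
  linear_combination (Real.sin (φ z.re) ^ 2 * Real.sinh (α * z.im) ^ 2 + 1)
    * catP_sq (α := α) (φ := φ) z + (Real.sinh (α * z.im) ^ 2 * catM α φ z ^ 2) * hc
    + catM α φ z ^ 2 * hC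

lemma catN_normSq (z : ℂ) : catN α φ z 0 * catN α φ z 0 + catN α φ z 1 * catN α φ z 1
    + catN α φ z 2 * catN α φ z 2 = (Real.cosh (α * z.im) * catM α φ z) ^ 2 := by
  have hc := Real.cos_sq' (φ z.re)
  have hC := Real.sinh_sq (α * z.im)
  simp only [catN_zero, catN_one, catN_two]
  linear_combination (Real.sin (φ z.re) ^ 2 + Real.sinh (α * z.im) ^ 2)
    * catP_sq (α := α) (φ := φ) z + catM α φ z ^ 2 * hc + catM α φ z ^ 2 * hC

lemma metricInner_add_right (g : (Fin 3 → ℝ) → Matrix (Fin 3) (Fin 3) ℝ) (p a b n : Fin 3 → ℝ) :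
    metricInner g p n (a + b) = metricInner g p n a + metricInner g p n b := by
  rw [metricInner, Matrix.mulVec_add, dotProduct_add]; rfl

lemma metricInner_smul_right (g : (Fin 3 → ℝ) → Matrix (Fin 3) (Fin 3) ℝ) (p a n : Fin 3 → ℝ)
    (r : ℝ) : metricInner g p n (r • a) = r * metricInner g p n a := by
  rw [metricInner, Matrix.mulVec_smul, dotProduct_smul]; rfl

lemma firstForm_catenoidParam (hα : 0 < α) (h : IsProfile α φ) (z a b : ℂ) :
    firstForm hypProdMetric (catenoidParam α φ) z a b
      = (Real.cosh (α * z.im) / profileDenom α φ z.re) ^ 2 * (a.re * b.re + a.im * b.im) := by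
  have hX := hasPartials_catenoidParam hα h
  have hy := catenoidParam_one_pos hα φ z
  have hd := (profileDenom_pos hα φ z.re).ne'
  have hM := (catM_pos hα φ z).ne'
  have h1 := catU_catV_orthogonal (α := α) (φ := φ) z
  have h2 : catV α φ z 0 * catU α φ z 0 + catV α φ z 1 * catU α φ z 1
    + catV α φ z 2 * catU α φ z 2 = 0 := by linear_combination h1
  rw [firstForm, hX.fderiv_apply, hX.fderiv_apply]
  simp only [metricInner_add_left, metricInner_smul_left, metricInner_add_right,
    metricInner_smul_right, catenoidU, catenoidV, metricInner_frameVec hy, h1, h2, catU_normSq,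
    catV_normSq]
  field_simp
  ring

lemma isUnitNormalAt_catenoidNormal (hα : 0 < α) (h : IsProfile α φ) (z : ℂ) :
    IsUnitNormalAt hypProdMetric (catenoidParam α φ) (catenoidNormal α φ z) z := by
  have hX := hasPartials_catenoidParam hα h
  have hy := catenoidParam_one_pos hα φ z
  have hM := (catM_pos hα φ z).ne'
  have hC := (Real.cosh_pos (α * z.im)).ne'
  constructor
  · rw [catenoidNormal, metricInner_frameVec hy, catN_normSq]
    field_simp
  · intro a
    rw [hX.fderiv_apply]
    simp only [metricInner_add_left, metricInner_smul_left, catenoidU, catenoidV, catenoidNormal,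
      metricInner_frameVec hy, catU_orthogonal, catV_orthogonal]
    simp

end

section

/-! The four components of the second fundamental form, as identities between `c = cos φ`,
`s = sin φ`, `C = cosh (α v)`, `S = sinh (α v)`, `M = catM`, `P = catP` and `d = profileDenom`. The
parameter `α` is eliminated through `C M - S P = 1 + α d`. -/

variable {c s C S M P d α : ℝ}

lemma catenoid_second_uu (hd : d ≠ 0) (hM0 : M ≠ 0) (hC0 : C ≠ 0) (hw : C * M - S * P = 1 + α * d)
    (hM : P ^ 2 = M ^ 2 - s ^ 2) (hc : c ^ 2 = 1 - s ^ 2) (hC : S ^ 2 = C ^ 2 - 1) :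
    (d * M * ((s * (C * M - S * P - 1 + c ^ 2) * C * P + c ^ 2 * s * C * (P - S)) / d
          * (s * (P - S))
        + C * (C * M - S * P - 1 + c ^ 2) * (s ^ 2 - c ^ 2) / d * (S * P + s ^ 2)
        + (c * (C * M - S * P - 1 + c ^ 2) * C * M - s ^ 2 * c * C * (M - C)) / d * (c * M))
      + c * C * P * (c * C * P * (S * P + s ^ 2) - c * s * C * (s * (P - S))))
      / ((d * M) ^ 2 * (C * M)) = α / d + c ^ 2 * C ^ 2 / d ^ 2 := by
  have hα : α = (C * M - S * P - 1) / d := by field_simp; linarith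
  rw [hα]
  field_simp
  linear_combination (2 * c ^ 2 * s ^ 2 * M + c ^ 2 * C * S * P + c ^ 2 * S ^ 2 * M
      + s ^ 2 * C * M ^ 2 - s ^ 2 * S * M * P - s ^ 2 * M) * hM
    + (-c ^ 2 * s ^ 2 * M - c ^ 2 * S * M * P + c ^ 2 * M ^ 3 - C ^ 2 * M ^ 3
      + C * M ^ 4 + S ^ 2 * M ^ 3 - S * M ^ 3 * P) * hc
    + (-s ^ 2 * M ^ 3 + M ^ 3) * hC

lemma catenoid_second_uv (hd : d ≠ 0) (hM0 : M ≠ 0) (hC0 : C ≠ 0)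
    (hM : P ^ 2 = M ^ 2 - s ^ 2) (hc : c ^ 2 = 1 - s ^ 2) (hC : S ^ 2 = C ^ 2 - 1) :
    (d * M * ((c * (C * M - S * P - 1 + c ^ 2) * (S * P + 1) - s ^ 2 * c * S * (P - S)) / d
          * (s * (P - S))
        + (c * s * (P - S) + 2 * s * c * (C * M - S * P - 1 + c ^ 2) * S) / d * (S * P + s ^ 2)
        + (-(s * (C * M - S * P - 1 + c ^ 2) * S * M) - c ^ 2 * s * S * (M - C)) / d * (c * M))
      + c * C * P * (-(s * (S * P + 1)) * (S * P + s ^ 2) - (P - s ^ 2 * S) * (s * (P - S))))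
      / ((d * M) ^ 2 * (C * M)) = -(c * s * S * C / d ^ 2) := by
  field_simp
  linear_combination (c ^ 3 * s * S * M - c * s ^ 3 * S * M - c * s * C * S ^ 2 * P
      + c * s * C * S * M ^ 2 - c * s * C * P - c * s * S ^ 3 * M - c * s * S ^ 2 * M * P
      - c * s * S * M) * hM
    + (c * s ^ 3 * S * M + c * s * C * S * M ^ 2 + c * s * S ^ 2 * M * P - c * s * S * M ^ 3
      - c * s * S * M + c * s * M * P) * hc + (-c * s * S * M ^ 3) * hC

lemma catenoid_second_vu (hd : d ≠ 0) (hM0 : M ≠ 0) (hC0 : C ≠ 0) (hw : C * M - S * P = 1 + α * d)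
    (hM : P ^ 2 = M ^ 2 - s ^ 2) :
    (d * M * ((c * α * S * P + c * C * α * M) * (s * (P - S)) + c * s * α * S * (S * P + s ^ 2)
        + (-(s * α * S * M) - s * C * α * P) * (c * M))
      + -(s * (S * P + 1)) * (c * C * P * (S * P + s ^ 2) - c * s * C * (s * (P - S))))
      / ((d * M) ^ 2 * (C * M)) = -(c * s * S * C / d ^ 2) := by
  have hα : α = (C * M - S * P - 1) / d := by field_simp; linarith
  rw [hα]
  field_simp
  linear_combination (-c * s * C * S ^ 2 * P + c * s * C * S * M ^ 2 - c * s * C * S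
    - c * s * S ^ 2 * M * P - c * s * S * M) * hM

lemma catenoid_second_vv (hd : d ≠ 0) (hM0 : M ≠ 0) (hC0 : C ≠ 0) (hw : C * M - S * P = 1 + α * d)
    (hM : P ^ 2 = M ^ 2 - s ^ 2) (hc : c ^ 2 = 1 - s ^ 2) (hC : S ^ 2 = C ^ 2 - 1) :
    (d * M * (-(s * α * (C * P + S * M)) * (s * (P - S)) + (α * M - s ^ 2 * α * C) * (S * P + s ^ 2)
        + (-(c * α * C * M) - c * α * S * P) * (c * M))
      + -(s * (S * P + 1)) * (-(s * (S * P + 1)) * (S * P + s ^ 2)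
        - (P - s ^ 2 * S) * (s * (P - S))))
      / ((d * M) ^ 2 * (C * M)) = -(α / d) + s ^ 2 * C ^ 2 / d ^ 2 := by
  have hα : α = (C * M - S * P - 1) / d := by field_simp; linarith
  rw [hα]
  field_simp
  linear_combination (c ^ 2 * S ^ 2 * M ^ 2 - s ^ 2 * C ^ 2 * M ^ 2 + s ^ 2 * C * S * M * P
      + s ^ 2 * C * M + s ^ 2 * S ^ 3 * P + s ^ 2 * S ^ 2 * M ^ 2 + s ^ 2 * S ^ 2 + s ^ 2 * S * P
      + s ^ 2 - S ^ 2 * M ^ 2) * hM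
    + (-s ^ 2 * S ^ 2 * M ^ 2 - C ^ 2 * M ^ 4 + C * M ^ 3 + S ^ 2 * M ^ 4 + S * M ^ 2 * P) * hc
    + (s ^ 2 * C * M ^ 3) * hC

end

section

variable {α : ℝ} {φ : ℝ → ℝ}

/-- The second fundamental form of the catenoid. -/
lemma secondForm_catenoidParam (hα : 0 < α) (h : IsProfile α φ) (z a b : ℂ) :
    secondForm hypProdMetric (catenoidParam α φ) (catenoidNormal α φ z) z a b
      = a.re * b.re * (α / profileDenom α φ z.re
          + Real.cos (φ z.re) ^ 2 * Real.cosh (α * z.im) ^ 2 / profileDenom α φ z.re ^ 2)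
        + (a.re * b.im + a.im * b.re) * (-(Real.cos (φ z.re) * Real.sin (φ z.re)
          * Real.sinh (α * z.im) * Real.cosh (α * z.im) / profileDenom α φ z.re ^ 2))
        + a.im * b.im * (-(α / profileDenom α φ z.re)
          + Real.sin (φ z.re) ^ 2 * Real.cosh (α * z.im) ^ 2 / profileDenom α φ z.re ^ 2) := by
  have hy := catenoidParam_one_pos hα φ z
  have hd := (profileDenom_pos hα φ z.re).ne'
  have hM0 := (catM_pos hα φ z).ne'
  have hC0 := (Real.cosh_pos (α * z.im)).ne'
  have hD := (catD_pos hα φ z).ne'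
  have hK : Real.cosh (α * z.im) * catM α φ z ≠ 0 := mul_ne_zero hC0 hM0
  have hw := cosh_mul_catM_sub (α := α) (φ := φ) z
  have hM := catP_sq (α := α) (φ := φ) z
  have hc := Real.cos_sq' (φ z.re)
  have hC := Real.sinh_sq (α * z.im)
  rw [secondForm_hypProdMetric hy (hasPartials_catenoidParam hα h) (hasPartials_catenoidU hα h)
    (hasPartials_catenoidV hα h)]
  have euu := hypConnection_frame hy hD hK (D' := catDu α φ z) (ma := catU α φ z)
    (mb' := catUu α φ z) (catU_orthogonal (α := α) (φ := φ) z)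
  have euv := hypConnection_frame hy hD hK (D' := catDu α φ z) (ma := catU α φ z)
    (mb' := catVu α φ z) (catV_orthogonal (α := α) (φ := φ) z)
  have evu := hypConnection_frame hy hD hK (D' := catDv α φ z) (ma := catV α φ z)
    (mb' := catUv α φ z) (catU_orthogonal (α := α) (φ := φ) z)
  have evv := hypConnection_frame hy hD hK (D' := catDv α φ z) (ma := catV α φ z)
    (mb' := catVv α φ z) (catV_orthogonal (α := α) (φ := φ) z)
  have fuu := euu.trans (catenoid_second_uu hd hM0 hC0 hw hM hc hC)
  have fuv := euv.trans (catenoid_second_uv hd hM0 hC0 hM hc hC)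
  have fvu := evu.trans (catenoid_second_vu hd hM0 hC0 hw hM)
  have fvv := evv.trans (catenoid_second_vv hd hM0 hC0 hw hM hc hC)
  have g1 : catenoidU α φ z = frameVec (catenoidParam α φ z 1) (catD α φ z) (catU α φ z) := rfl
  have g2 : catenoidV α φ z = frameVec (catenoidParam α φ z 1) (catD α φ z) (catV α φ z) := rfl
  rw [g1, g2, catenoidNormal, fuu, fuv, fvu, fvv]
  ring

lemma continuous_catenoidNormal (hα : 0 < α) (h : IsProfile α φ) :
    Continuous (catenoidNormal α φ) := by
  have hX := contDiff_catenoidParam hα h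
  have h1 : Continuous fun z => catenoidParam α φ z 1 := (contDiff_pi.1 hX 1).continuous
  have hM := (contDiff_catM hα h).continuous
  have hP := (contDiff_catP hα h).continuous
  have hc := (h.contDiff_cos_re hα).continuous
  have hs := (h.contDiff_sin_re hα).continuous
  have hC := (contDiff_cosh_mul_im α).continuous
  have hS := (contDiff_sinh_mul_im α).continuous
  have hK : ∀ z : ℂ, Real.cosh (α * z.im) * catM α φ z ≠ 0 := fun z =>
    mul_ne_zero (Real.cosh_pos _).ne' (catM_pos hα φ z).ne'
  rw [continuous_pi_iff]
  intro i
  fin_cases i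
  · exact h1.mul ((hs.mul (hP.sub hS)).div (hC.mul hM) hK)
  · exact h1.mul (((hS.mul hP).add (hs.pow 2)).div (hC.mul hM) hK)
  · exact (hc.mul hM).div (hC.mul hM) hK

lemma det_catenoid_pos (hα : 0 < α) (h : IsProfile α φ) (z : ℂ) :
    0 < (Matrix.of ![fderiv ℝ (catenoidParam α φ) z 1, fderiv ℝ (catenoidParam α φ) z Complex.I,
      catenoidNormal α φ z]).det := by
  have hX := hasPartials_catenoidParam hα h
  have hy := catenoidParam_one_pos hα φ z
  have hd := profileDenom_pos hα φ z.re
  have hMp := catM_pos hα φ z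
  have hC := Real.cosh_pos (α * z.im)
  -- the cross product of the first two rows is `C M` times the third
  have hdet : (Matrix.of ![fderiv ℝ (catenoidParam α φ) z 1,
      fderiv ℝ (catenoidParam α φ) z Complex.I, catenoidNormal α φ z]).det
      = (catenoidParam α φ z 1) ^ 2
        * (Real.cosh (α * z.im) / profileDenom α φ z.re) ^ 2 := by
    rw [hX.fderiv_one, hX.fderiv_I, Matrix.det_fin_three]
    simp only [Matrix.of_apply, Matrix.cons_val_zero, Matrix.cons_val_one, Matrix.cons_val]
    simp only [catenoidU, catenoidV, catenoidNormal, frameVec_zero, frameVec_one, frameVec_two]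
    have e0 : catU α φ z 1 * catV α φ z 2 - catU α φ z 2 * catV α φ z 1
        = Real.cosh (α * z.im) * catM α φ z * catN α φ z 0 := by
      have hc := Real.cos_sq' (φ z.re)
      simp only [catU_one, catU_two, catV_one, catV_two, catN_zero]
      linear_combination (-Real.sin (φ z.re) * Real.cosh (α * z.im) * Real.sinh (α * z.im)
        * catM α φ z) * hc
    have e1 : catU α φ z 2 * catV α φ z 0 - catU α φ z 0 * catV α φ z 2
        = Real.cosh (α * z.im) * catM α φ z * catN α φ z 1 := by
      have hc := Real.cos_sq' (φ z.re)
      simp only [catU_zero, catU_two, catV_zero, catV_two, catN_one]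
      linear_combination (Real.cosh (α * z.im) * Real.sinh (α * z.im)
        * catM α φ z * catP α φ z) * hc
    have e2 : catU α φ z 0 * catV α φ z 1 - catU α φ z 1 * catV α φ z 0
        = Real.cosh (α * z.im) * catM α φ z * catN α φ z 2 := by
      simp only [catU_zero, catU_one, catV_zero, catV_one, catN_two]
      linear_combination (Real.cos (φ z.re) * Real.cosh (α * z.im)) * catP_sq (α := α) (φ := φ) z
    have e3 := catN_normSq (α := α) (φ := φ) z
    field_simp
    linear_combination catN α φ z 0 * e0 + catN α φ z 1 * e1 + catN α φ z 2 * e2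
      + Real.cosh (α * z.im) * catM α φ z * e3
  rw [hdet]
  positivity

lemma meanCurvature_of_conformal {g : (Fin 3 → ℝ) → Matrix (Fin 3) (Fin 3) ℝ}
    {X : ℂ → Fin 3 → ℝ} {n : Fin 3 → ℝ} {z : ℂ} {E : ℝ} (hE : E ≠ 0)
    (h : ∀ a b : ℂ, firstForm g X z a b = E * (a.re * b.re + a.im * b.im)) :
    meanCurvature g X n z = (secondForm g X n z 1 1 + secondForm g X n z Complex.I Complex.I)
      / (2 * E) := by
  rw [meanCurvature]
  simp only [h, Complex.one_re, Complex.one_im, Complex.I_re, Complex.I_im]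
  field_simp
  ring

lemma isConformalImmersionOn_of_firstForm {g : (Fin 3 → ℝ) → Matrix (Fin 3) (Fin 3) ℝ}
    {X : ℂ → Fin 3 → ℝ} {D : Set ℂ} {E : ℂ → ℝ} (hX : ContDiffOn ℝ ∞ X D) (hE : ∀ z ∈ D, 0 < E z)
    (h : ∀ z ∈ D, ∀ a b : ℂ, firstForm g X z a b = E z * (a.re * b.re + a.im * b.im)) :
    IsConformalImmersionOn g X D := by
  refine ⟨hX, fun z hz => ?_⟩
  have := hE z hz
  simp only [h z hz, Complex.one_re, Complex.one_im, Complex.I_re, Complex.I_im]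
  refine ⟨by simpa using this, by ring, by ring⟩

lemma conformalFactor_pos (hα : 0 < α) (φ : ℝ → ℝ) (z : ℂ) :
    0 < (Real.cosh (α * z.im) / profileDenom α φ z.re) ^ 2 := by
  have := profileDenom_pos hα φ z.re
  have := Real.cosh_pos (α * z.im)
  positivity

lemma meanCurvature_catenoidParam (hα : 0 < α) (h : IsProfile α φ) (z : ℂ) :
    meanCurvature hypProdMetric (catenoidParam α φ) (catenoidNormal α φ z) z = 1 / 2 := by
  have hd := (profileDenom_pos hα φ z.re).ne'
  have hC := (Real.cosh_pos (α * z.im)).ne'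
  have hsc := Real.sin_sq_add_cos_sq (φ z.re)
  rw [meanCurvature_of_conformal (conformalFactor_pos hα φ z).ne'
    (firstForm_catenoidParam hα h z), secondForm_catenoidParam hα h, secondForm_catenoidParam hα h]
  simp only [Complex.one_re, Complex.one_im, Complex.I_re, Complex.I_im]
  field_simp
  linear_combination Real.cosh (α * z.im) ^ 2 * hsc

/-- The two surfaces are sister immersions: the fundamental forms and normals of both are
explicit. -/
lemma areSisterImmersions (hα : 0 < α) (h : IsProfile α φ) :
    AreSisterImmersions (helicoidParam α φ) (catenoidParam α φ) := by
  refine ⟨catenoidParam_one_pos hα φ, ?_, ?_, ?_, ?_, ?_, helicoidNormal α φ, catenoidNormal α φ,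
    fun z => ⟨isUnitNormalAt_helicoidNormal hα h z, isUnitNormalAt_catenoidNormal hα h z,
      det_helicoid_pos hα h z, det_catenoid_pos hα h z, ?_, ?_, ?_⟩⟩
  · exact isConformalImmersionOn_of_firstForm (contDiff_helicoidParam hα h).contDiffOn
      (fun z _ => conformalFactor_pos hα φ z) fun z _ => firstForm_helicoidParam hα h z
  · exact isConformalImmersionOn_of_firstForm (contDiff_catenoidParam hα h).contDiffOn
      (fun z _ => conformalFactor_pos hα φ z) fun z _ => firstForm_catenoidParam hα h z
  · refine ⟨helicoidNormal α φ, (continuous_helicoidNormal hα h).continuousOn, fun z _ =>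
      ⟨isUnitNormalAt_helicoidNormal hα h z, ?_⟩⟩
    rw [meanCurvature_of_conformal (conformalFactor_pos hα φ z).ne'
      (firstForm_helicoidParam hα h z), secondForm_helicoidParam hα h,
      secondForm_helicoidParam hα h]
    simp
  · exact ⟨catenoidNormal α φ, (continuous_catenoidNormal hα h).continuousOn, fun z _ =>
      ⟨isUnitNormalAt_catenoidNormal hα h z, meanCurvature_catenoidParam hα h z⟩⟩
  · intro z a b
    rw [firstForm_helicoidParam hα h, firstForm_catenoidParam hα h]
  · have hM := (catM_pos hα φ z).ne'
    have hC := (Real.cosh_pos (α * z.im)).ne'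
    rw [metricInner_nilMetric, metricInner_hypProdMetric]
    have hv : contactForm (helicoidParam α φ z) vertical = 1 := by
      simp [contactForm, vertical]
    rw [hv]
    simp only [helicoidNormal, catenoidNormal, contactForm_contactLift, frameVec_two, catN_two,
      vertical, Matrix.cons_val_zero, Matrix.cons_val_one, Matrix.cons_val]
    field_simp
    ring
  · intro a
    have hM := (catM_pos hα φ z).ne'
    have hd := (profileDenom_pos hα φ z.re).ne'
    rw [metricInner_nilMetric, metricInner_hypProdMetric,
      (hasPartials_helicoidParam hα h).fderiv_apply, (hasPartials_catenoidParam hα h).fderiv_apply]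
    have hv : contactForm (helicoidParam α φ z) vertical = 1 := by
      simp [contactForm, vertical]
    rw [hv]
    simp only [contactForm_add, contactForm_smul, helicoidU, helicoidV, catenoidU, catenoidV,
      contactForm_contactLift, frameVec_two, catU_two, catV_two, Pi.add_apply, Pi.smul_apply,
      smul_eq_mul, vertical, Matrix.cons_val_zero, Matrix.cons_val_one, Matrix.cons_val,
      Complex.mul_re, Complex.mul_im, Complex.I_re, Complex.I_im]
    field_simp
    ring
  · intro a b
    have hd := (profileDenom_pos hα φ z.re).ne'
    have hsc := Real.sin_sq_add_cos_sq (φ z.re)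
    rw [secondForm_catenoidParam hα h, secondForm_helicoidParam hα h,
      firstForm_catenoidParam hα h]
    simp only [Complex.mul_re, Complex.mul_im, Complex.I_re, Complex.I_im]
    field_simp
    linear_combination (Real.cosh (α * z.im) ^ 2 * (a.re * b.re + a.im * b.im)) * hsc

end

/-! ### Holomorphic reparametrisation of a surface -/

/-- The second fundamental form does not see tangential changes of the second derivative. -/
lemma secondForm_add_vector (g : (Fin 3 → ℝ) → Matrix (Fin 3) (Fin 3) ℝ) (X Y : ℂ → Fin 3 → ℝ)
    {n : Fin 3 → ℝ} {z w a b c d e : ℂ} (hXY : Y w = X z) (hn : IsUnitNormalAt g X n z)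
    (ha : fderiv ℝ Y w a = fderiv ℝ X z c) (hb : fderiv ℝ Y w b = fderiv ℝ X z d)
    (hab : fderiv ℝ (fun w => fderiv ℝ Y w b) w a
      = fderiv ℝ (fun z => fderiv ℝ X z d) z c + fderiv ℝ X z e) :
    secondForm g Y n w a b = secondForm g X n z c d := by
  have h : covDeriv g Y w a b = covDeriv g X z c d + fderiv ℝ X z e := by
    ext k
    simp only [covDeriv, hXY, ha, hb, hab, Pi.add_apply]
    ring
  rw [secondForm, h, hXY, metricInner_add_left, hn.2, add_zero, secondForm]

section

variable {X : ℂ → Fin 3 → ℝ} {h h' : ℂ → ℂ} {w : ℂ}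

lemma fderiv_comp_holomorphic (hX : Differentiable ℝ X) (hh : HasDerivAt h (h' w) w) (a : ℂ) :
    fderiv ℝ (X ∘ h) w a = fderiv ℝ X (h w) (h' w * a) := by
  rw [fderiv_comp w hX.differentiableAt
    (hh.hasFDerivAt.restrictScalars ℝ).differentiableAt,
    (hh.hasFDerivAt.restrictScalars ℝ).fderiv]
  simp [mul_comm]

lemma fderiv_fderiv_comp_holomorphic (hX : ContDiff ℝ ∞ X)
    (hh : ∀ᶠ ζ in nhds w, HasDerivAt h (h' ζ) ζ) {h'' : ℂ} (hh' : HasDerivAt h' h'' w) (a b : ℂ) :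
    fderiv ℝ (fun ζ => fderiv ℝ (X ∘ h) ζ b) w a
      = fderiv ℝ (fun z => fderiv ℝ X z (h' w * b)) (h w) (h' w * a)
        + fderiv ℝ X (h w) (h'' * a * b) := by
  have hXd : Differentiable ℝ X := hX.differentiable (by simp)
  have hX1 : Differentiable ℝ (fderiv ℝ X) :=
    (hX.fderiv_right (m := ∞) (by simp)).differentiable (by simp)
  have e : (fun ζ => fderiv ℝ (X ∘ h) ζ b) =ᶠ[nhds w] fun ζ => fderiv ℝ X (h ζ) (h' ζ * b) :=
    hh.mono fun ζ hζ => fderiv_comp_holomorphic hXd hζ b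
  have h1 : HasFDerivAt (fun ζ => fderiv ℝ X (h ζ)) _ w :=
    (hX1 (h w)).hasFDerivAt.comp w (hh.self_of_nhds.hasFDerivAt.restrictScalars ℝ)
  have h2 : HasFDerivAt (fun ζ => h' ζ * b) _ w :=
    ((hh'.mul_const b).hasFDerivAt.restrictScalars ℝ)
  have h3 := h1.clm_apply h2
  have h4 : fderiv ℝ (fun z => fderiv ℝ X z (h' w * b)) (h w)
      = (fderiv ℝ (fderiv ℝ X) (h w)).flip (h' w * b) := by
    have := ((hX1 (h w)).hasFDerivAt.clm_apply (hasFDerivAt_const (h' w * b) (h w))).fderiv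
    rw [this]
    simp
  rw [e.fderiv_eq, h3.fderiv, h4]
  simp only [add_apply, ContinuousLinearMap.comp_apply, ContinuousLinearMap.flip_apply,
    ContinuousLinearMap.coe_restrictScalars', ContinuousLinearMap.toSpanSingleton_apply,
    smul_eq_mul]
  rw [add_comm]
  congr 2
  · ring_nf
  · ring

end

/-! ### The catenoid as an annulus -/

section

variable {α P : ℝ} {φ : ℝ → ℝ}

lemma profile_add_int_mul (hP : ∀ u, φ (u + P) = φ u - 2 * Real.pi) (u : ℝ) (n : ℤ) :
    φ (u + n * P) = φ u - n * (2 * Real.pi) := by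
  induction n using Int.induction_on with
  | zero => simp
  | succ n ih =>
    have h1 := hP (u + (n : ℤ) * P)
    rw [show u + ((n + 1 : ℤ) : ℝ) * P = u + (n : ℤ) * P + P by push_cast; ring, h1, ih]
    push_cast
    ring
  | pred n ih =>
    have h1 := hP (u + ((-n - 1 : ℤ) : ℝ) * P)
    rw [show u + ((-n - 1 : ℤ) : ℝ) * P + P = u + ((-n : ℤ) : ℝ) * P by push_cast; ring, ih] at h1
    push_cast at h1 ⊢
    linarith

/-- The map that turns the universal cover of `ℂ ∖ {0}`, in the coordinate `log w`, into the
parameter plane of the catenoid: `2π` in the argument corresponds to the period `P` of `φ`. -/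
def annulusScale (P : ℝ) : ℂ := -Complex.I * ((P / (2 * Real.pi) : ℝ) : ℂ)

lemma annulusScale_mul_re (P : ℝ) (ζ : ℂ) :
    (annulusScale P * ζ).re = P / (2 * Real.pi) * ζ.im := by
  simp only [annulusScale, Complex.mul_re, Complex.mul_im, Complex.neg_re, Complex.neg_im,
    Complex.I_re, Complex.I_im, Complex.ofReal_re, Complex.ofReal_im]
  ring

lemma annulusScale_mul_im (P : ℝ) (ζ : ℂ) :
    (annulusScale P * ζ).im = -(P / (2 * Real.pi) * ζ.re) := by
  simp only [annulusScale, Complex.mul_re, Complex.mul_im, Complex.neg_re, Complex.neg_im,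
    Complex.I_re, Complex.I_im, Complex.ofReal_re, Complex.ofReal_im]
  ring

lemma annulusScale_ne_zero (hP : 0 < P) : annulusScale P ≠ 0 := by
  have := Real.pi_pos
  rw [annulusScale]
  refine mul_ne_zero (neg_ne_zero.2 Complex.I_ne_zero) ?_
  exact_mod_cast (show P / (2 * Real.pi) ≠ 0 by positivity)

/-- Functions of `(cos φ(u), sin φ(u), v)` descend to the annulus. -/
lemma eq_of_exp_eq {E : Type*} {F : ℂ → E} (hP : ∀ u, φ (u + P) = φ u - 2 * Real.pi)
    (hF : ∀ z w : ℂ, Real.cos (φ z.re) = Real.cos (φ w.re) → Real.sin (φ z.re) = Real.sin (φ w.re) →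
      z.im = w.im → F z = F w) {ζ ξ : ℂ} (h : Complex.exp ζ = Complex.exp ξ) :
    F (annulusScale P * ζ) = F (annulusScale P * ξ) := by
  obtain ⟨n, rfl⟩ := Complex.exp_eq_exp_iff_exists_int.1 h
  have hre : (annulusScale P * (ξ + n * (2 * Real.pi * Complex.I))).re
      = (annulusScale P * ξ).re + n * P := by
    have := Real.pi_pos
    rw [annulusScale_mul_re, annulusScale_mul_re]
    simp
    field_simp
  have hφ : φ (annulusScale P * (ξ + n * (2 * Real.pi * Complex.I))).re
      = φ (annulusScale P * ξ).re - n * (2 * Real.pi) := by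
    rw [hre, profile_add_int_mul hP]
  refine hF _ _ ?_ ?_ ?_
  · rw [hφ, Real.cos_sub_int_mul_two_pi]
  · rw [hφ, Real.sin_sub_int_mul_two_pi]
  · rw [annulusScale_mul_im, annulusScale_mul_im]
    simp

/-- A holomorphic branch of the logarithm near `w₀ ≠ 0`. -/
def localLog (w₀ w : ℂ) : ℂ := Complex.log (w / w₀) + Complex.log w₀

lemma exp_localLog {w₀ w : ℂ} (h₀ : w₀ ≠ 0) (h : w ≠ 0) : Complex.exp (localLog w₀ w) = w := by
  rw [localLog, Complex.exp_add, Complex.exp_log (div_ne_zero h h₀), Complex.exp_log h₀]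
  field_simp

lemma eventually_hasDerivAt_localLog {w₀ : ℂ} (h₀ : w₀ ≠ 0) :
    ∀ᶠ w in nhds w₀, w ≠ 0 ∧ HasDerivAt (localLog w₀) w⁻¹ w := by
  have hc : ContinuousAt (fun w : ℂ => w / w₀) w₀ := by fun_prop
  have h1 : ∀ᶠ w in nhds w₀, w / w₀ ∈ Complex.slitPlane :=
    hc.eventually_mem (Complex.isOpen_slitPlane.mem_nhds (by rw [div_self h₀]; simp))
  filter_upwards [h1, isOpen_ne.mem_nhds h₀] with w hw hw0
  refine ⟨hw0, ?_⟩
  have := (((hasDerivAt_id w).div_const w₀).clog hw).add_const (Complex.log w₀)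
  refine this.congr_deriv ?_
  have hw0' : w ≠ 0 := hw0
  simp only [id]
  field_simp

/-- Any function on the annulus that descends from the parameter plane is locally the composition
with a holomorphic branch. -/
lemma eventuallyEq_comp_localLog {E : Type*} {F : ℂ → E} (hP : ∀ u, φ (u + P) = φ u - 2 * Real.pi)
    (hF : ∀ z w : ℂ, Real.cos (φ z.re) = Real.cos (φ w.re) → Real.sin (φ z.re) = Real.sin (φ w.re) →
      z.im = w.im → F z = F w) {w₀ : ℂ} (h₀ : w₀ ≠ 0) :
    (fun w => F (annulusScale P * Complex.log w))
      =ᶠ[nhds w₀] F ∘ fun w => annulusScale P * localLog w₀ w := by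
  filter_upwards [isOpen_ne.mem_nhds h₀] with w hw
  exact eq_of_exp_eq hP hF (by rw [exp_localLog h₀ hw, Complex.exp_log hw])

lemma continuousOn_comp_log {E : Type*} [TopologicalSpace E] {F : ℂ → E} (hc : Continuous F)
    (hP : ∀ u, φ (u + P) = φ u - 2 * Real.pi)
    (hF : ∀ z w : ℂ, Real.cos (φ z.re) = Real.cos (φ w.re) → Real.sin (φ z.re) = Real.sin (φ w.re) →
      z.im = w.im → F z = F w) :
    ContinuousOn (fun w => F (annulusScale P * Complex.log w)) {0}ᶜ := by
  intro w₀ h₀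
  refine ContinuousAt.continuousWithinAt ?_
  refine ContinuousAt.congr ?_ (eventuallyEq_comp_localLog hP hF h₀).symm
  exact hc.continuousAt.comp
    ((eventually_hasDerivAt_localLog h₀).self_of_nhds.2.continuousAt.const_mul _)

lemma profileDenom_congr {α : ℝ} {φ : ℝ → ℝ} {u v : ℝ} (h : Real.cos (φ u) = Real.cos (φ v)) :
    profileDenom α φ u = profileDenom α φ v := by
  rw [profileDenom, profileDenom, h]

lemma catenoidPoint_congr (α : ℝ) (φ : ℝ → ℝ) (z w : ℂ)
    (hc : Real.cos (φ z.re) = Real.cos (φ w.re)) (hs : Real.sin (φ z.re) = Real.sin (φ w.re))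
    (hv : z.im = w.im) : catenoidPoint α φ z = catenoidPoint α φ w := by
  simp only [catenoidPoint, catenoidSlope, catenoidHeight, hc, hs, hv, profileDenom_congr hc]

lemma catenoidParam_congr (α : ℝ) (φ : ℝ → ℝ) (z w : ℂ)
    (hc : Real.cos (φ z.re) = Real.cos (φ w.re)) (hs : Real.sin (φ z.re) = Real.sin (φ w.re))
    (hv : z.im = w.im) : catenoidParam α φ z = catenoidParam α φ w := by
  simp only [catenoidParam, hc, hs, hv, profileDenom_congr hc]

lemma catenoidNormal_congr (α : ℝ) (φ : ℝ → ℝ) (z w : ℂ)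
    (hc : Real.cos (φ z.re) = Real.cos (φ w.re)) (hs : Real.sin (φ z.re) = Real.sin (φ w.re))
    (hv : z.im = w.im) : catenoidNormal α φ z = catenoidNormal α φ w := by
  have hM : catM α φ z = catM α φ w := by simp only [catM, hv, profileDenom_congr hc]
  have hP : catP α φ z = catP α φ w := by simp only [catP, hv, profileDenom_congr hc]
  have hN : catN α φ z = catN α φ w := by simp only [catN, hc, hs, hv, hM, hP]
  simp only [catenoidNormal, hN, hM, hv, catenoidParam_congr α φ z w hc hs hv]

/-- The catenoid parametrised by `ℂ ∖ {0}`. -/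
def annulusPoint (α P : ℝ) (φ : ℝ → ℝ) (w : ℂ) : HypProd :=
  catenoidPoint α φ (annulusScale P * Complex.log w)

/-- The unit normal of the catenoid parametrised by `ℂ ∖ {0}`. -/
def annulusNormal (α P : ℝ) (φ : ℝ → ℝ) (w : ℂ) : Fin 3 → ℝ :=
  catenoidNormal α φ (annulusScale P * Complex.log w)

lemma continuous_catenoidPoint (hα : 0 < α) (h : IsProfile α φ) :
    Continuous (catenoidPoint α φ) := by
  have hφ := (h.contDiff hα).continuous
  have hd : Continuous fun z : ℂ => profileDenom α φ z.re := by
    unfold profileDenom; fun_prop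
  have hd0 : ∀ z : ℂ, profileDenom α φ z.re ≠ 0 := fun z => (profileDenom_pos hα φ z.re).ne'
  have ha : √(α ^ 2 + 1) ≠ 0 := by positivity
  have hX : Continuous (catenoidSlope α φ) := by
    unfold catenoidSlope
    exact Continuous.div (by fun_prop) (by fun_prop) fun z => mul_ne_zero ha (hd0 z)
  have ht : Continuous (catenoidHeight α φ) := by
    unfold catenoidHeight
    exact Continuous.div (by fun_prop) (by fun_prop) fun z => mul_ne_zero hα.ne' (hd0 z)
  have hl : Continuous fun z : ℂ => logRadius α (catenoidSlope α φ z) z.im :=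
    (contDiff_logRadius α).continuous.comp (hX.prodMk Complex.continuous_im)
  exact (WithLp.prod_continuous_toLp 2 _ _).comp
    ((continuous_polarPoint.comp (hX.prodMk hl)).prodMk ht)

lemma pointParam_catenoidPoint (hα : 0 < α) (z : ℂ) :
    pointParam hα (catenoidPoint α φ z).fst = z.im := by
  rw [catenoidPoint_fst]
  exact pointParam_paramPoint hα _ _

lemma pointParam_annulusPoint (hα : 0 < α) (P : ℝ) (w : ℂ) :
    pointParam hα (annulusPoint α P φ w).fst = -(P / (2 * Real.pi) * Real.log ‖w‖) := by
  rw [annulusPoint, pointParam_catenoidPoint, annulusScale_mul_im, Complex.log_re]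

lemma isProperMap_log_norm : IsProperMap fun w : ({0}ᶜ : Set ℂ) => Real.log ‖(w : ℂ)‖ := by
  rw [isProperMap_iff_isCompact_preimage]
  constructor
  · refine Continuous.log (by fun_prop) fun w => norm_ne_zero_iff.2 w.2
  · intro K hK
    rw [Subtype.isCompact_iff]
    have : Subtype.val '' ((fun w : ({0}ᶜ : Set ℂ) => Real.log ‖(w : ℂ)‖) ⁻¹' K)
        = (fun w : ℂ => ‖w‖) ⁻¹' (Real.exp '' K) := by
      ext w
      constructor
      · rintro ⟨w, hw, rfl⟩
        exact ⟨_, hw, Real.exp_log (norm_pos_iff.2 w.2)⟩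
      · rintro ⟨r, hr, hrw⟩
        have hw : w ≠ 0 := norm_pos_iff.1 ((Real.exp_pos r).trans_eq hrw)
        refine ⟨⟨w, hw⟩, ?_, rfl⟩
        simp only [Set.mem_preimage]
        simp only at hrw
        rwa [← hrw, Real.log_exp]
    rw [this]
    have hK' := hK.image Real.continuous_exp
    refine Metric.isCompact_of_isClosed_isBounded (hK'.isClosed.preimage continuous_norm) ?_
    obtain ⟨R, hR⟩ := hK'.isBounded.bddAbove
    exact (Metric.isBounded_closedBall (x := (0 : ℂ)) (r := R)).subset fun w hw => by
      simpa using hR hw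

lemma continuousOn_annulusPoint (hα : 0 < α) (h : IsProfile α φ)
    (hper : ∀ u, φ (u + P) = φ u - 2 * Real.pi) : ContinuousOn (annulusPoint α P φ) {0}ᶜ :=
  continuousOn_comp_log (continuous_catenoidPoint hα h) hper (catenoidPoint_congr α φ)

/-- The map is proper because `log |w|` is, up to a factor, the continuous function `v` of the image
point. -/
lemma isProperMap_annulusPoint (hα : 0 < α) (h : IsProfile α φ) (hP : 0 < P)
    (hper : ∀ u, φ (u + P) = φ u - 2 * Real.pi) :
    IsProperMap fun w : ({0}ᶜ : Set ℂ) => annulusPoint α P φ w := by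
  have hpi := Real.pi_pos
  have hc : Continuous fun w : ({0}ᶜ : Set ℂ) => annulusPoint α P φ w :=
    continuousOn_iff_continuous_domRestrict.1 (continuousOn_annulusPoint hα h hper)
  have hg : Continuous fun p : HypProd => pointParam hα p.fst / (-(P / (2 * Real.pi))) :=
    ((continuous_pointParam hα).comp (WithLp.continuous_fst 2 _ _)).div_const _
  refine isProperMap_of_comp_of_t2 hc hg ?_
  convert isProperMap_log_norm using 2 with w
  simp only [Function.comp_apply, pointParam_annulusPoint]
  have : P / (2 * Real.pi) ≠ 0 := by positivity
  field_simp

/-- A point of the catenoid determines `v`, and then `(sin φ, cos φ) / d`, whose norm determines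
`d`. -/
lemma catenoidPoint_eq_imp (hα : 0 < α) {z w : ℂ}
    (h : catenoidPoint α φ z = catenoidPoint α φ w) :
    Real.cos (φ z.re) = Real.cos (φ w.re) ∧ Real.sin (φ z.re) = Real.sin (φ w.re) ∧
      z.im = w.im := by
  have hv : z.im = w.im := by
    rw [← pointParam_catenoidPoint (φ := φ) hα z, h, pointParam_catenoidPoint]
  have hX : catenoidSlope α φ z = catenoidSlope α φ w := by
    have := congrArg (fun p : HypProd => axialSlope p.fst) h
    simpa only [catenoidPoint_fst, slope_polarPoint] using this
  have ht : catenoidHeight α φ z = catenoidHeight α φ w := by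
    have := congrArg (fun p : HypProd => p.snd) h
    simpa only [catenoidPoint_snd] using this
  have hd := profileDenom_pos hα φ z.re
  have hd' := profileDenom_pos hα φ w.re
  have hC := Real.cosh_pos (α * w.im)
  have ha : 0 < √(α ^ 2 + 1) := by positivity
  have h1 := Real.sin_sq_add_cos_sq (φ z.re)
  have h2 := Real.sin_sq_add_cos_sq (φ w.re)
  rw [catenoidSlope, catenoidSlope, hv] at hX
  rw [catenoidHeight, catenoidHeight, hv] at ht
  have hX' : Real.sin (φ z.re) * profileDenom α φ w.re
      = Real.sin (φ w.re) * profileDenom α φ z.re := by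
    field_simp at hX
    linarith
  have ht' : Real.cos (φ z.re) * profileDenom α φ w.re
      = Real.cos (φ w.re) * profileDenom α φ z.re := by
    field_simp at ht
    linarith
  have hdd : profileDenom α φ w.re = profileDenom α φ z.re := by
    have : profileDenom α φ w.re ^ 2 = profileDenom α φ z.re ^ 2 := by
      linear_combination (Real.sin (φ z.re) * profileDenom α φ w.re
        + Real.sin (φ w.re) * profileDenom α φ z.re) * hX'
        + (Real.cos (φ z.re) * profileDenom α φ w.re
        + Real.cos (φ w.re) * profileDenom α φ z.re) * ht'
        - profileDenom α φ w.re ^ 2 * h1 + profileDenom α φ z.re ^ 2 * h2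
    exact (pow_left_inj₀ hd'.le hd.le two_ne_zero).1 this
  rw [hdd] at hX' ht'
  exact ⟨mul_right_cancel₀ hd.ne' ht', mul_right_cancel₀ hd.ne' hX', hv⟩

lemma injOn_annulusPoint (hα : 0 < α) (h : IsProfile α φ) (hP : 0 < P)
    (hper : ∀ u, φ (u + P) = φ u - 2 * Real.pi) : Set.InjOn (annulusPoint α P φ) {0}ᶜ := by
  intro w₁ h₁ w₂ h₂ h12
  have hpi := Real.pi_pos
  obtain ⟨hc, hs, hv⟩ := catenoidPoint_eq_imp hα h12
  obtain ⟨n, hn⟩ := Real.Angle.angle_eq_iff_two_pi_dvd_sub.1 (Real.Angle.cos_sin_inj hc hs)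
  have hu : (annulusScale P * Complex.log w₁).re
      = (annulusScale P * Complex.log w₂).re + ((-n : ℤ) : ℝ) * P := by
    apply (h.strictAnti hα).injective
    rw [profile_add_int_mul hper]
    push_cast
    linarith
  rw [annulusScale_mul_re, annulusScale_mul_re] at hu
  rw [annulusScale_mul_im, annulusScale_mul_im] at hv
  rw [← Complex.exp_log h₁, ← Complex.exp_log h₂, Complex.exp_eq_exp_iff_exists_int]
  refine ⟨-n, Complex.ext ?_ ?_⟩
  · have : P / (2 * Real.pi) ≠ 0 := by positivity
    have := mul_left_cancel₀ this (neg_inj.1 hv)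
    simpa using this
  · field_simp at hu
    simp only [Complex.add_im, Complex.mul_im, Complex.mul_re, Complex.intCast_re,
      Complex.intCast_im, Complex.I_re, Complex.I_im, Complex.ofReal_re, Complex.ofReal_im,
      Complex.re_ofNat, Complex.im_ofNat]
    linarith

lemma image_annulusPoint (hα : 0 < α) (hP : 0 < P)
    (hper : ∀ u, φ (u + P) = φ u - 2 * Real.pi) :
    annulusPoint α P φ '' {0}ᶜ = horizontalCatenoid α φ := by
  rw [horizontalCatenoid_eq_range hα]
  apply Set.Subset.antisymm
  · rintro _ ⟨w, -, rfl⟩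
    exact ⟨_, rfl⟩
  · rintro _ ⟨z, rfl⟩
    refine ⟨Complex.exp (z / annulusScale P), Complex.exp_ne_zero _, ?_⟩
    have := eq_of_exp_eq hper (catenoidPoint_congr α φ)
      (Complex.exp_log (Complex.exp_ne_zero (z / annulusScale P)))
    rw [annulusPoint, this, mul_div_cancel₀ _ (annulusScale_ne_zero hP)]

/-- Locally the annulus is a holomorphic reparametrisation of the catenoid, so that the first and
second fundamental forms are pulled back. -/
lemma fundamentalForms_annulusPoint (hα : 0 < α) (h : IsProfile α φ)
    (hper : ∀ u, φ (u + P) = φ u - 2 * Real.pi) {w : ℂ} (hw : w ≠ 0) :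
    coords (annulusPoint α P φ w) = catenoidParam α φ (annulusScale P * Complex.log w) ∧
    ContDiffAt ℝ ∞ (fun z => coords (annulusPoint α P φ z)) w ∧
    (∀ a, fderiv ℝ (fun z => coords (annulusPoint α P φ z)) w a
      = fderiv ℝ (catenoidParam α φ) (annulusScale P * Complex.log w)
        (annulusScale P * w⁻¹ * a)) ∧
    ∀ a b, secondForm hypProdMetric (fun z => coords (annulusPoint α P φ z))
        (annulusNormal α P φ w) w a b
      = secondForm hypProdMetric (catenoidParam α φ) (annulusNormal α P φ w)
        (annulusScale P * Complex.log w) (annulusScale P * w⁻¹ * a)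
        (annulusScale P * w⁻¹ * b) := by
  have hX := contDiff_catenoidParam hα h
  have hlog : annulusScale P * localLog w w = annulusScale P * Complex.log w := by
    simp [localLog, div_self hw]
  have heq : (fun z => coords (annulusPoint α P φ z))
      =ᶠ[nhds w] catenoidParam α φ ∘ fun ζ => annulusScale P * localLog w ζ := by
    simp only [annulusPoint, coords_catenoidPoint hα]
    exact eventuallyEq_comp_localLog hper (catenoidParam_congr α φ) hw
  have hh : ∀ᶠ ζ in nhds w, HasDerivAt (fun ζ => annulusScale P * localLog w ζ)
      ((fun ζ => annulusScale P * ζ⁻¹) ζ) ζ :=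
    (eventually_hasDerivAt_localLog hw).mono fun ζ hζ => hζ.2.const_mul _
  have hh' : HasDerivAt (fun ζ => annulusScale P * ζ⁻¹) (annulusScale P * -(w ^ 2)⁻¹) w :=
    (hasDerivAt_inv hw).const_mul _
  have hp : coords (annulusPoint α P φ w) = catenoidParam α φ (annulusScale P * Complex.log w) := by
    rw [annulusPoint, coords_catenoidPoint hα]
  have h1 : ∀ a, fderiv ℝ (fun z => coords (annulusPoint α P φ z)) w a
      = fderiv ℝ (catenoidParam α φ) (annulusScale P * Complex.log w)
        (annulusScale P * w⁻¹ * a) := fun a => by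
    rw [heq.fderiv_eq, fderiv_comp_holomorphic (h' := fun ζ => annulusScale P * ζ⁻¹)
      (hX.differentiable (by simp)) hh.self_of_nhds, hlog]
  refine ⟨hp, ?_, h1, fun a b => ?_⟩
  · refine ContDiffAt.congr_of_eventuallyEq ?_ heq
    refine hX.contDiffAt.comp w (contDiffAt_const.mul ?_)
    have hd : ∀ᶠ ζ in nhds w, DifferentiableAt ℂ (localLog w) ζ :=
      (eventually_hasDerivAt_localLog hw).mono fun ζ hζ => hζ.2.differentiableAt
    exact ((Complex.analyticAt_iff_eventually_differentiableAt.2 hd).contDiffAt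
      (n := ∞)).restrict_scalars ℝ
  · have hab : fderiv ℝ (fun z => fderiv ℝ (fun z => coords (annulusPoint α P φ z)) z b) w a
        = fderiv ℝ (fun z => fderiv ℝ (catenoidParam α φ) z (annulusScale P * w⁻¹ * b))
            (annulusScale P * Complex.log w) (annulusScale P * w⁻¹ * a)
          + fderiv ℝ (catenoidParam α φ) (annulusScale P * Complex.log w)
            (annulusScale P * -(w ^ 2)⁻¹ * a * b) := by
      have e : (fun z => fderiv ℝ (fun z => coords (annulusPoint α P φ z)) z b) =ᶠ[nhds w]
          fun z => fderiv ℝ (catenoidParam α φ ∘ fun ζ => annulusScale P * localLog w ζ) z b :=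
        heq.eventuallyEq_nhds.mono fun ζ hζ => by simp only [hζ.fderiv_eq]
      rw [e.fderiv_eq, fderiv_fderiv_comp_holomorphic hX hh hh', hlog]
    exact secondForm_add_vector hypProdMetric _ _ hp (isUnitNormalAt_catenoidNormal hα h _)
      (h1 a) (h1 b) hab

/-- The catenoid is a properly embedded annulus of mean curvature `1/2`. -/
lemma isProperlyEmbeddedCMCPuncturedPlane (hα : 0 < α) (h : IsProfile α φ) (hP : 0 < P)
    (hper : ∀ u, φ (u + P) = φ u - 2 * Real.pi) :
    IsProperlyEmbeddedCMCPuncturedPlane (1 / 2) (horizontalCatenoid α φ) := by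
  have key := fun {w : ℂ} (hw : w ≠ 0) => fundamentalForms_annulusPoint hα h hper hw
  have hE : ∀ w ∈ ({0}ᶜ : Set ℂ), 0 < Complex.normSq (annulusScale P * w⁻¹)
      * (Real.cosh (α * (annulusScale P * Complex.log w).im)
        / profileDenom α φ (annulusScale P * Complex.log w).re) ^ 2 := fun w hw =>
    mul_pos (Complex.normSq_pos.2 (mul_ne_zero (annulusScale_ne_zero hP) (inv_ne_zero hw)))
      (conformalFactor_pos hα φ _)
  have hff : ∀ w ∈ ({0}ᶜ : Set ℂ), ∀ a b : ℂ,
      firstForm hypProdMetric (fun z => coords (annulusPoint α P φ z)) w a b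
        = Complex.normSq (annulusScale P * w⁻¹)
          * (Real.cosh (α * (annulusScale P * Complex.log w).im)
            / profileDenom α φ (annulusScale P * Complex.log w).re) ^ 2
          * (a.re * b.re + a.im * b.im) := by
    intro w hw a b
    obtain ⟨hp, -, h1, -⟩ := key hw
    have := firstForm_catenoidParam hα h (annulusScale P * Complex.log w)
      (annulusScale P * w⁻¹ * a) (annulusScale P * w⁻¹ * b)
    rw [firstForm] at this ⊢
    rw [hp, h1, h1, this, Complex.normSq_apply]
    simp only [Complex.mul_re (annulusScale P * w⁻¹), Complex.mul_im (annulusScale P * w⁻¹)]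
    ring
  refine ⟨annulusPoint α P φ, isConformalImmersionOn_of_firstForm
    (fun w hw => (key hw).2.1.contDiffWithinAt) hE hff, injOn_annulusPoint hα h hP hper,
    isProperMap_annulusPoint hα h hP hper, image_annulusPoint hα hP hper,
    annulusNormal α P φ, continuousOn_comp_log (continuous_catenoidNormal hα h) hper
      (catenoidNormal_congr α φ), fun w hw => ?_⟩
  obtain ⟨hp, -, h1, h2⟩ := key hw
  have hn := isUnitNormalAt_catenoidNormal hα h (annulusScale P * Complex.log w)
  refine ⟨⟨by simp only [hp]; exact hn.1, fun a => by simp only [hp, h1]; exact hn.2 _⟩, ?_⟩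
  have hE' := hE w hw
  have hH := meanCurvature_catenoidParam hα h (annulusScale P * Complex.log w)
  have hE0 := conformalFactor_pos hα φ (annulusScale P * Complex.log w)
  rw [meanCurvature_of_conformal hE0.ne' (firstForm_catenoidParam hα h _),
    div_eq_iff (by positivity)] at hH
  rw [meanCurvature_of_conformal hE'.ne' (hff w hw), div_eq_iff (by positivity), h2, h2]
  simp only [annulusNormal, secondForm_catenoidParam hα h, Complex.one_re, Complex.one_im,
    Complex.I_re, Complex.I_im] at hH ⊢
  rw [Complex.normSq_apply]
  simp only [Complex.mul_re (annulusScale P * w⁻¹), Complex.mul_im (annulusScale P * w⁻¹),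
    Complex.one_re, Complex.one_im, Complex.I_re, Complex.I_im]
  linear_combination ((annulusScale P * w⁻¹).re * (annulusScale P * w⁻¹).re
    + (annulusScale P * w⁻¹).im * (annulusScale P * w⁻¹).im) * hH

end

/-! ### Smooth dependence on parameters -/

section

variable {P E G : Type*} [NormedAddCommGroup P] [NormedSpace ℝ P] [NormedAddCommGroup E]
  [NormedSpace ℝ E] [NormedAddCommGroup G] [NormedSpace ℝ G]

/-- The partial derivatives in the second variable of a map that is smooth in both variables depend
continuously on both variables. -/
lemma continuousAt_iteratedFDeriv_snd {F : P × E → G} {s : Set (P × E)} (hs : IsOpen s)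
    (hF : ContDiffOn ℝ ∞ F s) (k : ℕ) {x : P × E} (hx : x ∈ s) :
    ContinuousAt (fun y : P × E => iteratedFDeriv ℝ k (fun z => F (y.1, z)) y.2) x := by
  have key : ∀ y ∈ s, iteratedFDeriv ℝ k (fun z => F (y.1, z)) y.2
      = ContinuousMultilinearMap.compContinuousLinearMapL (F := G)
        (fun _ : Fin k => ContinuousLinearMap.inr ℝ P E) (iteratedFDeriv ℝ k F y) := by
    rintro ⟨p, z⟩ hy
    set τ : P × E → P × E := fun w => (p, (0 : E)) + w with hτ
    have hτs : IsOpen (τ ⁻¹' s) := hs.preimage (by fun_prop)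
    have hcd : ContDiffOn ℝ ∞ (F ∘ τ) (τ ⁻¹' s) :=
      hF.comp (by fun_prop) fun w hw => hw
    have hz : ContinuousLinearMap.inr ℝ P E z ∈ τ ⁻¹' s := by
      simpa [hτ] using hy
    have ho := hτs.preimage (ContinuousLinearMap.inr ℝ P E).continuous
    have h1 := (ContinuousLinearMap.inr ℝ P E).iteratedFDerivWithin_comp_right hcd
      hτs.uniqueDiffOn ho.uniqueDiffOn hz (i := k) (by exact_mod_cast le_top)
    rw [iteratedFDerivWithin_of_isOpen k ho hz, iteratedFDerivWithin_of_isOpen k hτs hz] at h1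
    have h2 : (F ∘ τ) ∘ ContinuousLinearMap.inr ℝ P E = fun z => F (p, z) := by
      ext z; simp [hτ]
    have h3 : iteratedFDeriv ℝ k (F ∘ τ) (ContinuousLinearMap.inr ℝ P E z)
        = iteratedFDeriv ℝ k F (p, z) := by
      have := iteratedFDeriv_comp_add_left (𝕜 := ℝ) (f := F) k (p, (0 : E))
        (ContinuousLinearMap.inr ℝ P E z)
      rw [show F ∘ τ = fun w => F ((p, (0 : E)) + w) from rfl, this]
      simp
    rw [h2, h3] at h1
    exact h1
  have hc : ContinuousAt (iteratedFDeriv ℝ k F) x :=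
    (hF.contDiffAt (hs.mem_nhds hx)).continuousAt_iteratedFDeriv (by exact_mod_cast le_top)
  refine ContinuousAt.congr ?_ ((hs.eventually_mem hx).mono fun y hy => (key y hy).symm)
  exact (ContinuousLinearMap.continuous _).continuousAt.comp hc

/-- If a map is smooth in a point and a parameter, then all its derivatives in the point converge
locally uniformly as the parameter converges. -/
lemma tendstoLocallyUniformlyOn_iteratedFDeriv {F : P × E → G} {s : Set E} (hs : IsOpen s)
    (hF : ContDiffOn ℝ ∞ F (Set.univ ×ˢ s)) (k : ℕ) {γ : ℝ → P} {p : P}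
    (hγ : Filter.Tendsto γ Filter.atTop (nhds p)) :
    TendstoLocallyUniformlyOn (fun α => iteratedFDeriv ℝ k (fun z => F (γ α, z)))
      (iteratedFDeriv ℝ k (fun z => F (p, z))) Filter.atTop s := by
  rw [Metric.tendstoLocallyUniformlyOn_iff]
  intro e he x hx
  have hc := continuousAt_iteratedFDeriv_snd (isOpen_univ.prod hs) hF k
    (x := (p, x)) ⟨Set.mem_univ _, hx⟩
  have h1 := Metric.tendsto_nhds.1 hc (e / 2) (half_pos he)
  rw [nhds_prod_eq] at h1
  obtain ⟨A, hA, B, hB, hAB⟩ := Filter.eventually_prod_iff.1 h1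
  refine ⟨{z | B z}, mem_nhdsWithin_of_mem_nhds hB, ?_⟩
  filter_upwards [hγ.eventually hA] with α hα z hz
  have h2 := hAB hα hz
  have h3 := hAB hA.self_of_nhds hz
  calc _ ≤ _ := dist_triangle_right _ _ (iteratedFDeriv ℝ k (fun z => F (p, z)) x)
    _ < e / 2 + e / 2 := add_lt_add h3 h2
    _ = e := add_halves e

end

/-! ### The two sheets of the catenoid -/

/-- The norm of `(√(1 + ε²) ξ, η)` for `ζ = ξ + i η`, where `ε = 1 / α`. -/
def sheetRadius (ε : ℝ) (ζ : ℂ) : ℝ := √((1 + ε ^ 2) * ζ.re ^ 2 + ζ.im ^ 2)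

/-- The value of `sinh (α v) / α²` along a sheet, with `ε = 1 / α`. -/
def sheetSinh (ε : ℝ) (ζ : ℂ) : ℝ := sheetRadius ε ζ + √(sheetRadius ε ζ ^ 2 + ε ^ 2 * ζ.im ^ 2)

/-- The value of `coth (α v)` along a sheet, with `ε = 1 / α`. -/
def sheetCoth (ε : ℝ) (ζ : ℂ) : ℝ := √(1 + ε ^ 4 / sheetSinh ε ζ ^ 2)

/-- The value of `y` along a sheet, with `p.1 = 1 / α`; the parameter `p.2` stands for
`2 (√(1 + 1 / α²) - 1) log α`, which is not smooth in `1 / α` but converges to `0`. -/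
def sheetIm (p : ℝ × ℝ) (ζ : ℂ) : ℝ :=
  (1 + sheetCoth p.1 ζ)
    * Real.exp (p.2 + (√(1 + p.1 ^ 2) - 1) * Real.log (sheetSinh p.1 ζ * (1 + sheetCoth p.1 ζ)))
    / (1 + sheetCoth p.1 ζ * √(1 + ζ.re ^ 2 * (p.1 ^ 4 / sheetSinh p.1 ζ ^ 2)))

lemma sheetIm_pos (p : ℝ × ℝ) (ζ : ℂ) : 0 < sheetIm p ζ := by
  have : 0 ≤ sheetCoth p.1 ζ := Real.sqrt_nonneg _
  rw [sheetIm]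
  positivity

/-- The sheet of the catenoid on which `v > 0`, for `p = (1 / α, 2 (√(1 + 1 / α²) - 1) log α)`. The
parameter `ζ` is `tanh (α v)` times (slope + `i` height), so that the sheet is parametrised by
`ℂ ∖ {0}` and the value `p = 0` gives the horocylinder `{y = 1}`. -/
def sheetPoint (p : ℝ × ℝ) (ζ : ℂ) : HypProd :=
  WithLp.toLp 2 (⟨⟨ζ.re * sheetCoth p.1 ζ * sheetIm p ζ, sheetIm p ζ⟩, sheetIm_pos p ζ⟩,
    ζ.im * sheetCoth p.1 ζ)

lemma coords_sheetPoint (p : ℝ × ℝ) (ζ : ℂ) : coords (sheetPoint p ζ)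
    = ![ζ.re * sheetCoth p.1 ζ * sheetIm p ζ, sheetIm p ζ, ζ.im * sheetCoth p.1 ζ] := rfl

lemma axialSlope_sheetPoint (p : ℝ × ℝ) (ζ : ℂ) :
    axialSlope (sheetPoint p ζ).fst = ζ.re * sheetCoth p.1 ζ := by
  change ζ.re * sheetCoth p.1 ζ * sheetIm p ζ / sheetIm p ζ = _
  rw [mul_div_assoc, div_self (sheetIm_pos p ζ).ne', mul_one]

lemma sheetRadius_pos (ε : ℝ) {ζ : ℂ} (hζ : ζ ≠ 0) :
    0 < (1 + ε ^ 2) * ζ.re ^ 2 + ζ.im ^ 2 := by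
  have h : 0 < Complex.normSq ζ := Complex.normSq_pos.2 hζ
  rw [Complex.normSq_apply] at h
  nlinarith [mul_nonneg (sq_nonneg ε) (sq_nonneg ζ.re)]

lemma sheetSinh_pos (ε : ℝ) {ζ : ℂ} (hζ : ζ ≠ 0) : 0 < sheetSinh ε ζ :=
  add_pos_of_pos_of_nonneg (Real.sqrt_pos.2 (sheetRadius_pos ε hζ)) (Real.sqrt_nonneg _)

lemma sheetCoth_pos (ε : ℝ) (ζ : ℂ) : 0 < sheetCoth ε ζ := by
  rw [sheetCoth]; positivity

lemma contDiffOn_sheet : ContDiffOn ℝ ∞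
    (fun x : (ℝ × ℝ) × ℂ => coords (sheetPoint x.1 x.2)) (Set.univ ×ˢ {0}ᶜ) := by
  rintro ⟨p, ζ⟩ ⟨-, hζ⟩
  apply ContDiffAt.contDiffWithinAt
  have hζ : ζ ≠ 0 := hζ
  have he : ContDiffAt ℝ ∞ (fun x : (ℝ × ℝ) × ℂ => x.1.1) (p, ζ) := by fun_prop
  have hl : ContDiffAt ℝ ∞ (fun x : (ℝ × ℝ) × ℂ => x.1.2) (p, ζ) := by fun_prop
  have hx : ContDiffAt ℝ ∞ (fun x : (ℝ × ℝ) × ℂ => x.2.re) (p, ζ) :=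
    (Complex.reCLM.contDiff.comp contDiff_snd).contDiffAt
  have hy : ContDiffAt ℝ ∞ (fun x : (ℝ × ℝ) × ℂ => x.2.im) (p, ζ) :=
    (Complex.imCLM.contDiff.comp contDiff_snd).contDiffAt
  have hr : ContDiffAt ℝ ∞ (fun x : (ℝ × ℝ) × ℂ => sheetRadius x.1.1 x.2) (p, ζ) := by
    unfold sheetRadius
    exact ContDiffAt.sqrt (((contDiffAt_const.add (he.pow 2)).mul (hx.pow 2)).add (hy.pow 2))
      (sheetRadius_pos p.1 hζ).ne'
  have hS : ContDiffAt ℝ ∞ (fun x : (ℝ × ℝ) × ℂ => sheetSinh x.1.1 x.2) (p, ζ) := by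
    unfold sheetSinh
    refine hr.add (ContDiffAt.sqrt ((hr.pow 2).add ((he.pow 2).mul (hy.pow 2))) ?_)
    have : 0 < sheetRadius p.1 ζ := Real.sqrt_pos.2 (sheetRadius_pos p.1 hζ)
    dsimp only
    positivity
  have hS0 := sheetSinh_pos p.1 hζ
  have hQ : ContDiffAt ℝ ∞ (fun x : (ℝ × ℝ) × ℂ => x.1.1 ^ 4 / sheetSinh x.1.1 x.2 ^ 2) (p, ζ) :=
    (he.pow 4).div (hS.pow 2) (by dsimp only; positivity)
  have hq : ContDiffAt ℝ ∞ (fun x : (ℝ × ℝ) × ℂ => sheetCoth x.1.1 x.2) (p, ζ) := by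
    unfold sheetCoth
    exact ContDiffAt.sqrt (contDiffAt_const.add hQ) (by dsimp only; positivity)
  have hq0 := sheetCoth_pos p.1 ζ
  have hm : ContDiffAt ℝ ∞ (fun x : (ℝ × ℝ) × ℂ => √(1 + x.1.1 ^ 2)) (p, ζ) :=
    ContDiffAt.sqrt (contDiffAt_const.add (he.pow 2)) (by dsimp only; positivity)
  have hI : ContDiffAt ℝ ∞ (fun x : (ℝ × ℝ) × ℂ => sheetIm x.1 x.2) (p, ζ) := by
    unfold sheetIm
    refine ContDiffAt.div (ContDiffAt.mul (contDiffAt_const.add hq) (ContDiffAt.exp (hl.add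
      ((hm.sub contDiffAt_const).mul (ContDiffAt.log (hS.mul (contDiffAt_const.add hq)) ?_)))))
      (contDiffAt_const.add (hq.mul (ContDiffAt.sqrt (contDiffAt_const.add
        ((hx.pow 2).mul hQ)) ?_))) ?_
    · dsimp only; positivity
    · dsimp only; positivity
    · dsimp only; positivity
  simp only [coords_sheetPoint]
  rw [contDiffAt_pi]
  intro i
  fin_cases i
  · exact (hx.mul hq).mul hI
  · exact hI
  · exact hy.mul hq

/-- The parameter of the sheets that corresponds to `α`. -/
def sheetShift (α : ℝ) : ℝ × ℝ := (α⁻¹, 2 * (√(1 + α⁻¹ ^ 2) - 1) * Real.log α)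

lemma tendsto_sheetShift : Filter.Tendsto sheetShift Filter.atTop (nhds 0) := by
  refine Filter.Tendsto.prodMk_nhds tendsto_inv_atTop_zero ?_
  refine squeeze_zero' (g := fun α : ℝ => α⁻¹) ?_ ?_ tendsto_inv_atTop_zero
  · filter_upwards [Filter.eventually_ge_atTop 1] with α hα
    have h1 : 1 ≤ √(1 + α⁻¹ ^ 2) := Real.one_le_sqrt.2 (by nlinarith [sq_nonneg α⁻¹])
    have h2 := Real.log_nonneg hα
    have h3 : 0 ≤ √(1 + α⁻¹ ^ 2) - 1 := by linarith
    positivity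
  · filter_upwards [Filter.eventually_ge_atTop 1] with α hα
    have hα0 : 0 < α := by linarith
    have h1 : √(1 + α⁻¹ ^ 2) ≤ 1 + α⁻¹ ^ 2 / 2 := by
      rw [Real.sqrt_le_left (by positivity)]
      nlinarith [sq_nonneg (α⁻¹ ^ 2)]
    have h2 := Real.log_nonneg hα
    have h3 : Real.log α ≤ α := (Real.log_le_sub_one_of_pos hα0).trans (by linarith)
    calc _ ≤ α⁻¹ ^ 2 * Real.log α := by
          apply mul_le_mul_of_nonneg_right _ h2; linarith
      _ ≤ α⁻¹ ^ 2 * α := by gcongr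
      _ = α⁻¹ := by field_simp

/-! ### The sheets lie in the catenoid -/

section

variable {α : ℝ} {φ : ℝ → ℝ}

/-- The conformal parameter `v` along the sheet on which it is positive. -/
def sheetParam (α : ℝ) (ζ : ℂ) : ℝ := Real.arsinh (α ^ 2 * sheetSinh α⁻¹ ζ) / α

lemma sinh_sheetParam (hα : 0 < α) (ζ : ℂ) :
    Real.sinh (α * sheetParam α ζ) = α ^ 2 * sheetSinh α⁻¹ ζ := by
  rw [sheetParam, mul_div_cancel₀ _ hα.ne', Real.sinh_arsinh]

lemma sheetParam_pos (hα : 0 < α) {ζ : ℂ} (hζ : ζ ≠ 0) : 0 < sheetParam α ζ := by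
  have := sheetSinh_pos α⁻¹ hζ
  have : 0 < Real.arsinh (α ^ 2 * sheetSinh α⁻¹ ζ) := Real.arsinh_pos_iff.2 (by positivity)
  rw [sheetParam]
  positivity

lemma cosh_sheetParam (hα : 0 < α) {ζ : ℂ} (hζ : ζ ≠ 0) :
    Real.cosh (α * sheetParam α ζ) = α ^ 2 * sheetSinh α⁻¹ ζ * sheetCoth α⁻¹ ζ := by
  have hK := sheetSinh_pos α⁻¹ hζ
  have hq := sheetCoth_pos α⁻¹ ζ
  have h2 : sheetCoth α⁻¹ ζ ^ 2 = 1 + α⁻¹ ^ 4 / sheetSinh α⁻¹ ζ ^ 2 :=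
    Real.sq_sqrt (by positivity)
  rw [← sq_eq_sq₀ (Real.cosh_pos _).le (by positivity), Real.cosh_sq, sinh_sheetParam hα,
    mul_pow _ (sheetCoth α⁻¹ ζ), h2]
  generalize sheetSinh α⁻¹ ζ = K at hK ⊢
  field_simp

lemma sheetPoint_fst (hα : 0 < α) {ζ : ℂ} (hζ : ζ ≠ 0) : (sheetPoint (sheetShift α) ζ).fst
    = paramPoint α (ζ.re * sheetCoth α⁻¹ ζ) (sheetParam α ζ) := by
  have hK := sheetSinh_pos α⁻¹ hζ
  have hq := sheetCoth_pos α⁻¹ ζ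
  have hS := sinh_sheetParam hα ζ
  have hC := cosh_sheetParam hα hζ
  have him : sheetIm (sheetShift α) ζ = Real.exp (logRadius α (ζ.re * sheetCoth α⁻¹ ζ)
      (sheetParam α ζ)) / √(1 + (ζ.re * sheetCoth α⁻¹ ζ) ^ 2) := by
    have ha : √(α ^ 2 + 1) = α * √(1 + α⁻¹ ^ 2) := by
      conv_rhs => rw [← Real.sqrt_sq hα.le, ← Real.sqrt_mul (sq_nonneg _)]
      rw [Real.sqrt_sq hα.le]
      congr 1
      field_simp
    have hexp : Real.exp (α * sheetParam α ζ)
        = α ^ 2 * sheetSinh α⁻¹ ζ * (1 + sheetCoth α⁻¹ ζ) := by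
      rw [← Real.cosh_add_sinh, hC, hS]; ring
    have hlog : 2 * Real.log α + Real.log (sheetSinh α⁻¹ ζ * (1 + sheetCoth α⁻¹ ζ))
        = α * sheetParam α ζ := by
      rw [← Real.log_exp (α * sheetParam α ζ), hexp, mul_assoc,
        Real.log_mul (x := α ^ 2) (by positivity) (by positivity), Real.log_pow]
      push_cast; ring
    have harg : 2 * (√(1 + α⁻¹ ^ 2) - 1) * Real.log α + (√(1 + α⁻¹ ^ 2) - 1)
        * Real.log (sheetSinh α⁻¹ ζ * (1 + sheetCoth α⁻¹ ζ))
        = √(α ^ 2 + 1) * sheetParam α ζ - α * sheetParam α ζ := by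
      rw [ha]
      linear_combination (√(1 + α⁻¹ ^ 2) - 1) * hlog
    have hW : √(Real.cosh (α * sheetParam α ζ) ^ 2 + (ζ.re * sheetCoth α⁻¹ ζ) ^ 2)
        = α ^ 2 * sheetSinh α⁻¹ ζ * (sheetCoth α⁻¹ ζ
          * √(1 + ζ.re ^ 2 * (α⁻¹ ^ 4 / sheetSinh α⁻¹ ζ ^ 2))) := by
      rw [Real.sqrt_eq_iff_mul_self_eq (by positivity) (by positivity), hC]
      have h2 := Real.sq_sqrt
        (show 0 ≤ 1 + ζ.re ^ 2 * (α⁻¹ ^ 4 / sheetSinh α⁻¹ ζ ^ 2) by positivity)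
      generalize √(1 + ζ.re ^ 2 * (α⁻¹ ^ 4 / sheetSinh α⁻¹ ζ ^ 2)) = Q at h2 ⊢
      have h3 : α ^ 4 * sheetSinh α⁻¹ ζ ^ 2 * Q ^ 2 = α ^ 4 * sheetSinh α⁻¹ ζ ^ 2 + ζ.re ^ 2 := by
        rw [h2]
        generalize sheetSinh α⁻¹ ζ = K at hK ⊢
        field_simp
      linear_combination -sheetCoth α⁻¹ ζ ^ 2 * h3
    have hQ := Real.sqrt_nonneg (1 + ζ.re ^ 2 * (α⁻¹ ^ 4 / sheetSinh α⁻¹ ζ ^ 2))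
    rw [exp_logRadius, hW, hS, sheetIm, sheetShift, harg, Real.exp_sub, hexp]
    dsimp only
    generalize √(1 + ζ.re ^ 2 * (α⁻¹ ^ 4 / sheetSinh α⁻¹ ζ ^ 2)) = Q at hQ ⊢
    generalize sheetSinh α⁻¹ ζ = K at hK ⊢
    generalize sheetCoth α⁻¹ ζ = q at hq ⊢
    field_simp
  apply UpperHalfPlane.ext
  apply Complex.ext
  · change ζ.re * sheetCoth α⁻¹ ζ * sheetIm (sheetShift α) ζ = _
    rw [him]
    rfl
  · change sheetIm (sheetShift α) ζ = _
    rw [him]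
    rfl

lemma sheetPoint_snd (α : ℝ) (ζ : ℂ) :
    (sheetPoint (sheetShift α) ζ).snd = ζ.im * sheetCoth α⁻¹ ζ := rfl

lemma sheetPoint_mem (hα : 0 < α) (hφ : Function.Surjective φ) {ζ : ℂ} (hζ : ζ ≠ 0) :
    sheetPoint (sheetShift α) ζ ∈ horizontalCatenoid α φ := by
  rw [mem_horizontalCatenoid_iff' hα hφ, sheetPoint_fst hα hζ, slope_paramPoint,
    pointParam_paramPoint, sqHeight_eq, cosh_sheetParam hα hζ, sheetPoint_snd]
  have hK := sheetSinh_pos α⁻¹ hζ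
  have hq := sheetCoth_pos α⁻¹ ζ
  have ha := sq_sqrt_sq_add_one α
  have hr : sheetRadius α⁻¹ ζ ^ 2 = (1 + α⁻¹ ^ 2) * ζ.re ^ 2 + ζ.im ^ 2 :=
    Real.sq_sqrt (sheetRadius_pos α⁻¹ hζ).le
  have hr0 : 0 ≤ sheetRadius α⁻¹ ζ := Real.sqrt_nonneg _
  have hK2 : (sheetSinh α⁻¹ ζ - sheetRadius α⁻¹ ζ) ^ 2
      = sheetRadius α⁻¹ ζ ^ 2 + α⁻¹ ^ 2 * ζ.im ^ 2 := by
    rw [sheetSinh, add_sub_cancel_left, Real.sq_sqrt (by positivity)]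
  set K := sheetSinh α⁻¹ ζ
  set q := sheetCoth α⁻¹ ζ
  set r := sheetRadius α⁻¹ ζ
  have hr' : α ^ 2 * r ^ 2 = (α ^ 2 + 1) * ζ.re ^ 2 + α ^ 2 * ζ.im ^ 2 := by
    rw [hr]; field_simp
  have hK2' : α ^ 2 * (K ^ 2 - 2 * K * r) = ζ.im ^ 2 := by
    have : K ^ 2 - 2 * K * r = α⁻¹ ^ 2 * ζ.im ^ 2 := by linear_combination hK2
    rw [this]; field_simp
  have hW : √(α ^ 2 + 1) * √((α ^ 2 * K * q) ^ 2 + (ζ.re * q) ^ 2) - α * (α ^ 2 * K * q)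
      = α * r * q := by
    rw [sub_eq_iff_eq_add, ← Real.sqrt_mul (by positivity), Real.sqrt_eq_iff_mul_self_eq
      (by positivity) (by positivity)]
    linear_combination -q ^ 2 * hr' + q ^ 2 * α ^ 2 * hK2'
  rw [hW, mul_pow √(α ^ 2 + 1), ha]
  linear_combination -q ^ 2 * hr'

/-- The implicit equation of the catenoid, solved for `cosh (α v)`. -/
lemma sqrt_of_mul_sq_eq_sqHeight (hα : 0 < α) {X v t : ℝ} (h : (α * t) ^ 2 = sqHeight α X v) :
    ∃ r : ℝ, 0 < r ∧ r ^ 2 = (α ^ 2 + 1) * X ^ 2 + α ^ 2 * t ^ 2 ∧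
      √(r ^ 2 + t ^ 2) = Real.cosh (α * v) / α - r := by
  have hap : 0 < √(α ^ 2 + 1) := by positivity
  have ha := sq_sqrt_sq_add_one α
  have hC := Real.cosh_pos (α * v)
  have hlt := lt_sqrt_sq_add_one α
  have hW2 := Real.sq_sqrt (show 0 ≤ Real.cosh (α * v) ^ 2 + X ^ 2 by positivity)
  have hCW : Real.cosh (α * v) ≤ √(Real.cosh (α * v) ^ 2 + X ^ 2) :=
    Real.le_sqrt_of_sq_le (by nlinarith [sq_nonneg X])
  rw [sqHeight_eq] at h
  obtain ⟨r, hr⟩ : ∃ r, r = √(α ^ 2 + 1) * √(Real.cosh (α * v) ^ 2 + X ^ 2)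
    - α * Real.cosh (α * v) := ⟨_, rfl⟩
  rw [← hr] at h
  have hr0 : 0 < r := by rw [hr]; nlinarith
  have hr2 : r ^ 2 = (α ^ 2 + 1) * X ^ 2 + α ^ 2 * t ^ 2 := by
    linear_combination X ^ 2 * ha - h
  have hW : (α * Real.cosh (α * v) + r) ^ 2
      = (α ^ 2 + 1) * (Real.cosh (α * v) ^ 2 + X ^ 2) := by
    rw [hr, add_sub_cancel, mul_pow, ha, hW2]
  have hq : Real.cosh (α * v) * (Real.cosh (α * v) - 2 * α * r) = α ^ 2 * t ^ 2 := by
    linear_combination hr2 - hW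
  have hle : 2 * α * r ≤ Real.cosh (α * v) := by
    have : 0 ≤ Real.cosh (α * v) * (Real.cosh (α * v) - 2 * α * r) := by rw [hq]; positivity
    linarith [nonneg_of_mul_nonneg_right this hC]
  refine ⟨r, hr0, hr2, ?_⟩
  have hnn : 0 ≤ Real.cosh (α * v) / α - r := by
    rw [sub_nonneg, le_div_iff₀ hα]
    nlinarith
  rw [Real.sqrt_eq_iff_mul_self_eq (by positivity) hnn]
  field_simp
  linear_combination -hq

lemma eq_sheetPoint (hα : 0 < α) (hφ : Function.Surjective φ) {p : HypProd}
    (hp : p ∈ horizontalCatenoid α φ) (hv : 0 < pointParam hα p.fst) :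
    sheetPoint (sheetShift α) (((Real.sinh (α * pointParam hα p.fst)
      / Real.cosh (α * pointParam hα p.fst) : ℝ) : ℂ) * ⟨axialSlope p.fst, p.snd⟩) = p := by
  rw [mem_horizontalCatenoid_iff' hα hφ] at hp
  obtain ⟨r, hr0, hr2, hs⟩ := sqrt_of_mul_sq_eq_sqHeight hα hp
  set v := pointParam hα p.fst with hvdef
  set X := axialSlope p.fst with hX
  set t := p.snd with ht
  have hC := Real.cosh_pos (α * v)
  have hS : 0 < Real.sinh (α * v) := Real.sinh_pos_iff.2 (by positivity)
  have hCS := Real.cosh_sq (α * v)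
  obtain ⟨k, hk⟩ : ∃ k, k = Real.sinh (α * v) / Real.cosh (α * v) := ⟨_, rfl⟩
  have hk0 : 0 < k := by rw [hk]; positivity
  rw [← hk]
  set ζ : ℂ := (k : ℂ) * ⟨X, t⟩ with hζ
  have hre : ζ.re = k * X := by simp [hζ]
  have him : ζ.im = k * t := by simp [hζ]
  have hrad : sheetRadius α⁻¹ ζ = k * r / α := by
    rw [sheetRadius, Real.sqrt_eq_iff_mul_self_eq (by positivity) (by positivity), hre, him]
    field_simp
    linear_combination -hr2
  have hsinh : sheetSinh α⁻¹ ζ = Real.sinh (α * v) / α ^ 2 := by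
    have h1 : √(sheetRadius α⁻¹ ζ ^ 2 + α⁻¹ ^ 2 * ζ.im ^ 2) = k / α * √(r ^ 2 + t ^ 2) := by
      rw [Real.sqrt_eq_iff_mul_self_eq (by positivity) (by positivity), hrad, him]
      have := Real.sq_sqrt (show 0 ≤ r ^ 2 + t ^ 2 by positivity)
      field_simp
      linear_combination -this
    rw [sheetSinh, h1, hrad, hs, hk]
    field_simp
    ring
  have hcoth : sheetCoth α⁻¹ ζ = k⁻¹ := by
    rw [sheetCoth, Real.sqrt_eq_iff_mul_self_eq (by positivity) (by positivity), hsinh, hk]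
    field_simp
    linear_combination -hCS
  have hζ0 : ζ ≠ 0 := by
    intro h0
    rw [sheetSinh, sheetRadius, h0] at hsinh
    have : 0 < Real.sinh (α * v) / α ^ 2 := by positivity
    simp at hsinh
    simp [← hsinh] at this
  have hparam : sheetParam α ζ = v := by
    rw [sheetParam, hsinh, mul_div_cancel₀ _ (by positivity), Real.arsinh_sinh,
      mul_div_cancel_left₀ _ hα.ne']
  refine HypProd.ext ?_ ?_
  · rw [sheetPoint_fst hα hζ0, hparam, hcoth, hre, mul_comm k, mul_inv_cancel_right₀ hk0.ne',
      hX, hvdef, paramPoint_pointParam]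
  · rw [sheetPoint_snd, hcoth, him, mul_comm k, mul_inv_cancel_right₀ hk0.ne']

lemma pointParam_sheetPoint (hα : 0 < α) {ζ : ℂ} (hζ : ζ ≠ 0) :
    pointParam hα (sheetPoint (sheetShift α) ζ).fst = sheetParam α ζ := by
  rw [sheetPoint_fst hα hζ, pointParam_paramPoint]

lemma injOn_sheetPoint (hα : 0 < α) :
    Set.InjOn (sheetPoint (sheetShift α)) {0}ᶜ := by
  intro ζ hζ ξ hξ h
  have hv : sheetParam α ζ = sheetParam α ξ := by
    rw [← pointParam_sheetPoint hα hζ, h, pointParam_sheetPoint hα hξ]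
  have hS : sheetSinh α⁻¹ ζ = sheetSinh α⁻¹ ξ := by
    have := congrArg (fun x => Real.sinh (α * x)) hv
    simp only [sinh_sheetParam hα] at this
    exact mul_left_cancel₀ (by positivity) this
  have hq : sheetCoth α⁻¹ ζ = sheetCoth α⁻¹ ξ := by rw [sheetCoth, sheetCoth, hS]
  have hq0 := (sheetCoth_pos α⁻¹ ξ).ne'
  have h1 := axialSlope_sheetPoint (sheetShift α) ζ
  have h2 := sheetPoint_snd α ζ
  rw [h, axialSlope_sheetPoint] at h1
  rw [h, sheetPoint_snd] at h2
  change ξ.re * sheetCoth α⁻¹ ξ = ζ.re * sheetCoth α⁻¹ ζ at h1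
  rw [hq] at h1 h2
  exact Complex.ext (mul_right_cancel₀ hq0 h1.symm) (mul_right_cancel₀ hq0 h2.symm)

lemma pointParam_reflectUnitCircle (hα : 0 < α) (p : HypProd) :
    pointParam hα (reflectUnitCircle p).fst = -pointParam hα p.fst := by
  rw [pointParam, slope_reflectUnitCircle, log_norm_reflectUnitCircle, conformalParam_neg,
    pointParam]

/-! ### Compact sets away from the contact point -/

/-- The pair (slope, height), as a complex number. -/
def slopeHeight (p : HypProd) : ℂ := ⟨axialSlope p.fst, p.snd⟩

lemma continuous_slopeHeight : Continuous slopeHeight := by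
  have h : Continuous fun p : HypProd => ((axialSlope p.fst : ℂ) + p.snd * Complex.I) := by
    have h1 := continuous_slope.comp (WithLp.continuous_fst 2 UpperHalfPlane ℝ)
    have h2 := WithLp.continuous_snd 2 UpperHalfPlane ℝ
    exact (Complex.continuous_ofReal.comp h1).add
      ((Complex.continuous_ofReal.comp h2).mul continuous_const)
  convert h using 2 with p
  exact Complex.mk_eq_add_mul_I _ _

lemma eq_contactPoint {p : HypProd} (h : slopeHeight p = 0) (hl : Real.log ‖(p.fst : ℂ)‖ = 0) :
    p = contactPoint := by
  have h1 : axialSlope p.fst = 0 := congrArg Complex.re h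
  have h2 : p.snd = 0 := congrArg Complex.im h
  refine HypProd.ext ?_ h2
  rw [← polarPoint_slope_log_norm p.fst, h1, hl]
  apply UpperHalfPlane.ext
  apply Complex.ext
  · rw [polarPoint_coe_re, zero_mul]
    rfl
  · rw [polarPoint_coe_im]
    simp [contactPoint]

/-- On the catenoid `cosh (α v)` is comparable to `α²` times the norm of (slope, height). -/
lemma cosh_bounds (hα : 1 ≤ α) {X v t : ℝ} (h : (α * t) ^ 2 = sqHeight α X v) :
    2 * α ^ 2 * ‖(⟨X, t⟩ : ℂ)‖ ≤ Real.cosh (α * v) ∧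
      Real.cosh (α * v) ≤ 5 * α ^ 2 * ‖(⟨X, t⟩ : ℂ)‖ := by
  have hα0 : 0 < α := by linarith
  obtain ⟨r, hr0, hr2, hs⟩ := sqrt_of_mul_sq_eq_sqHeight hα0 h
  have hn2 : ‖(⟨X, t⟩ : ℂ)‖ ^ 2 = X ^ 2 + t ^ 2 := by
    rw [Complex.sq_norm, Complex.normSq_apply]; ring
  have hn := norm_nonneg (⟨X, t⟩ : ℂ)
  set n := ‖(⟨X, t⟩ : ℂ)‖
  have h1 : α * n ≤ r := by
    rw [← sq_le_sq₀ (by positivity) hr0.le, mul_pow, hn2, hr2]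
    nlinarith [sq_nonneg X]
  have h2 : r ≤ √2 * (α * n) := by
    rw [← sq_le_sq₀ hr0.le (by positivity), mul_pow, mul_pow, hn2, hr2,
      Real.sq_sqrt (by norm_num)]
    have : 1 ≤ α ^ 2 := by nlinarith
    nlinarith [mul_nonneg (sub_nonneg.2 this) (sq_nonneg X), sq_nonneg (α * t)]
  have h3 : r ≤ √(r ^ 2 + t ^ 2) := Real.le_sqrt_of_sq_le (by nlinarith [sq_nonneg t])
  have h4 : √(r ^ 2 + t ^ 2) ≤ r + n := by
    rw [Real.sqrt_le_left (by positivity)]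
    nlinarith [sq_nonneg X, mul_nonneg hr0.le hn]
  have hC : Real.cosh (α * v) = α * (r + √(r ^ 2 + t ^ 2)) := by
    rw [hs]; field_simp; ring
  have h5 : √2 ≤ 2 := by rw [Real.sqrt_le_left (by norm_num)]; norm_num
  constructor
  · rw [hC]
    nlinarith
  · have h6 : r ≤ 2 * (α * n) := h2.trans (by gcongr)
    rw [hC]
    nlinarith [mul_nonneg (sub_nonneg.2 hα) hn]

lemma logRadius_le (α X v : ℝ) :
    logRadius α X v ≤ (√(α ^ 2 + 1) - α) * v + X ^ 2 / 2 := by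
  have h := exp_logRadius α X v
  rw [div_eq_iff (by positivity)] at h
  rw [← Real.exp_le_exp, h, Real.exp_add, sub_mul, Real.exp_sub]
  have h1 : √(1 + X ^ 2) ≤ Real.exp (X ^ 2 / 2) := by
    rw [Real.sqrt_le_left (Real.exp_pos _).le, ← Real.exp_nat_mul]
    have := Real.add_one_le_exp (X ^ 2)
    push_cast
    rw [mul_div_cancel₀ _ two_ne_zero]
    linarith
  have h2 : Real.exp (α * v) ≤ Real.sinh (α * v) + √(Real.cosh (α * v) ^ 2 + X ^ 2) := by
    rw [← Real.sinh_add_cosh]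
    gcongr
    exact Real.le_sqrt_of_sq_le (by nlinarith [sq_nonneg X])
  gcongr

/-- Near a fixed compact set that avoids the contact point, the half `v ≥ 0` of the catenoid is
parametrised by a fixed compact subset of `ℂ ∖ {0}`. If slope and height are not small, then
`cosh (α v)` is large and `tanh (α v)` is close to `1`; if both are small, then so is `log |z|`,
because `v` is at most of the order of `(log α) / α`. -/
lemma exists_compact_sheet {φ : ℝ → ℝ → ℝ} (hφ : ∀ α, 0 < α → Function.Surjective (φ α))
    {K : Set HypProd} (hK : IsCompact K) (ho : contactPoint ∉ K) :
    ∃ L : Set ℂ, IsCompact L ∧ L ⊆ {0}ᶜ ∧ ∀ᶠ α in Filter.atTop,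
      ∀ p ∈ horizontalCatenoid α (φ α) ∩ K, 0 ≤ Real.log ‖(p.fst : ℂ)‖ →
        ∃ ζ ∈ L, sheetPoint (sheetShift α) ζ = p := by
  have hlog : Continuous fun p : HypProd => Real.log ‖(p.fst : ℂ)‖ :=
    continuous_log_norm.comp (WithLp.continuous_fst 2 _ _)
  obtain ⟨δ₀, hδ₀, hmin⟩ := hK.exists_forall_le' (a := 0)
    (continuous_slopeHeight.norm.add hlog.abs).continuousOn fun p hp => by
      by_contra hle
      have h1 := norm_nonneg (slopeHeight p)
      have h2 := abs_nonneg (Real.log ‖(p.fst : ℂ)‖)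
      simp only [Pi.add_apply, not_lt] at hle
      refine ho (eq_contactPoint (p := p) ?_ ?_ ▸ hp)
      · exact norm_eq_zero.1 (by linarith)
      · exact abs_eq_zero.1 (by linarith)
  obtain ⟨R, hR⟩ := hK.exists_bound_of_continuousOn continuous_slopeHeight.continuousOn
  obtain ⟨δ, hδ⟩ : ∃ δ, δ = min 1 (δ₀ / 3) := ⟨_, rfl⟩
  have hδpos : 0 < δ := by rw [hδ]; positivity
  have hδ1 : δ ≤ 1 := by rw [hδ]; exact min_le_left _ _
  have hδ2 : δ ≤ δ₀ / 3 := by rw [hδ]; exact min_le_right _ _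
  refine ⟨Metric.closedBall 0 R ∩ {ζ | δ / 2 ≤ ‖ζ‖},
    (isCompact_closedBall _ _).inter_right (isClosed_le continuous_const continuous_norm), ?_, ?_⟩
  · rintro ζ ⟨-, hζ⟩ rfl
    have : δ / 2 ≤ ‖(0 : ℂ)‖ := hζ
    rw [norm_zero] at this
    linarith
  filter_upwards [Filter.eventually_ge_atTop 1, Filter.eventually_gt_atTop (8 / δ₀),
    Filter.eventually_ge_atTop (1 / δ)] with α hα1 hα2 hα3 p hp hl
  have hα : 0 < α := by linarith
  have hmem := (mem_horizontalCatenoid_iff' hα (hφ α hα) p).1 hp.1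
  obtain ⟨hC1, hC2⟩ := cosh_bounds hα1 hmem
  have hlr : logRadius α (axialSlope p.fst) (pointParam hα p.fst) = Real.log ‖(p.fst : ℂ)‖ :=
    logRadius_conformalParam hα _ _
  have hv : 0 ≤ pointParam hα p.fst := by
    rw [← (logRadius_strictMono hα (axialSlope p.fst)).le_iff_le, logRadius_zero, hlr]
    exact hl
  have hsn : ‖slopeHeight p‖ = ‖(⟨axialSlope p.fst, p.snd⟩ : ℂ)‖ := rfl
  have hXn : |axialSlope p.fst| ≤ ‖slopeHeight p‖ := Complex.abs_re_le_norm (slopeHeight p)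
  have hmin := hmin p hp.2
  simp only [Pi.add_apply, abs_of_nonneg hl] at hmin
  rw [← hsn] at hC1 hC2
  set n := ‖slopeHeight p‖ with hn
  have hn0 : 0 ≤ n := norm_nonneg _
  set v := pointParam hα p.fst with hvdef
  have hCpos := Real.cosh_pos (α * v)
  have hlarge : δ ≤ n := by
    by_contra! hlt
    -- slope and height are small, hence so is `log |z|`
    have h1 : √(α ^ 2 + 1) - α ≤ 1 / (2 * α) := by
      rw [sub_le_iff_le_add, Real.sqrt_le_left (by positivity)]
      field_simp
      nlinarith [sq_nonneg (α ^ 2)]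
    have h2 : α * v ≤ 8 * α := by
      have h3 : Real.exp (α * v) ≤ (4 * α) ^ 2 := by
        have h4 := Real.exp_pos (-(α * v))
        have h5 : Real.exp (α * v) ≤ 2 * Real.cosh (α * v) := by
          rw [Real.cosh_eq]; linarith
        nlinarith [sq_nonneg α]
      have h6 := Real.log_le_log (Real.exp_pos _) h3
      rw [Real.log_exp, Real.log_pow] at h6
      have h7 := Real.log_le_sub_one_of_pos (show 0 < 4 * α by positivity)
      push_cast at h6
      linarith
    have h3 : (√(α ^ 2 + 1) - α) * v ≤ 4 / α := by
      calc _ ≤ 1 / (2 * α) * v := by gcongr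
        _ = 1 / (2 * α ^ 2) * (α * v) := by field_simp
        _ ≤ 1 / (2 * α ^ 2) * (8 * α) := by gcongr
        _ = 4 / α := by field_simp; norm_num
    have h4 : 4 / α < δ₀ / 2 := by
      rw [div_lt_iff₀ hδ₀] at hα2
      rw [div_lt_iff₀ hα]
      linarith
    have h5 := logRadius_le α (axialSlope p.fst) v
    rw [hlr] at h5
    have h6 : axialSlope p.fst ^ 2 ≤ δ := by
      rw [← sq_abs]
      nlinarith [abs_nonneg (axialSlope p.fst)]
    linarith
  have hC3 : 2 ≤ Real.cosh (α * v) := by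
    have h1 : 1 ≤ α * δ := by rw [div_le_iff₀ hδpos] at hα3; linarith
    have h2 : 1 ≤ α ^ 2 * n := by nlinarith [mul_nonneg hα.le hδpos.le]
    linarith
  have hvpos : 0 < v := by
    refine lt_of_le_of_ne hv fun h0 => ?_
    rw [← h0, mul_zero, Real.cosh_zero] at hC3
    linarith
  have hS : 0 < Real.sinh (α * v) := Real.sinh_pos_iff.2 (by positivity)
  have hCS := Real.cosh_sq (α * v)
  refine ⟨_, ⟨?_, ?_⟩, eq_sheetPoint hα (hφ α hα) hp.1 hvpos⟩
  · rw [mem_closedBall_zero_iff, norm_mul, Complex.norm_real, Real.norm_of_nonneg (by positivity)]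
    calc _ ≤ 1 * n := by
          refine mul_le_mul ?_ hsn.symm.le (norm_nonneg _) zero_le_one
          rw [div_le_one hCpos]
          exact (Real.sinh_lt_cosh _).le
      _ ≤ R := by rw [one_mul]; exact hR p hp.2
  · change δ / 2 ≤ ‖_‖
    rw [norm_mul, Complex.norm_real, Real.norm_of_nonneg (by positivity), ← hsn]
    have h1 : 1 / 2 ≤ Real.sinh (α * v) / Real.cosh (α * v) := by
      rw [div_le_div_iff₀ two_pos hCpos]
      nlinarith
    nlinarith

end

/-! ### The limit -/

/-- The reflection in the vertical plane over `{|z| = 1}`, in coordinates. -/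
def reflectCoords (q : Fin 3 → ℝ) : Fin 3 → ℝ :=
  ![q 0 / (q 0 ^ 2 + q 1 ^ 2), q 1 / (q 0 ^ 2 + q 1 ^ 2), q 2]

lemma coords_reflectUnitCircle (p : HypProd) :
    coords (reflectUnitCircle p) = reflectCoords (coords p) := by
  have hn : Complex.normSq (p.fst : ℂ) = p.fst.re ^ 2 + p.fst.im ^ 2 := by
    rw [Complex.normSq_apply]; simp [sq]
  ext i
  fin_cases i
  · change ((starRingEnd ℂ (p.fst : ℂ))⁻¹).re = p.fst.re / (p.fst.re ^ 2 + p.fst.im ^ 2)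
    rw [Complex.inv_re, Complex.normSq_conj, hn]
    simp
  · change ((starRingEnd ℂ (p.fst : ℂ))⁻¹).im = p.fst.im / (p.fst.re ^ 2 + p.fst.im ^ 2)
    rw [Complex.inv_im, Complex.normSq_conj, hn]
    simp
  · rfl

lemma contDiffAt_reflectCoords {q : Fin 3 → ℝ} (hq : 0 < q 1) :
    ContDiffAt ℝ ∞ reflectCoords q := by
  have h : q 0 ^ 2 + q 1 ^ 2 ≠ 0 := by positivity
  unfold reflectCoords
  rw [contDiffAt_pi]
  intro i
  have h0 : ContDiffAt ℝ ∞ (fun q : Fin 3 → ℝ => q 0) q := (contDiff_apply ℝ ℝ 0).contDiffAt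
  have h1 : ContDiffAt ℝ ∞ (fun q : Fin 3 → ℝ => q 1) q := (contDiff_apply ℝ ℝ 1).contDiffAt
  fin_cases i
  · exact h0.div ((h0.pow 2).add (h1.pow 2)) h
  · exact h1.div ((h0.pow 2).add (h1.pow 2)) h
  · exact (contDiff_apply ℝ ℝ 2).contDiffAt

/-- The two sheets of the catenoid: the half `v > 0` and its mirror image. -/
def sheetPair : Fin 2 → ℝ × ℝ → ℂ → HypProd :=
  ![sheetPoint, fun p ζ => reflectUnitCircle (sheetPoint p ζ)]

lemma contDiffOn_sheetPair (i : Fin 2) : ContDiffOn ℝ ∞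
    (fun x : (ℝ × ℝ) × ℂ => coords (sheetPair i x.1 x.2)) (Set.univ ×ˢ {0}ᶜ) := by
  fin_cases i
  · exact contDiffOn_sheet
  · change ContDiffOn ℝ ∞ (fun x : (ℝ × ℝ) × ℂ => coords (reflectUnitCircle (sheetPoint x.1 x.2))) _
    simp only [coords_reflectUnitCircle]
    intro x hx
    exact ContDiffAt.comp_contDiffWithinAt x (contDiffAt_reflectCoords (sheetIm_pos _ _))
      (contDiffOn_sheet x hx)

lemma coords_sheetPoint_zero (ζ : ℂ) : coords (sheetPoint 0 ζ) = ![ζ.re, 1, ζ.im] := by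
  have h1 : sheetCoth 0 ζ = 1 := by simp [sheetCoth]
  have h2 : sheetIm 0 ζ = 1 := by simp [sheetIm, h1]
  rw [coords_sheetPoint, h2]
  simp [h1]

lemma isConformalImmersionOn_sheetPoint_zero :
    IsConformalImmersionOn hypProdMetric (fun z => coords (sheetPoint 0 z)) {0}ᶜ := by
  have h : HasPartials (fun z => coords (sheetPoint 0 z)) (fun _ => ![1, 0, 0])
      (fun _ => ![0, 0, 1]) := by
    simp only [coords_sheetPoint_zero]
    refine ⟨?_, fun z i => ?_, fun z i => ?_⟩
    · rw [contDiff_pi]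
      intro i
      fin_cases i
      · exact Complex.reCLM.contDiff
      · exact contDiff_const
      · exact Complex.imCLM.contDiff
    · fin_cases i
      · exact hasDerivAt_id _
      · exact hasDerivAt_const _ _
      · exact hasDerivAt_const _ _
    · fin_cases i
      · exact hasDerivAt_const _ _
      · exact hasDerivAt_const _ _
      · exact hasDerivAt_id _
  refine isConformalImmersionOn_of_firstForm (E := fun _ => 1) h.contDiff.contDiffOn
    (fun _ _ => one_pos) fun z _ a b => ?_
  rw [firstForm, h.fderiv_apply, h.fderiv_apply, metricInner_hypProdMetric, coords_sheetPoint_zero]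
  simp

lemma isConformalImmersionOn_reflectUnitCircle_sheetPoint_zero :
    IsConformalImmersionOn hypProdMetric
      (fun z => coords (reflectUnitCircle (sheetPoint 0 z))) {0}ᶜ := by
  have hX : ∀ z, coords (reflectUnitCircle (sheetPoint 0 z))
      = ![z.re / (z.re ^ 2 + 1), 1 / (z.re ^ 2 + 1), z.im] := fun z => by
    rw [coords_reflectUnitCircle, coords_sheetPoint_zero, reflectCoords]
    simp
  have h : HasPartials (fun z => coords (reflectUnitCircle (sheetPoint 0 z)))
      (fun z => ![(1 - z.re ^ 2) / (z.re ^ 2 + 1) ^ 2, -2 * z.re / (z.re ^ 2 + 1) ^ 2, 0])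
      (fun _ => ![0, 0, 1]) := by
    simp only [hX]
    refine ⟨?_, fun z i => ?_, fun z i => ?_⟩
    · have h1 : ContDiff ℝ ∞ fun z : ℂ => z.re := Complex.reCLM.contDiff
      have h2 : ContDiff ℝ ∞ fun z : ℂ => z.re ^ 2 + 1 := (h1.pow 2).add contDiff_const
      have h3 : ∀ z : ℂ, z.re ^ 2 + 1 ≠ 0 := fun z => by positivity
      rw [contDiff_pi]
      intro i
      fin_cases i
      · exact h1.div h2 h3
      · exact contDiff_const.div h2 h3
      · exact Complex.imCLM.contDiff
    · have h2 : HasDerivAt (fun u : ℝ => u ^ 2 + 1) (2 * z.re) z.re := by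
        simpa using (hasDerivAt_pow 2 z.re).add_const 1
      have h3 : z.re ^ 2 + 1 ≠ 0 := by positivity
      fin_cases i
      · refine ((hasDerivAt_id z.re).fun_div h2 h3).congr_deriv ?_
        simp only [id, Fin.zero_eta, Matrix.cons_val_zero]
        ring
      · refine ((hasDerivAt_const z.re (1 : ℝ)).fun_div h2 h3).congr_deriv ?_
        simp
      · exact hasDerivAt_const _ _
    · fin_cases i
      · exact hasDerivAt_const _ (z.re / (z.re ^ 2 + 1))
      · exact hasDerivAt_const _ (1 / (z.re ^ 2 + 1))
      · exact hasDerivAt_id _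
  refine isConformalImmersionOn_of_firstForm (E := fun _ => 1) h.contDiff.contDiffOn
    (fun _ _ => one_pos) fun z _ a b => ?_
  rw [firstForm, h.fderiv_apply, h.fderiv_apply, metricInner_hypProdMetric, hX]
  simp
  field_simp
  ring

lemma slopeHeight_reflectUnitCircle (p : HypProd) :
    slopeHeight (reflectUnitCircle p) = slopeHeight p := by
  rw [slopeHeight, slope_reflectUnitCircle]
  rfl

/-- The limit sheets are parametrised by slope and height, which gives a continuous inverse. -/
lemma slopeHeight_sheetPair_zero (i : Fin 2) (ζ : ℂ) : slopeHeight (sheetPair i 0 ζ) = ζ := by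
  have h : slopeHeight (sheetPoint 0 ζ) = ζ := by
    have h1 : sheetCoth (0 : ℝ × ℝ).1 ζ = 1 := by simp [sheetCoth]
    rw [slopeHeight, axialSlope_sheetPoint, h1, mul_one]
    change (⟨ζ.re, ζ.im * sheetCoth (0 : ℝ × ℝ).1 ζ⟩ : ℂ) = ζ
    rw [h1, mul_one]
  fin_cases i
  · exact h
  · exact (slopeHeight_reflectUnitCircle _).trans h

lemma continuous_reflectUnitCircle : Continuous reflectUnitCircle := by
  have h1 := WithLp.continuous_fst 2 UpperHalfPlane ℝ
  have h2 := WithLp.continuous_snd 2 UpperHalfPlane ℝ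
  refine (WithLp.prod_continuous_toLp 2 _ _).comp (Continuous.prodMk ?_ h2)
  rw [UpperHalfPlane.isEmbedding_coe.continuous_iff]
  exact (Complex.continuous_conj.comp (UpperHalfPlane.continuous_coe.comp h1)).inv₀ fun p => by
    simp [p.fst.ne_zero]

lemma continuous_sheetPair_zero (i : Fin 2) : Continuous (sheetPair i 0) := by
  have h : Continuous (sheetPoint 0) := by
    have h0 : ∀ ζ, sheetPoint 0 ζ
        = WithLp.toLp 2 ((⟨⟨ζ.re, 1⟩, one_pos⟩ : UpperHalfPlane), ζ.im) := fun ζ =>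
      coords_injective (coords_sheetPoint_zero ζ)
    simp only [funext h0]
    refine (WithLp.prod_continuous_toLp 2 _ _).comp (Continuous.prodMk ?_ Complex.continuous_im)
    rw [UpperHalfPlane.isEmbedding_coe.continuous_iff]
    change Continuous fun ζ : ℂ => (⟨ζ.re, 1⟩ : ℂ)
    simp only [Complex.mk_eq_add_mul_I]
    fun_prop
  fin_cases i
  · exact h
  · exact continuous_reflectUnitCircle.comp h

lemma reflectUnitCircle_mem_horocylinder (p : HypProd) :
    p ∈ horocylinder 1 ↔ reflectUnitCircle p ∈ horocylinder 0 := by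
  have him : (reflectUnitCircle p).fst.im = p.fst.im / (p.fst.re ^ 2 + p.fst.im ^ 2) :=
    congrFun (coords_reflectUnitCircle p) 1
  change ‖(p.fst : ℂ) - Complex.I / 2‖ = 1 / 2 ↔ (reflectUnitCircle p).fst.im = 1
  have hy := p.fst.im_pos
  have hn : ‖(p.fst : ℂ) - Complex.I / 2‖ ^ 2 = p.fst.re ^ 2 + (p.fst.im - 1 / 2) ^ 2 := by
    rw [Complex.sq_norm, Complex.normSq_apply]
    simp
    ring
  rw [him, div_eq_one_iff_eq (by positivity), ← sq_eq_sq₀ (norm_nonneg _) (by norm_num), hn]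
  constructor <;> intro h <;> linarith

lemma reflectUnitCircle_contactPoint : reflectUnitCircle contactPoint = contactPoint := by
  apply coords_injective
  rw [coords_reflectUnitCircle]
  ext i
  fin_cases i <;> simp [coords, contactPoint, reflectCoords]

lemma image_sheetPoint_zero : sheetPoint 0 '' {0}ᶜ = horocylinder 0 \ {contactPoint} := by
  ext p
  constructor
  · rintro ⟨ζ, hζ, rfl⟩
    refine ⟨congrFun (coords_sheetPoint_zero ζ) 1, fun h => hζ ?_⟩
    have h1 := slopeHeight_sheetPair_zero 0 ζ
    change slopeHeight (sheetPoint 0 ζ) = ζ at h1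
    rw [h] at h1
    rw [Set.mem_singleton_iff, ← h1]
    apply Complex.ext <;> simp [slopeHeight, contactPoint, axialSlope]
  · rintro ⟨h1, h2⟩
    have h1 : p.fst.im = 1 := h1
    have h3 : sheetPoint 0 ⟨p.fst.re, p.snd⟩ = p := by
      apply coords_injective
      rw [coords_sheetPoint_zero, coords, h1]
    refine ⟨⟨p.fst.re, p.snd⟩, fun h => h2 ?_, h3⟩
    rw [Set.mem_singleton_iff] at h ⊢
    rw [← h3, h]
    apply coords_injective
    rw [coords_sheetPoint_zero]
    ext i
    fin_cases i <;> simp [coords, contactPoint]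

lemma image_sheetPair_zero (i : Fin 2) :
    sheetPair i 0 '' {0}ᶜ = horocylinder i \ {contactPoint} := by
  fin_cases i
  · exact image_sheetPoint_zero
  · change (fun ζ => reflectUnitCircle (sheetPoint 0 ζ)) '' {0}ᶜ = horocylinder 1 \ {contactPoint}
    rw [← Set.image_image reflectUnitCircle, image_sheetPoint_zero,
      Set.image_eq_preimage_of_inverse reflectUnitCircle_reflectUnitCircle
      reflectUnitCircle_reflectUnitCircle]
    ext p
    rw [Set.mem_preimage, Set.mem_sdiff, Set.mem_sdiff, reflectUnitCircle_mem_horocylinder p,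
      Set.mem_singleton_iff, Set.mem_singleton_iff]
    refine and_congr_right fun _ => not_congr ⟨fun h => ?_, fun h => ?_⟩
    · rw [← reflectUnitCircle_reflectUnitCircle p, h, reflectUnitCircle_contactPoint]
    · rw [h, reflectUnitCircle_contactPoint]

section

variable {α : ℝ} {φ : ℝ → ℝ}

lemma sheetPair_mem (hα : 0 < α) (hφ : Function.Surjective φ) (i : Fin 2) {ζ : ℂ} (hζ : ζ ≠ 0) :
    sheetPair i (sheetShift α) ζ ∈ horizontalCatenoid α φ := by
  have h := sheetPoint_mem hα hφ hζ
  fin_cases i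
  · exact h
  · rw [← reflectUnitCircle_image hα hφ]
    exact ⟨_, h, rfl⟩

/-- The two sheets are embedded and disjoint, as `v` is positive on one and negative on the
other. -/
lemma sheetPair_injective (hα : 0 < α) {i j : Fin 2} {ζ ξ : ℂ} (hζ : ζ ≠ 0) (hξ : ξ ≠ 0)
    (h : sheetPair i (sheetShift α) ζ = sheetPair j (sheetShift α) ξ) : i = j ∧ ζ = ξ := by
  have hp : ∀ {ζ : ℂ}, ζ ≠ 0 → 0 < pointParam hα (sheetPair 0 (sheetShift α) ζ).fst :=
    fun {ζ} hζ => (pointParam_sheetPoint hα hζ).symm ▸ sheetParam_pos hα hζ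
  have hn : ∀ {ζ : ℂ}, ζ ≠ 0 → pointParam hα (sheetPair 1 (sheetShift α) ζ).fst < 0 :=
    fun {ζ} hζ => (pointParam_reflectUnitCircle hα _).trans_lt (neg_neg_of_pos (hp hζ))
  fin_cases i <;> fin_cases j
  · exact ⟨rfl, injOn_sheetPoint hα hζ hξ h⟩
  · have h1 := hp hζ
    exact absurd (h1.trans_eq (congrArg (fun p : HypProd => pointParam hα p.fst) h)) (hn hξ).not_gt
  · have h1 := hn hζ
    exact absurd ((congrArg (fun p : HypProd => pointParam hα p.fst) h).symm.trans_lt h1)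
      (hp hξ).not_gt
  · refine ⟨rfl, injOn_sheetPoint hα hζ hξ ?_⟩
    have := congrArg reflectUnitCircle h
    change reflectUnitCircle (reflectUnitCircle _) = reflectUnitCircle (reflectUnitCircle _) at this
    rwa [reflectUnitCircle_reflectUnitCircle, reflectUnitCircle_reflectUnitCircle] at this

end

/-- The catenoids converge to the two horocylinders punctured at the contact point. -/
lemma convergesToPunctured {φ : ℝ → ℝ → ℝ} (hφ : ∀ α, 0 < α → Function.Surjective (φ α)) :
    ConvergesToPunctured (fun α => horizontalCatenoid α (φ α)) horocylinder contactPoint := by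
  refine ⟨fun i => sheetPair i 0, fun i α => sheetPair i (sheetShift α), fun i => ⟨?_, ?_, ?_⟩,
    fun i => .of_forall fun α => ?_, fun i k => ?_, fun L hL hL0 => ?_, fun K hK ho => ?_⟩
  · fin_cases i
    · exact isConformalImmersionOn_sheetPoint_zero
    · exact isConformalImmersionOn_reflectUnitCircle_sheetPoint_zero
  · exact (Function.LeftInverse.isEmbedding (slopeHeight_sheetPair_zero i) continuous_slopeHeight
      (continuous_sheetPair_zero i)).comp Topology.IsEmbedding.subtypeVal
  · exact image_sheetPair_zero i
  · exact (contDiffOn_sheetPair i).comp (f := fun ζ => (sheetShift α, ζ)) (by fun_prop)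
      fun ζ hζ => ⟨Set.mem_univ _, hζ⟩
  · exact tendstoLocallyUniformlyOn_iteratedFDeriv isOpen_compl_singleton
      (contDiffOn_sheetPair i) k tendsto_sheetShift
  · filter_upwards [Filter.eventually_gt_atTop 0] with α hα
    refine ⟨fun i => ?_, fun i j z hz w hw h => sheetPair_injective hα (hL0 hz) (hL0 hw) h⟩
    rintro _ ⟨ζ, hζ, rfl⟩
    exact sheetPair_mem hα (hφ α hα) i (hL0 hζ)
  · -- the reflection reduces the half `v ≤ 0` to the half `v ≥ 0`
    have ho' : contactPoint ∉ K ∪ reflectUnitCircle '' K := by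
      rintro (h | ⟨p, hp, hpo⟩)
      · exact ho h
      · rw [← reflectUnitCircle_contactPoint] at hpo
        have := congrArg reflectUnitCircle hpo
        rw [reflectUnitCircle_reflectUnitCircle, reflectUnitCircle_reflectUnitCircle] at this
        exact ho (this ▸ hp)
    obtain ⟨L, hL, hL0, hev⟩ := exists_compact_sheet hφ
      (hK.union (hK.image continuous_reflectUnitCircle)) ho'
    refine ⟨L, hL, hL0, ?_⟩
    filter_upwards [hev, Filter.eventually_gt_atTop 0] with α hα hα0
    rintro p ⟨hpC, hpK⟩
    rw [Set.mem_iUnion]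
    rcases le_total 0 (Real.log ‖(p.fst : ℂ)‖) with hl | hl
    · obtain ⟨ζ, hζ, h⟩ := hα p ⟨hpC, Or.inl hpK⟩ hl
      exact ⟨0, ζ, hζ, h⟩
    · obtain ⟨ζ, hζ, h⟩ := hα (reflectUnitCircle p)
        ⟨by rw [← reflectUnitCircle_image hα0 (hφ α hα0)]; exact ⟨p, hpC, rfl⟩,
          Or.inr ⟨p, hpK, rfl⟩⟩
        (by rw [log_norm_reflectUnitCircle]; linarith)
      refine ⟨1, ζ, hζ, ?_⟩
      change reflectUnitCircle (sheetPoint (sheetShift α) ζ) = p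
      rw [h, reflectUnitCircle_reflectUnitCircle]

end

theorem mainTheorem7 :
    ∃ φ : ℝ → ℝ → ℝ,
      (∀ α : ℝ, 0 < α →
        IsProfile α (φ α) ∧
        AreSisterImmersions (helicoidParam α (φ α)) (catenoidParam α (φ α)) ∧
        IsProperlyEmbeddedCMCPuncturedPlane (1 / 2) (horizontalCatenoid α (φ α)) ∧
        reflectHorizontal '' horizontalCatenoid α (φ α) = horizontalCatenoid α (φ α) ∧
        reflectImAxis '' horizontalCatenoid α (φ α) = horizontalCatenoid α (φ α) ∧
        reflectUnitCircle '' horizontalCatenoid α (φ α) = horizontalCatenoid α (φ α) ∧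
        (∃ Ω : Set UpperHalfPlane, IsOpen Ω ∧ IsConnected Ω ∧
          IsBigraphOver Ω (horizontalCatenoid α (φ α))) ∧
        ¬ IsInvariantUnderOneParameterGroup (horizontalCatenoid α (φ α))) ∧
      ConvergesToPunctured (fun α => horizontalCatenoid α (φ α)) horocylinder contactPoint := by
  choose! φ hφ hsurj hper using fun (α : ℝ) (hα : 0 < α) => exists_isProfile hα
  refine ⟨φ, fun α hα => ?_, convergesToPunctured hsurj⟩
  obtain ⟨P, hP, hφP⟩ := hper α hα
  exact ⟨hφ α hα, areSisterImmersions hα (hφ α hα),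
    isProperlyEmbeddedCMCPuncturedPlane hα (hφ α hα) hP hφP,
    reflectHorizontal_image hα (hsurj α hα), reflectImAxis_image hα (hsurj α hα),
    reflectUnitCircle_image hα (hsurj α hα),
    ⟨bigraphDomain hα, isOpen_bigraphDomain hα, isConnected_bigraphDomain hα,
      isBigraphOver_bigraphDomain hα (hsurj α hα)⟩,
    not_isInvariantUnderOneParameterGroup hα (hsurj α hα)⟩
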